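/- **Setting.** Let $n\ge 8$, $p\in[1,2]$, $q\in[2,\infty]$ with $\frac1p+\frac1q=1$, and $\rho_n=\min\{q-1,\,16\ln n-8\}\,n^{2/q-1}$. Let $d:\mathbb R^n\to\mathbb R$ be a prox-function, i.e. differentiable with $V[z](x):=d(x)-d(z)-\langle\nabla d(z),x-z\rangle\ge\frac12\|x-z\|_p^2$ for all $x,z$. Consider $\min_{x\in\mathbb R^n} f(x)$, $f(x)=\mathbb E_\xi F(x,\xi)$, $\xi\sim P$, where $f$ is finite and convex with a minimizer $x^*$; for $P$-almost every $\xi$ the function $F(\cdot,\xi)$ has a gradient $g(\cdot,\xi)$ that is $L(\xi)$-Lipschitz in the Euclidean norm, with $0<L_2:=\sqrt{\mathbb E L(\xi)^2}<\infty$; and $\mathbb E_\xi\|g(x,\xi)-\nabla f(x)\|_2^2\le\sigma^2$ for all $x$. One oracle call at a pair $(x,y)$ draws $\xi\sim P$ and returns $(\tilde f(x,\xi),\tilde f(y,\xi))$, where $\tilde f=F+\eta$ with an arbitrary (measurable) noise $\eta$ such that, for every $x$, $|\eta(x,\xi)|\le\Delta$ almost surely. **ARDFDS** with starting point $x_0$,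 batch size $m$, smoothing parameter $t>0$ and stepsizes $\alpha_k$: put $y_0=z_0=x_0$; for $k=0,\dots,N-1$ draw $e_{k+1}$ uniformly on the unit Euclidean sphere and $\xi_1,\dots,\xi_m\sim P$, all independent of each other and of the past, and set $\tau_k=\frac2{k+2}$, $x_{k+1}=\tau_kz_k+(1-\tau_k)y_k$, $G=\frac1m\sum_{i=1}^m\frac{\tilde f(x_{k+1}+te_{k+1},\xi_i)-\tilde f(x_{k+1},\xi_i)}{t}e_{k+1}$ (which takes $m$ oracle calls), $y_{k+1}=x_{k+1}-\frac1{2L_2}G$, $z_{k+1}=\arg\min_z\{\alpha_{k+1}n\langle G,z-z_k\rangle+V[z_k](z)\}$. Let $\Theta_p=V[x_0](x^*)$ and $\alpha_{k+1}=\frac{k+2}{96n^2\rho_nL_2}$. **Corollary 1.** (a) There are absolute constants $A,B,c,K>0$ such that in this setting, for every $\varepsilon>0$ and every $x_0$, if $$N=\Big\lfloor A\sqrt{\tfrac{n^2\rho_nL_2\Theta_p}{\varepsilon}}\Big\rfloor,\quad m=\Big\lceil B\max\Big\{1,\tfrac{\sigma^2}{\varepsilon^{3/2}}\sqrt{\tfrac{\rho_n\Theta_p}{L_2}}\Big\}\Big\rceil,\quad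 0<\Delta\le c\,\min\Big\{\tfrac{\varepsilon^2}{nL_2\Theta_p},\tfrac{\varepsilon^{3/2}}{\sqrt{n^2\rho_nL_2\Theta_p}}\Big\},\quad t=2\sqrt{\tfrac{\Delta}{L_2}}$$ (no upper bound on $\Delta$ when $\Theta_p=0$), then $\mathbb E f(y_N)$ is finite and $$\mathbb E f(y_N)-f(x^*)\le\varepsilon .$$ Moreover $N\le K\sqrt{n^2\rho_nL_2\Theta_p/\varepsilon}$, $1\le m\le K\max\{1,\frac{\sigma^2}{\varepsilon^{3/2}}\sqrt{\rho_n\Theta_p/L_2}\}$, $t\le K\min\{\frac{\varepsilon}{L_2\sqrt{n\Theta_p}},\frac{\varepsilon^{3/4}}{(n^2\rho_nL_2^3\Theta_p)^{1/4}}\}$ (no bound on $t$ is claimed when $\Theta_p=0$), and the total number of oracle calls equals $$Nm\le K\max\Big\{\sqrt{\tfrac{n^2\rho_nL_2\Theta_p}{\varepsilon}},\ \tfrac{n\rho_n\sigma^2\Theta_p}{\varepsilon^2}\Big\}.$$ If in addition either $p=2$ and $d(x)=\frac12\|x\|_2^2$, or $p=1$ and $d(x)=\frac{\mathrm e\,n^{(\kappa-1)(2-\kappa)/\kappa}\ln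 n}{2}\|x-x_0\|_\kappa^2$ with $\kappa=1+\frac1{\ln n}$, then with $R_p=\|x_0-x^*\|_p$ $$Nm\le K(\ln n)^2\max\Big\{n^{\frac12+\frac1q}\sqrt{\tfrac{L_2R_p^2}{\varepsilon}},\ \tfrac{n^{2/q}\sigma^2R_p^2}{\varepsilon^2}\Big\}.$$ (b) For $n\ge8$ and every $c\in\mathbb R^n$, the function $x\mapsto\frac{\mathrm e\,n^{(\kappa-1)(2-\kappa)/\kappa}\ln n}{2}\|x-c\|_\kappa^2$ is a prox-function for $p=1$, and $\frac12\|x\|_2^2$ is one for $p=2$. -/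

import Mathlib

open MeasureTheory ProbabilityTheory

noncomputable section

namespace ARDFDS

/-- `ℝⁿ` with its Euclidean norm and inner product. -/
abbrev E (n : ℕ) : Type := EuclideanSpace ℝ (Fin n)

/-- The `p`-norm of a vector of `ℝⁿ`. -/
def pNorm {n : ℕ} (p : ENNReal) (x : E n) : ℝ :=
  ‖(WithLp.toLp p (fun i => x i) : PiLp p (fun _ : Fin n => ℝ))‖

/-- `ρ_n = min {q - 1, 16 ln n - 8} * n ^ (2 / q - 1)`, where `q ∈ [2, ∞]`. -/
def rho (n : ℕ) (q : ENNReal) : ℝ :=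
  (min (q - 1) (ENNReal.ofReal (16 * Real.log n - 8))).toReal *
    (n : ℝ) ^ (2 * (q⁻¹).toReal - 1)

/-! ### Proximal setup -/

/-- A differentiable function that is `1`-strongly convex with respect to the `p`-norm. -/
structure IsProxFunction {n : ℕ} (p : ENNReal) (d : E n → ℝ) : Prop where
  differentiable : Differentiable ℝ d
  strongly_convex : ∀ x y : E n,
    1 / 2 * pNorm p (y - x) ^ 2 ≤ d y - d x - inner ℝ (gradient d x) (y - x)

/-- Bregman divergence `V[z](x)` of `d`. -/
def bregman {n : ℕ} (d : E n → ℝ) (z x : E n) : ℝ :=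
  d x - d z - inner ℝ (gradient d z) (x - z)

/-- The Euclidean prox-function `‖x‖₂² / 2` (case `p = 2`). -/
def proxTwo (n : ℕ) (x : E n) : ℝ := 1 / 2 * ‖x‖ ^ 2

/-- The exponent `κ = 1 + 1 / ln n`. -/
def kappa (n : ℕ) : ℝ := 1 + 1 / Real.log n

/-- The prox-function `(e n ^ ((κ - 1) (2 - κ) / κ) ln n / 2) ‖x - c‖_κ²` (case `p = 1`),
centred at the point `c`. -/
def proxOne (n : ℕ) (c x : E n) : ℝ :=
  Real.exp 1 * (n : ℝ) ^ ((kappa n - 1) * (2 - kappa n) / kappa n) * Real.log n / 2 *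
    pNorm (ENNReal.ofReal (kappa n)) (x - c) ^ 2

/-! ### The stochastic optimization problem -/

/-- The objective `f(x) = E_ξ F(x, ξ)`. -/
def objective {n : ℕ} {Ξ : Type*} [MeasurableSpace Ξ] (F : E n → Ξ → ℝ) (P : Measure Ξ)
    (x : E n) : ℝ :=
  ∫ ξ, F x ξ ∂P

/-- `L₂ = √(E_ξ L(ξ)²)`. -/
def L2 {Ξ : Type*} [MeasurableSpace Ξ] (L : Ξ → ℝ) (P : Measure Ξ) : ℝ :=
  √(∫ ξ, L ξ ^ 2 ∂P)

/-- The assumptions on the problem: `f` is well defined and convex; for almost every `ξ` the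
function `F(·, ξ)` has an `L(ξ)`-Lipschitz gradient, with `E L(ξ)² < ∞`; the variance of the
stochastic gradient is at most `σ²` at every point. -/
structure IsProblem {n : ℕ} {Ξ : Type*} [MeasurableSpace Ξ] (F : E n → Ξ → ℝ) (P : Measure Ξ)
    (L : Ξ → ℝ) (σ : ℝ) : Prop where
  measurable : Measurable (Function.uncurry F)
  integrable : ∀ x, Integrable (F x) P
  convex : ConvexOn ℝ Set.univ (objective F P)
  differentiable : ∀ᵐ ξ ∂P, Differentiable ℝ (fun x => F x ξ)
  lipschitz : ∀ᵐ ξ ∂P, ∀ x y : E n,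
    ‖gradient (fun u => F u ξ) x - gradient (fun u => F u ξ) y‖ ≤ L ξ * ‖x - y‖
  memLp : MemLp L 2 P
  variance : ∀ x : E n,
    ∫⁻ ξ, ‖gradient (fun u => F u ξ) x - gradient (objective F P) x‖ₑ ^ 2 ∂P
      ≤ ENNReal.ofReal (σ ^ 2)

/-! ### The algorithm -/

/-- The uniform probability distribution on the unit Euclidean sphere of `ℝⁿ`. -/
def sphereLaw (n : ℕ) : Measure (E n) :=
  (((volume : Measure (E n)).toSphere Set.univ)⁻¹ • (volume : Measure (E n)).toSphere).map
    Subtype.val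

/-- One call of the two-point oracle: the pair of noisy values at `x` and `y` for one and the
same `ξ`, together with the number of oracle calls that it costs. -/
def oracleCall {n : ℕ} {Ξ : Type*} (ftilde : E n → Ξ → ℝ) (x y : E n) (ξ : Ξ) : (ℝ × ℝ) × ℕ :=
  ((ftilde x ξ, ftilde y ξ), 1)

/-- The mini-batch finite-difference approximation of the gradient at `x` along the direction `e`,
`m⁻¹ ∑ᵢ (f̃(x + t e, ξᵢ) - f̃(x, ξᵢ)) / t • e`, together with the number of oracle calls used. -/
def gradEst {n m : ℕ} {Ξ : Type*} (ftilde : E n → Ξ → ℝ) (t : ℝ) (x e : E n) (ξ : Fin m → Ξ) :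
    E n × ℕ :=
  let r : Fin m → (ℝ × ℝ) × ℕ := fun i => oracleCall ftilde (x + t • e) x (ξ i)
  ((1 / (m : ℝ)) • ∑ i, (((r i).1.1 - (r i).1.2) / t) • e, ∑ i, (r i).2)

/-- The mirror descent step `argmin_u {a ⟨g, u - z⟩ + V[z](u)}`. When `d` is a prox-function
the minimizer exists and is unique. -/
def mirrorStep {n : ℕ} (d : E n → ℝ) (a : ℝ) (g z : E n) : E n :=
  Classical.epsilon fun w : E n =>
    IsMinOn (fun u : E n => a * inner ℝ g (u - z) + bregman d z u) Set.univ w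

/-- State of the method: the points `y_k`, `z_k` and the number of oracle calls made so far. -/
structure State (n : ℕ) where
  y : E n
  z : E n
  calls : ℕ

/-- The state of ARDFDS after `k` iterations, for noisy values `ftilde`, prox-function `d`,
Lipschitz parameter `ℓ`, stepsizes `α`, smoothing parameter `t`, starting point `x₀`,
directions `e 0, e 1, …` and batches `ξ 0, ξ 1, …` of size `m`; iteration `k` uses `e k`
and `ξ k`. -/
def run {n m : ℕ} {Ξ : Type*} (ftilde : E n → Ξ → ℝ) (d : E n → ℝ) (ℓ : ℝ) (α : ℕ → ℝ) (t : ℝ)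
    (x₀ : E n) (e : ℕ → E n) (ξ : ℕ → Fin m → Ξ) : ℕ → State n
  | 0 => ⟨x₀, x₀, 0⟩
  | k + 1 =>
    let s := run ftilde d ℓ α t x₀ e ξ k
    let τ : ℝ := 2 / ((k : ℝ) + 2)
    let x : E n := τ • s.z + (1 - τ) • s.y
    let G := gradEst ftilde t x (e k) (ξ k)
    { y := x - (1 / (2 * ℓ)) • G.1
      z := mirrorStep d (α (k + 1) * n) G.1 s.z
      calls := s.calls + G.2 }

/-- The stepsizes `α_k = (k + 1) / (96 n² ρ L₂)`, that is `α_{k+1} = (k + 2) / (96 n² ρ L₂)`. -/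
def stepSize (n : ℕ) (ρ ℓ : ℝ) (k : ℕ) : ℝ :=
  ((k : ℝ) + 1) / (96 * (n : ℝ) ^ 2 * ρ * ℓ)

/-- The joint law of all the randomness of `N` iterations: `N` independent copies of a uniform
direction on the sphere and, independently of it, `m` independent realizations of `ξ`. -/
def sampleLaw (n N m : ℕ) {Ξ : Type*} [MeasurableSpace Ξ] (P : Measure Ξ) :
    Measure (Fin N → E n × (Fin m → Ξ)) :=
  Measure.pi fun _ => (sphereLaw n).prod (Measure.pi fun _ => P)

end ARDFDS

end

open ARDFDS

/-! The method couples a gradient step with a mirror step, both driven by one random slope. With `g`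
the gradient of `f` at `x_{k+1}`, the estimate is `G = γ e`, where `γ = ⟨g, e⟩ + ⟨h, e⟩ + r`. Here
`h` is the batch average of the gradient noise, centred with second moment at most `σ² / m`. The
scalar `r` collects the Taylor remainder and the oracle noise; its square has a bound of mean `4 Δ
L₂`, because the prescribed `t` balances `t² L₂² / 2` against `8 Δ² / t²` (`integral_batchError`).

By isotropy of the direction, the gradient step gains `‖g‖² / (4 n L₂)` on average, and the mirror
step costs `α² n ‖g‖² E‖e‖_q²`, up to errors. Since `E‖e‖_q² ≤ 3 ρ_n` (`integral_pNorm_sq_le`), the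
stepsize lets the gain pay for the cost. Convexity (`coupling_inequality`) makes the rest telescope
in the potential `k (k + 2) / (2c) (f(y) - f*) + V[z](x*)`, with `c = 96 n² ρ_n L₂`.

The error `r` may depend on `e`, so its product with `⟨z - x*, e⟩` does not average out. Young's
inequality with weight `N` charges it to `‖z - x*‖² / (2N) ≤ V[z](x*) / N`. The potential then grows
by the factor `1 + 1/N` per step, hence by at most 3 in `N` steps, and no bound on the iterates is
needed (`lintegral_potential_le`, `lintegral_iter_le`). All this is done with `ℝ≥0∞`-valued
integrals, so integrability of `f(y_N)` is an outcome. `convergence_bound_le` fits the parameters;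
the case `N = 0` uses smoothness at the minimizer only.

For part (b) with `p = 1`, the two-point inequality and Minkowski give the sharp 2-uniform convexity
of the `κ`-norm (`uniform_convexity_pNorm`). Iterated midpoint convexity turns it into the gradient
inequality, and the factor in `proxOne` is what the comparison of the `1`-norm with the `κ`-norm
costs. -/

namespace ARDFDS

variable {n : ℕ}

/-! ### Comparison and duality of the `p`-norms. -/

lemma pNorm_eq_sum {p : ENNReal} (hp : 0 < p.toReal) (x : E n) :
    pNorm p x = (∑ i, |x i| ^ p.toReal) ^ (1 / p.toReal) := by
  simp [pNorm, PiLp.norm_eq_sum hp, Real.norm_eq_abs]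

lemma pNorm_top (x : E n) : pNorm ⊤ x = ‖(fun i => x i : Fin n → ℝ)‖ := by
  simp [pNorm]

lemma pNorm_two (x : E n) : pNorm 2 x = ‖x‖ := rfl

lemma pNorm_nonneg {p : ENNReal} (hp : 1 ≤ p) (x : E n) : 0 ≤ pNorm p x := by
  have : Fact (1 ≤ p) := ⟨hp⟩
  exact norm_nonneg _

lemma continuous_pNorm {p : ENNReal} (hp : 1 ≤ p) : Continuous (pNorm p : E n → ℝ) := by
  have : Fact (1 ≤ p) := ⟨hp⟩
  unfold pNorm
  exact continuous_norm.comp ((PiLp.continuous_toLp p _).comp (by fun_prop))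

lemma pNorm_smul {p : ENNReal} (hp : 1 ≤ p) (a : ℝ) (x : E n) :
    pNorm p (a • x) = |a| * pNorm p x := by
  have : Fact (1 ≤ p) := ⟨hp⟩
  have : (WithLp.toLp p (fun i => (a • x) i) : PiLp p (fun _ : Fin n => ℝ)) =
    a • WithLp.toLp p (fun i => x i) := rfl
  rw [pNorm, this, norm_smul, Real.norm_eq_abs, pNorm]

lemma abs_apply_le_pNorm {p : ENNReal} (hp : 1 ≤ p) (x : E n) (i : Fin n) :
    |x i| ≤ pNorm p x := by
  have : Fact (1 ≤ p) := ⟨hp⟩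
  exact PiLp.norm_apply_le (WithLp.toLp p (fun i => x i) : PiLp p (fun _ : Fin n => ℝ)) i

lemma one_le_toReal {p : ENNReal} (hp : 1 ≤ p) (hp' : p ≠ ⊤) : 1 ≤ p.toReal := by
  simpa using (ENNReal.toReal_le_toReal ENNReal.one_ne_top hp').2 hp

lemma pNorm_rpow {p : ENNReal} (hp : 0 < p.toReal) (x : E n) :
    pNorm p x ^ p.toReal = ∑ i, |x i| ^ p.toReal := by
  have h : 0 ≤ ∑ i, |x i| ^ p.toReal :=
    Finset.sum_nonneg fun i _ => Real.rpow_nonneg (abs_nonneg _) _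
  rw [pNorm_eq_sum hp, ← Real.rpow_mul h, one_div_mul_cancel hp.ne', Real.rpow_one]

/-- The `p`-norms decrease in `p`. -/
lemma pNorm_anti {p q : ENNReal} (hp : 1 ≤ p) (hpq : p ≤ q) (x : E n) :
    pNorm q x ≤ pNorm p x := by
  have hM := pNorm_nonneg hp x
  rcases eq_or_ne q ⊤ with rfl | hq
  · rw [pNorm_top, pi_norm_le_iff_of_nonneg hM]
    exact abs_apply_le_pNorm hp x
  have hp' : p ≠ ⊤ := ne_top_of_le_ne_top hq hpq
  have h1 := one_le_toReal hp hp'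
  have h2 : p.toReal ≤ q.toReal := (ENNReal.toReal_le_toReal hp' hq).2 hpq
  have hq0 : 0 < q.toReal := by linarith
  have hp0 : 0 < p.toReal := by linarith
  rw [← Real.rpow_le_rpow_iff (pNorm_nonneg (hp.trans hpq) x) hM hq0, pNorm_rpow hq0]
  -- Each coordinate is at most `M = ‖x‖_p`, so `s^q` can be traded for `M^(q-p) s^p`; summing gives
  -- `M^q`.
  have key : ∀ s : ℝ, 0 ≤ s → s ≤ pNorm p x →
      s ^ q.toReal ≤ pNorm p x ^ (q.toReal - p.toReal) * s ^ p.toReal := by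
    intro s hs hsM
    have e : q.toReal = (q.toReal - p.toReal) + p.toReal := by ring
    conv_lhs => rw [e, Real.rpow_add_of_nonneg hs (by linarith) hp0.le]
    gcongr
  calc ∑ i, |x i| ^ q.toReal
      ≤ ∑ i, pNorm p x ^ (q.toReal - p.toReal) * |x i| ^ p.toReal :=
        Finset.sum_le_sum fun i _ => key _ (abs_nonneg _) (abs_apply_le_pNorm hp x i)
    _ = pNorm p x ^ q.toReal := by
        rw [← Finset.mul_sum, ← pNorm_rpow hp0, ← Real.rpow_add_of_nonneg hM (by linarith) hp0.le]
        congr 1; ring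

lemma norm_le_pNorm {p : ENNReal} (hp : 1 ≤ p) (hp2 : p ≤ 2) (x : E n) : ‖x‖ ≤ pNorm p x :=
  pNorm_two x ▸ pNorm_anti hp hp2 x

/-- Comparison of the `p`-norms in the opposite direction. -/
lemma pNorm_le_rpow_mul_pNorm {p q : ENNReal} (hp : 1 ≤ p) (hpq : p ≤ q) (hq : q ≠ ⊤) (x : E n) :
    pNorm p x ≤ (n : ℝ) ^ (1 / p.toReal - 1 / q.toReal) * pNorm q x := by
  have hp' : p ≠ ⊤ := ne_top_of_le_ne_top hq hpq
  have h1 := one_le_toReal hp hp'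
  have h2 : p.toReal ≤ q.toReal := (ENNReal.toReal_le_toReal hp' hq).2 hpq
  have hq0 : 0 < q.toReal := by linarith
  have hp0 : 0 < p.toReal := by linarith
  have h3 : 1 ≤ q.toReal / p.toReal := (one_le_div hp0).2 h2
  have hn : (0 : ℝ) ≤ n := Nat.cast_nonneg n
  have key := Real.rpow_sum_le_const_mul_sum_rpow (Finset.univ : Finset (Fin n))
    (fun i => |x i| ^ p.toReal) h3
  have e1 : ∀ i, |(|x i| ^ p.toReal)| = |x i| ^ p.toReal :=
    fun i => abs_of_nonneg (Real.rpow_nonneg (abs_nonneg _) _)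
  have e2 : ∀ i, (|x i| ^ p.toReal) ^ (q.toReal / p.toReal) = |x i| ^ q.toReal := by
    intro i
    rw [← Real.rpow_mul (abs_nonneg _)]
    congr 1; field_simp
  simp only [e1, e2, Finset.card_univ, Fintype.card_fin] at key
  rw [← pNorm_rpow hp0, ← pNorm_rpow hq0, ← Real.rpow_mul (pNorm_nonneg hp x),
    mul_div_cancel₀ _ hp0.ne'] at key
  rw [← Real.rpow_le_rpow_iff (pNorm_nonneg hp x)
    (mul_nonneg (Real.rpow_nonneg hn _) (pNorm_nonneg (hp.trans hpq) x)) hq0,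
    Real.mul_rpow (Real.rpow_nonneg hn _) (pNorm_nonneg (hp.trans hpq) x), ← Real.rpow_mul hn]
  convert key using 3
  field_simp

/-- Hölder's inequality for conjugate exponents, endpoints included. -/
lemma inner_le_pNorm_mul_pNorm {p q : ENNReal} (hp : 1 ≤ p) (hq : 2 ≤ q) (hpq : p⁻¹ + q⁻¹ = 1)
    (u v : E n) : inner ℝ u v ≤ pNorm q u * pNorm p v := by
  have hin : (inner ℝ u v : ℝ) = ∑ i, u i * v i := by
    simp [PiLp.inner_apply, mul_comm]
  rw [hin]
  rcases eq_or_ne q ⊤ with rfl | hqt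
  · have hp1 : p = 1 := by simpa using hpq
    subst hp1
    have : pNorm 1 v = ∑ i, |v i| := by
      rw [pNorm_eq_sum (by simp)]; simp
    rw [this, Finset.mul_sum]
    refine Finset.sum_le_sum fun i _ => ?_
    calc u i * v i ≤ |u i| * |v i| := by rw [← abs_mul]; exact le_abs_self _
      _ ≤ _ := by gcongr; exact abs_apply_le_pNorm le_top u i
  · have hpt : p ≠ ⊤ := by
      rintro rfl
      have : q = 1 := by simpa using hpq
      subst this
      norm_num at hq
    have h1 := one_le_toReal hp hpt
    have h2 := one_le_toReal (le_trans (by norm_num) hq : (1 : ENNReal) ≤ q) hqt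
    have hp0 : p ≠ 0 := by rintro rfl; simp at hp
    have hq0 : q ≠ 0 := by rintro rfl; simp at hq
    have hr : p.toReal⁻¹ + q.toReal⁻¹ = 1 := by
      rw [← ENNReal.toReal_inv, ← ENNReal.toReal_inv, ← ENNReal.toReal_add
        (by simpa using hp0) (by simpa using hq0), hpq, ENNReal.toReal_one]
    have hconj : q.toReal.HolderConjugate p.toReal :=
      ⟨by rw [add_comm, hr]; simp, by linarith, by linarith⟩
    have := Real.inner_le_Lp_mul_Lq (Finset.univ : Finset (Fin n)) (fun i => u i) (fun i => v i)
      hconj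
    rwa [← pNorm_eq_sum (by linarith), ← pNorm_eq_sum (by linarith)] at this

lemma two_le_of_conj {p q : ENNReal} (hp2 : p ≤ 2) (hpq : p⁻¹ + q⁻¹ = 1) : 2 ≤ q := by
  by_contra h
  push Not at h
  have h1 : (2 : ENNReal)⁻¹ < q⁻¹ := ENNReal.inv_lt_inv.2 h
  have h2 : (2 : ENNReal)⁻¹ ≤ p⁻¹ := ENNReal.inv_le_inv.2 hp2
  have : (2 : ENNReal)⁻¹ + 2⁻¹ < p⁻¹ + q⁻¹ := ENNReal.add_lt_add_of_le_of_lt (by simp) h2 h1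
  rw [hpq, ENNReal.inv_two_add_inv_two] at this
  exact lt_irrefl _ this

end ARDFDS

namespace ARDFDS

variable {n : ℕ}

/-! ### Strong convexity of the squared `p`-norm, `1 < p ≤ 2` -/

/-- AM-GM: the product of the two summands is `(1 - t²)^s`, which is at least 1 for `s ≤ 0`. Taken
at `s = p - 2` and integrated twice in `t`, it yields the next two inequalities. -/
lemma two_le_rpow_add_rpow {s t : ℝ} (hs : s ≤ 0) (ht : 0 < t) (ht1 : t < 1) :
    2 ≤ (1 + t) ^ s + (1 - t) ^ s := by
  have h1 : 0 < (1 + t) ^ s := Real.rpow_pos_of_pos (by linarith) _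
  have h2 : 0 < (1 - t) ^ s := Real.rpow_pos_of_pos (by linarith) _
  have h3 : 1 ≤ (1 + t) ^ s * (1 - t) ^ s := by
    rw [← Real.mul_rpow (by linarith) (by linarith)]
    exact Real.one_le_rpow_of_pos_of_le_one_of_nonpos (by nlinarith) (by nlinarith) hs
  nlinarith [sq_nonneg ((1 + t) ^ s - (1 - t) ^ s)]

lemma hasDerivAt_one_add_rpow {s t : ℝ} (ht : 0 < 1 + t) :
    HasDerivAt (fun t : ℝ => (1 + t) ^ s) (s * (1 + t) ^ (s - 1)) t := by
  have h := (Real.hasDerivAt_rpow_const (x := 1 + t) (p := s) (Or.inl ht.ne')).comp t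
    ((hasDerivAt_id t).const_add 1)
  simpa [Function.comp_def] using h

lemma hasDerivAt_one_sub_rpow {s t : ℝ} (ht : 0 < 1 - t) :
    HasDerivAt (fun t : ℝ => (1 - t) ^ s) (-(s * (1 - t) ^ (s - 1))) t := by
  have h := (Real.hasDerivAt_rpow_const (x := 1 - t) (p := s) (Or.inl ht.ne')).comp t
    ((hasDerivAt_id t).const_sub 1)
  simpa [Function.comp_def] using h

lemma two_mul_le_rpow_sub_rpow {p t : ℝ} (hp : 1 < p) (hp2 : p ≤ 2) (ht : 0 ≤ t) (ht1 : t ≤ 1) :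
    2 * (p - 1) * t ≤ (1 + t) ^ (p - 1) - (1 - t) ^ (p - 1) := by
  have hd : ∀ t ∈ Set.Ioo (0 : ℝ) 1, HasDerivAt
      (fun t : ℝ => (1 + t) ^ (p - 1) - (1 - t) ^ (p - 1) - 2 * (p - 1) * t)
      ((p - 1) * (1 + t) ^ (p - 1 - 1) - -((p - 1) * (1 - t) ^ (p - 1 - 1)) -
        2 * (p - 1) * 1) t := fun t ht =>
    ((hasDerivAt_one_add_rpow (by linarith [ht.1])).sub
      (hasDerivAt_one_sub_rpow (by linarith [ht.2]))).sub ((hasDerivAt_id t).const_mul _)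
  have hm : MonotoneOn (fun t : ℝ => (1 + t) ^ (p - 1) - (1 - t) ^ (p - 1) - 2 * (p - 1) * t)
      (Set.Icc 0 1) := by
    apply monotoneOn_of_deriv_nonneg (convex_Icc _ _)
    · apply ContinuousOn.sub
      · apply ContinuousOn.sub
        · exact ContinuousOn.rpow_const (by fun_prop) fun x _ => Or.inr (by linarith)
        · exact ContinuousOn.rpow_const (by fun_prop) fun x _ => Or.inr (by linarith)
      · fun_prop
    · intro t ht
      rw [interior_Icc] at ht
      exact (hd t ht).differentiableAt.differentiableWithinAt
    · intro t ht
      rw [interior_Icc] at ht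
      rw [(hd t ht).deriv]
      nlinarith [two_le_rpow_add_rpow (s := p - 1 - 1) (by linarith) ht.1 ht.2]
  have := hm (Set.left_mem_Icc.2 zero_le_one) ⟨ht, ht1⟩ ht
  simp only [add_zero, sub_zero, Real.one_rpow, mul_zero, sub_self] at this
  linarith

lemma two_add_le_rpow_add_rpow {p t : ℝ} (hp : 1 < p) (hp2 : p ≤ 2) (ht : 0 ≤ t) (ht1 : t ≤ 1) :
    2 + p * (p - 1) * t ^ 2 ≤ (1 + t) ^ p + (1 - t) ^ p := by
  have hd : ∀ t ∈ Set.Ioo (0 : ℝ) 1, HasDerivAt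
      (fun t : ℝ => (1 + t) ^ p + (1 - t) ^ p - p * (p - 1) * t ^ 2)
      (p * (1 + t) ^ (p - 1) + -(p * (1 - t) ^ (p - 1)) -
        p * (p - 1) * (((2 : ℕ) : ℝ) * t ^ (2 - 1))) t := fun t ht =>
    ((hasDerivAt_one_add_rpow (by linarith [ht.1])).add
      (hasDerivAt_one_sub_rpow (by linarith [ht.2]))).sub ((hasDerivAt_pow 2 t).const_mul _)
  have hm : MonotoneOn (fun t : ℝ => (1 + t) ^ p + (1 - t) ^ p - p * (p - 1) * t ^ 2)
      (Set.Icc 0 1) := by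
    apply monotoneOn_of_deriv_nonneg (convex_Icc _ _)
    · apply ContinuousOn.sub
      · apply ContinuousOn.add
        · exact ContinuousOn.rpow_const (by fun_prop) fun x _ => Or.inr (by linarith)
        · exact ContinuousOn.rpow_const (by fun_prop) fun x _ => Or.inr (by linarith)
      · fun_prop
    · intro t ht
      rw [interior_Icc] at ht
      exact (hd t ht).differentiableAt.differentiableWithinAt
    · intro t ht
      rw [interior_Icc] at ht
      rw [(hd t ht).deriv]
      have := two_mul_le_rpow_sub_rpow hp hp2 ht.1.le ht.2.le
      norm_num
      nlinarith
  have := hm (Set.left_mem_Icc.2 zero_le_one) ⟨ht, ht1⟩ ht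
  simp only [add_zero, sub_zero, Real.one_rpow, ne_eq, OfNat.ofNat_ne_zero, not_false_eq_true,
    zero_pow, mul_zero] at this
  linarith

/-- Scaling reduces to `a = 1`. The left side is then at most `1 + p (p - 1) t² / 2` by Bernoulli,
as `p / 2 ≤ 1`, and `two_add_le_rpow_add_rpow` bounds the right side below by the same quantity. -/
lemma two_point_of_nonneg {p a b : ℝ} (hp : 1 < p) (hp2 : p ≤ 2) (hb : 0 ≤ b) (hba : b ≤ a) :
    (a ^ 2 + (p - 1) * b ^ 2) ^ (p / 2) ≤ ((a + b) ^ p + (a - b) ^ p) / 2 := by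
  rcases hb.trans hba |>.eq_or_lt with h0 | ha
  · have hb0 : b = 0 := le_antisymm (h0 ▸ hba) hb
    subst hb0
    rw [← h0]
    have h1 : (0 : ℝ) ^ (p / 2) = 0 := Real.zero_rpow (by linarith)
    have h2 : (0 : ℝ) ^ p = 0 := Real.zero_rpow (by linarith)
    simp [h1, h2]
  have ht : 0 ≤ b / a := by positivity
  have ht1 : b / a ≤ 1 := (div_le_one ha).2 hba
  have e0 : a ^ 2 + (p - 1) * b ^ 2 = a ^ 2 * (1 + (p - 1) * (b / a) ^ 2) := by field_simp
  have e1 : a + b = a * (1 + b / a) := by field_simp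
  have e2 : a - b = a * (1 - b / a) := by field_simp
  have e3 : (a ^ 2) ^ (p / 2) = a ^ p := by
    rw [← Real.rpow_natCast, ← Real.rpow_mul ha.le]; congr 1; push_cast; ring
  rw [e0, e1, e2, Real.mul_rpow (by positivity) (by nlinarith [sq_nonneg (b / a)]),
    Real.mul_rpow ha.le (by linarith), Real.mul_rpow ha.le (by linarith), e3]
  have h1 := two_add_le_rpow_add_rpow hp hp2 ht ht1
  have h2 := rpow_one_add_le_one_add_mul_self (s := (p - 1) * (b / a) ^ 2)
    (by nlinarith [sq_nonneg (b / a)]) (p := p / 2) (by linarith) (by linarith)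
  have h3 : 0 < a ^ p := Real.rpow_pos_of_pos ha p
  nlinarith

/-- The two-point inequality of Gross and Bonami. -/
lemma two_point {p : ℝ} (hp : 1 < p) (hp2 : p ≤ 2) (a b : ℝ) :
    (a ^ 2 + (p - 1) * b ^ 2) ^ (p / 2) ≤ (|a + b| ^ p + |a - b| ^ p) / 2 := by
  have key : ∀ a b : ℝ, 0 ≤ a → 0 ≤ b →
      (a ^ 2 + (p - 1) * b ^ 2) ^ (p / 2) ≤ (|a + b| ^ p + |a - b| ^ p) / 2 := by
    intro a b ha hb
    rcases le_total b a with h | h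
    · rw [abs_of_nonneg (by linarith : 0 ≤ a + b), abs_of_nonneg (by linarith : 0 ≤ a - b)]
      exact two_point_of_nonneg hp hp2 hb h
    · rw [abs_of_nonneg (by linarith : 0 ≤ a + b), abs_sub_comm,
        abs_of_nonneg (by linarith : 0 ≤ b - a), add_comm a b]
      -- Exchanging `a ≤ b` leaves the right side unchanged and only increases the left one, since
      -- `p - 1 ≤ 1`.
      refine le_trans ?_ (two_point_of_nonneg hp hp2 ha h)
      apply Real.rpow_le_rpow (by nlinarith [sq_nonneg a, sq_nonneg b]) _ (by linarith)
      nlinarith [mul_self_le_mul_self ha h]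
  have h := key |a| |b| (abs_nonneg _) (abs_nonneg _)
  rw [sq_abs, sq_abs] at h
  refine h.trans_eq ?_
  rcases abs_cases a with ⟨ha, -⟩ | ⟨ha, -⟩ <;> rcases abs_cases b with ⟨hb, -⟩ | ⟨hb, -⟩ <;>
    rw [ha, hb]
  · rw [← sub_eq_add_neg, sub_neg_eq_add, add_comm]
  · rw [show -a + b = -(a - b) by ring, show -a - b = -(a + b) by ring, abs_neg, abs_neg, add_comm]
  · rw [show -a + -b = -(a + b) by ring, show -a - -b = -(a - b) by ring, abs_neg, abs_neg]

/-- Reversed Minkowski inequality, as the triangle inequality in the plane with the `r`-norm. -/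
lemma rpow_sum_add_rpow_sum_le {ι : Type*} (s : Finset ι) (u v : ι → ℝ) {r : ℝ} (hr : 1 ≤ r)
    (hu : ∀ i, 0 ≤ u i) (hv : ∀ i, 0 ≤ v i) :
    ((∑ i ∈ s, u i) ^ r + (∑ i ∈ s, v i) ^ r) ^ (1 / r) ≤
      ∑ i ∈ s, (u i ^ r + v i ^ r) ^ (1 / r) := by
  have hr' : (ENNReal.ofReal r).toReal = r := ENNReal.toReal_ofReal (by linarith)
  have : Fact (1 ≤ ENNReal.ofReal r) := ⟨by simpa using ENNReal.ofReal_le_ofReal hr⟩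
  let w : ι → PiLp (ENNReal.ofReal r) (fun _ : Fin 2 => ℝ) := fun i => WithLp.toLp _ ![u i, v i]
  have h := norm_sum_le s w
  have e : ∀ x : PiLp (ENNReal.ofReal r) (fun _ : Fin 2 => ℝ), 0 ≤ x 0 → 0 ≤ x 1 →
      ‖x‖ = (x 0 ^ r + x 1 ^ r) ^ (1 / r) := by
    intro x h0 h1
    rw [PiLp.norm_eq_sum (by rw [hr']; linarith), hr']
    simp [Fin.sum_univ_two, abs_of_nonneg h0, abs_of_nonneg h1]
  have e0 : (∑ i ∈ s, w i) 0 = ∑ i ∈ s, u i := by simp [w]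
  have e1 : (∑ i ∈ s, w i) 1 = ∑ i ∈ s, v i := by simp [w]
  rw [e _ (e0 ▸ Finset.sum_nonneg fun i _ => hu i) (e1 ▸ Finset.sum_nonneg fun i _ => hv i),
    e0, e1] at h
  refine h.trans_eq (Finset.sum_congr rfl fun i _ => ?_)
  rw [e _ (by simpa [w] using hu i) (by simpa [w] using hv i)]
  simp [w]

/-- The 2-uniform convexity of the `p`-norm with the sharp constant. -/
lemma uniform_convexity_pNorm {p : ℝ} (hp : 1 < p) (hp2 : p ≤ 2) (x y : E n) :
    2 * (pNorm (ENNReal.ofReal p) x ^ 2 + (p - 1) * pNorm (ENNReal.ofReal p) y ^ 2) ≤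
      pNorm (ENNReal.ofReal p) (x + y) ^ 2 + pNorm (ENNReal.ofReal p) (x - y) ^ 2 := by
  have hp0 : 0 < p := by linarith
  have htr : (ENNReal.ofReal p).toReal = p := ENNReal.toReal_ofReal hp0.le
  have h1 : 1 ≤ ENNReal.ofReal p := by simpa using ENNReal.ofReal_le_ofReal hp.le
  have hN : ∀ x : E n, pNorm (ENNReal.ofReal p) x ^ p = ∑ i, |x i| ^ p := by
    intro x
    have := pNorm_rpow (p := ENNReal.ofReal p) (by rwa [htr]) x
    rwa [htr] at this
  have hsq : ∀ s : ℝ, 0 ≤ s → (s ^ p) ^ (2 / p) = s ^ 2 := by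
    intro s hs
    rw [← Real.rpow_mul hs, mul_div_cancel₀ _ hp0.ne', ← Real.rpow_natCast]; norm_num
  have hr : 1 ≤ 2 / p := (one_le_div hp0).2 hp2
  have hpm : 0 < p - 1 := by linarith
  set A := pNorm (ENNReal.ofReal p) (x + y) with hA
  set B := pNorm (ENNReal.ofReal p) (x - y) with hB
  have hA0 : 0 ≤ A := pNorm_nonneg h1 _
  have hB0 : 0 ≤ B := pNorm_nonneg h1 _
  have hx0 := pNorm_nonneg h1 x
  have hy0 := pNorm_nonneg h1 y
  have hc : ((p - 1) ^ (p / 2)) ^ (2 / p) = p - 1 := by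
    rw [← Real.rpow_mul hpm.le]
    rw [show p / 2 * (2 / p) = 1 by field_simp, Real.rpow_one]
  have hc0 : 0 ≤ (p - 1) ^ (p / 2) := Real.rpow_nonneg hpm.le _
  -- Minkowski with exponent `2 / p` pulls the sum over coordinates out of the norms; `two_point`
  -- then applies coordinatewise.
  have key := rpow_sum_add_rpow_sum_le (Finset.univ : Finset (Fin n)) (fun i => |x i| ^ p)
    (fun i => (p - 1) ^ (p / 2) * |y i| ^ p) hr (fun i => Real.rpow_nonneg (abs_nonneg _) _)
    (fun i => mul_nonneg hc0 (Real.rpow_nonneg (abs_nonneg _) _))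
  rw [← Finset.mul_sum, ← hN, ← hN, Real.mul_rpow hc0 (Real.rpow_nonneg hy0 _), hsq _ hx0,
    hsq _ hy0, hc] at key
  have key2 : ∑ i, ((|x i| ^ p) ^ (2 / p) + ((p - 1) ^ (p / 2) * |y i| ^ p) ^ (2 / p)) ^
      (1 / (2 / p)) ≤ (A ^ p + B ^ p) / 2 := by
    rw [hA, hB, hN, hN, ← Finset.sum_add_distrib, Finset.sum_div]
    refine Finset.sum_le_sum fun i _ => ?_
    rw [Real.mul_rpow hc0 (Real.rpow_nonneg (abs_nonneg _) _), hsq _ (abs_nonneg _),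
      hsq _ (abs_nonneg _), hc, sq_abs, sq_abs, one_div_div]
    exact two_point hp hp2 _ _
  have key3 := key.trans key2
  have hS0 : 0 ≤ pNorm (ENNReal.ofReal p) x ^ 2 + (p - 1) * pNorm (ENNReal.ofReal p) y ^ 2 := by
    positivity
  have key4 := Real.rpow_le_rpow (Real.rpow_nonneg hS0 _) key3 (by linarith : 0 ≤ 2 / p)
  rw [← Real.rpow_mul hS0, show 1 / (2 / p) * (2 / p) = 1 by field_simp, Real.rpow_one] at key4
  -- Convexity of `s ↦ s^(2/p)` passes from the mean of `A^p` and `B^p` to the mean of `A²` and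
  -- `B²`.
  have key5 := (convexOn_rpow hr).2 (Real.rpow_nonneg hA0 p) (Real.rpow_nonneg hB0 p)
    (by norm_num : (0 : ℝ) ≤ 1 / 2) (by norm_num : (0 : ℝ) ≤ 1 / 2) (by norm_num)
  simp only [smul_eq_mul] at key5
  rw [hsq _ hA0, hsq _ hB0, show 1 / 2 * A ^ p + 1 / 2 * B ^ p = (A ^ p + B ^ p) / 2 by ring]
    at key5
  linarith

/-- A differentiable function that is strongly midpoint convex satisfies the gradient inequality of
strong convexity. -/
lemma gradient_inequality_of_midpoint {Φ : E n → ℝ} (hd : Differentiable ℝ Φ) {x h : E n} {M : ℝ}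
    (hmid : ∀ s : ℝ, 2 * Φ (x + (s / 2) • h) + M / 2 * s ^ 2 ≤ Φ (x + s • h) + Φ x) :
    M ≤ Φ (x + h) - Φ x - inner ℝ (gradient Φ x) h := by
  set g : ℝ := inner ℝ (gradient Φ x) h with hg
  let D : ℝ → ℝ := fun s => Φ (x + s • h) - Φ x - s * g
  have hD : ∀ s, 2 * D (s / 2) + M / 2 * s ^ 2 ≤ D s := by
    intro s
    have := hmid s
    simp only [D]
    linarith
  -- Halving the step repeatedly collects `M/2 + M/4 + ...`, which tends to `M`. The term `2^k
  -- D(2^(-k))` vanishes in the limit because `D` has zero value and zero derivative at 0.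
  have hiter : ∀ k : ℕ, 2 ^ k * D (1 / 2 ^ k) + M * (1 - 1 / 2 ^ k) ≤ D 1 := by
    intro k
    induction k with
    | zero => simp
    | succ k ih =>
      have h2 := hD (1 / 2 ^ k)
      have h3 : (0 : ℝ) < 2 ^ k := by positivity
      have h4 : (2 : ℝ) ^ k * (2 * D (1 / 2 ^ k / 2) + M / 2 * (1 / 2 ^ k) ^ 2) ≤
          2 ^ k * D (1 / 2 ^ k) := mul_le_mul_of_nonneg_left h2 h3.le
      have e1 : (1 : ℝ) / 2 ^ k / 2 = 1 / 2 ^ (k + 1) := by rw [pow_succ]; field_simp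
      have e2 : (2 : ℝ) ^ k * (2 * D (1 / 2 ^ (k + 1)) + M / 2 * (1 / 2 ^ k) ^ 2) =
          2 ^ (k + 1) * D (1 / 2 ^ (k + 1)) + M / 2 * (1 / 2 ^ k) := by
        rw [pow_succ]; field_simp
      rw [e1, e2] at h4
      have e3 : M * (1 - 1 / 2 ^ (k + 1)) = M * (1 - 1 / 2 ^ k) + M / 2 * (1 / 2 ^ k) := by
        rw [pow_succ]; field_simp; ring
      linarith
  have hder : HasDerivAt D 0 0 := by
    have h1 : HasDerivAt (fun s : ℝ => Φ (x + s • h)) (fderiv ℝ Φ (x + (0 : ℝ) • h) h) 0 := by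
      have hl : HasDerivAt (fun s : ℝ => x + s • h) h 0 := by
        simpa using ((hasDerivAt_id (0 : ℝ)).smul_const h).const_add x
      exact (hd (x + (0 : ℝ) • h)).hasFDerivAt.comp_hasDerivAt 0 hl
    have h2 : HasDerivAt (fun s : ℝ => s * g) g 0 := by simpa using (hasDerivAt_id (0 : ℝ)).mul_const g
    have h3 := (h1.sub_const (Φ x)).sub h2
    have : fderiv ℝ Φ (x + (0 : ℝ) • h) h - g = 0 := by
      rw [zero_smul, add_zero, hg, inner_gradient_left, sub_self]
    rwa [this] at h3
  have hlim : Filter.Tendsto (fun k : ℕ => (2 : ℝ) ^ k * D (1 / 2 ^ k)) Filter.atTop (nhds 0) := by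
    rw [hasDerivAt_iff_tendsto_slope] at hder
    have hu : Filter.Tendsto (fun k : ℕ => (1 : ℝ) / 2 ^ k) Filter.atTop (nhdsWithin 0 {0}ᶜ) := by
      rw [tendsto_nhdsWithin_iff]
      refine ⟨?_, Filter.Eventually.of_forall fun k => by simp⟩
      have := tendsto_pow_atTop_nhds_zero_of_lt_one (r := (1 : ℝ) / 2) (by norm_num) (by norm_num)
      simpa using this
    refine (hder.comp hu).congr fun k => ?_
    simp [slope_def_field, D]
    field_simp
  have hlim2 : Filter.Tendsto (fun k : ℕ => (2 : ℝ) ^ k * D (1 / 2 ^ k) + M * (1 - 1 / 2 ^ k))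
      Filter.atTop (nhds (0 + M * (1 - 0))) := by
    refine hlim.add (Filter.Tendsto.const_mul _ (Filter.Tendsto.const_sub _ ?_))
    have := tendsto_pow_atTop_nhds_zero_of_lt_one (r := (1 : ℝ) / 2) (by norm_num) (by norm_num)
    simpa using this
  have := le_of_tendsto' hlim2 hiter
  simpa [D] using this

/-- The inner sum is differentiable because `p > 1`, and the outer power `2 / p ≥ 1` is
differentiable even at 0, that is at `x = c`. -/
lemma differentiable_pNorm_sq {p : ℝ} (hp : 1 < p) (hp2 : p ≤ 2) (c : E n) :
    Differentiable ℝ (fun x : E n => pNorm (ENNReal.ofReal p) (x - c) ^ 2) := by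
  have hp0 : 0 < p := by linarith
  have htr : (ENNReal.ofReal p).toReal = p := ENNReal.toReal_ofReal hp0.le
  have e : (fun x : E n => pNorm (ENNReal.ofReal p) (x - c) ^ 2) =
      fun x : E n => (∑ i, ‖(x - c) i‖ ^ p) ^ (2 / p) := by
    funext x
    rw [pNorm_eq_sum (by rwa [htr]), htr, ← Real.rpow_natCast, ← Real.rpow_mul
      (Finset.sum_nonneg fun i _ => Real.rpow_nonneg (abs_nonneg _) _)]
    simp only [Real.norm_eq_abs]
    congr 1
    push_cast
    ring
  rw [e]
  intro x
  have h1 : DifferentiableAt ℝ (fun x : E n => ∑ i, ‖(x - c) i‖ ^ p) x := by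
    refine DifferentiableAt.fun_sum fun i _ => ?_
    have h2 : DifferentiableAt ℝ (fun x : E n => (x - c) i) x := by
      simp only [PiLp.sub_apply]; fun_prop
    exact (differentiable_norm_rpow (E := ℝ) hp _).comp x h2
  exact h1.rpow_const (Or.inr ((one_le_div hp0).2 hp2))

/-! ### The exponent `κ` and the two standard prox-functions. -/

lemma two_lt_log {n : ℕ} (hn : 8 ≤ n) : 2 < Real.log n := by
  have h1 : Real.log 8 ≤ Real.log n := Real.log_le_log (by norm_num) (by exact_mod_cast hn)
  have h2 : Real.log 8 = 3 * Real.log 2 := by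
    rw [show (8 : ℝ) = 2 ^ 3 by norm_num, Real.log_pow]; norm_num
  have := Real.log_two_gt_d9
  linarith

lemma kappa_bounds {n : ℕ} (hn : 8 ≤ n) : 1 < kappa n ∧ kappa n ≤ 2 := by
  have h := two_lt_log hn
  unfold kappa
  constructor
  · have : 0 < 1 / Real.log n := by positivity
    linarith
  · have : 1 / Real.log n ≤ 1 := by
      rw [div_le_one (by linarith)]; linarith
    linarith

lemma rpow_kappa_sub_one {n : ℕ} (hn : 8 ≤ n) : (n : ℝ) ^ (kappa n - 1) = Real.exp 1 := by
  have h := two_lt_log hn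
  have hn0 : (0 : ℝ) < n := by exact_mod_cast (by omega : 0 < n)
  rw [Real.rpow_def_of_pos hn0, kappa]
  congr 1
  field_simp
  ring

lemma isProxFunction_proxOne {n : ℕ} (hn : 8 ≤ n) (c : E n) : IsProxFunction 1 (proxOne n c) := by
  obtain ⟨hk1, hk2⟩ := kappa_bounds hn
  have hlog := two_lt_log hn
  have hn0 : (0 : ℝ) < n := by exact_mod_cast (by omega : 0 < n)
  set κ := kappa n with hκ
  have hk0 : 0 < κ := by linarith
  have hE1 : 1 ≤ ENNReal.ofReal κ := by simpa using ENNReal.ofReal_le_ofReal hk1.le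
  have htr : (ENNReal.ofReal κ).toReal = κ := ENNReal.toReal_ofReal hk0.le
  set C : ℝ := Real.exp 1 * (n : ℝ) ^ ((κ - 1) * (2 - κ) / κ) * Real.log n / 2 with hC
  have hC0 : 0 < C := by positivity
  have hdef : proxOne n c = fun x => C * pNorm (ENNReal.ofReal κ) (x - c) ^ 2 := rfl
  have hdiff : Differentiable ℝ (proxOne n c) := by
    rw [hdef]; exact (differentiable_pNorm_sq hk1 hk2 c).const_mul C
  refine ⟨hdiff, fun x y => ?_⟩
  have hcmp : 1 / 2 * pNorm 1 (y - x) ^ 2 ≤ C * (κ - 1) * pNorm (ENNReal.ofReal κ) (y - x) ^ 2 := by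
    have h := pNorm_le_rpow_mul_pNorm le_rfl hE1 ENNReal.ofReal_ne_top (y - x)
    have h2 := pow_le_pow_left₀ (pNorm_nonneg le_rfl _) h 2
    rw [mul_pow, htr, ENNReal.toReal_one, ← Real.rpow_natCast ((n : ℝ) ^ _),
      ← Real.rpow_mul hn0.le] at h2
    -- The factor of `proxOne` is designed for this: `ln n` cancels `κ - 1`, and `e = n^(κ-1)`
    -- completes the exponent to `2 (1 - 1/κ)`, the squared cost of comparing the `1`-norm with the
    -- `κ`-norm.
    have hconst : C * (κ - 1) = 1 / 2 * (n : ℝ) ^ ((1 / 1 - 1 / κ) * ((2 : ℕ) : ℝ)) := by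
      have e1 : Real.log n * (κ - 1) = 1 := by
        rw [hκ, kappa]; field_simp; ring
      have e2 : Real.exp 1 * (n : ℝ) ^ ((κ - 1) * (2 - κ) / κ) =
          (n : ℝ) ^ ((1 / 1 - 1 / κ) * ((2 : ℕ) : ℝ)) := by
        rw [← rpow_kappa_sub_one hn, ← Real.rpow_add hn0, ← hκ]
        congr 1
        push_cast
        field_simp
        ring
      rw [hC, e2]
      linear_combination (1 / 2 * (n : ℝ) ^ ((1 / 1 - 1 / κ) * ((2 : ℕ) : ℝ))) * e1
    rw [hconst]
    nlinarith
  refine hcmp.trans ?_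
  have h := gradient_inequality_of_midpoint hdiff (x := x) (h := y - x)
    (M := C * (κ - 1) * pNorm (ENNReal.ofReal κ) (y - x) ^ 2) ?_
  · simpa using h
  · intro s
    have hu := uniform_convexity_pNorm hk1 hk2 (x + (s / 2) • (y - x) - c) ((s / 2) • (y - x))
    rw [show x + (s / 2) • (y - x) - c + (s / 2) • (y - x) = x + s • (y - x) - c by
        module,
      show x + (s / 2) • (y - x) - c - (s / 2) • (y - x) = x - c by module,
      pNorm_smul hE1 (s / 2), mul_pow, sq_abs] at hu
    simp only [hdef]
    nlinarith

lemma hasGradientAt_proxTwo (x : E n) : HasGradientAt (proxTwo n) x x := by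
  rw [hasGradientAt_iff_hasFDerivAt]
  have := (hasStrictFDerivAt_norm_sq x).hasFDerivAt.const_mul (1 / 2 : ℝ)
  have e : (1 / 2 : ℝ) • (2 • innerSL ℝ x) = InnerProductSpace.toDual ℝ (E n) x := by
    ext v
    simp
  rwa [e] at this

lemma isProxFunction_proxTwo (n : ℕ) : IsProxFunction 2 (proxTwo n) := by
  refine ⟨fun x => (hasGradientAt_proxTwo x).differentiableAt, fun x y => ?_⟩
  rw [(hasGradientAt_proxTwo x).gradient, pNorm_two, proxTwo, proxTwo, norm_sub_sq_real,
    inner_sub_right, real_inner_self_eq_norm_sq, real_inner_comm]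
  linarith

end ARDFDS

noncomputable section

namespace ARDFDS

variable {n : ℕ}

/-! ### The mirror descent step -/

lemma half_pNorm_sq_le_bregman {p : ENNReal} {d : E n → ℝ} (hd : IsProxFunction p d) (z x : E n) :
    1 / 2 * pNorm p (x - z) ^ 2 ≤ bregman d z x := hd.strongly_convex z x

lemma half_norm_sq_le_bregman {p : ENNReal} {d : E n → ℝ} (hp : 1 ≤ p) (hp2 : p ≤ 2)
    (hd : IsProxFunction p d) (z x : E n) : 1 / 2 * ‖x - z‖ ^ 2 ≤ bregman d z x := by
  refine le_trans ?_ (half_pNorm_sq_le_bregman hd z x)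
  gcongr
  exact norm_le_pNorm hp hp2 _

lemma bregman_nonneg {p : ENNReal} {d : E n → ℝ} (hp : 1 ≤ p) (hp2 : p ≤ 2)
    (hd : IsProxFunction p d) (z x : E n) : 0 ≤ bregman d z x :=
  le_trans (by positivity) (half_norm_sq_le_bregman hp hp2 hd z x)

lemma gradient_sub_inner {f : E n → ℝ} {w v : E n} (hf : DifferentiableAt ℝ f w)
    (hmin : ∀ u, f w - inner ℝ v w ≤ f u - inner ℝ v u) : gradient f w = v := by
  have h1 : IsLocalMin (fun u => f u - inner ℝ v u) w := Filter.Eventually.of_forall hmin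
  have h2 : HasFDerivAt (fun u => f u - inner ℝ v u) (fderiv ℝ f w - innerSL ℝ v) w :=
    hf.hasFDerivAt.sub (innerSL ℝ v).hasFDerivAt
  have h3 := h1.hasFDerivAt_eq_zero h2
  refine ext_inner_right ℝ fun u => ?_
  have h4 := congrArg (fun φ : E n →L[ℝ] ℝ => φ u) h3
  rw [inner_gradient_left]
  simpa [sub_eq_zero] using h4

/-- Strong convexity makes `d - ⟨v, ·⟩` coercive, so it has a minimizer, where the gradient of `d`
is `v`. -/
lemma exists_gradient_eq {p : ENNReal} {d : E n → ℝ} (hp : 1 ≤ p) (hp2 : p ≤ 2)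
    (hd : IsProxFunction p d) (v : E n) : ∃ w, gradient d w = v := by
  have hcont : Continuous fun u : E n => d u - inner ℝ v u :=
    hd.differentiable.continuous.sub (by fun_prop)
  set C := ‖gradient d 0 - v‖ with hC
  have hbound : ∀ u : E n, d 0 + ‖u‖ * (1 / 2 * ‖u‖ - C) ≤ d u - inner ℝ v u := by
    intro u
    have h1 := half_norm_sq_le_bregman hp hp2 hd 0 u
    simp only [bregman, sub_zero] at h1
    have h2 : |inner ℝ (gradient d 0 - v) u| ≤ C * ‖u‖ := abs_real_inner_le_norm _ _
    have h3 := (abs_le.1 h2).1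
    rw [inner_sub_left] at h3
    nlinarith
  have hlim : Filter.Tendsto (fun u : E n => d u - inner ℝ v u) (Filter.cocompact _)
      Filter.atTop := by
    refine Filter.tendsto_atTop_mono hbound ?_
    refine Filter.tendsto_atTop_add_const_left _ _ ?_
    have hn := tendsto_norm_cocompact_atTop (E := E n)
    refine hn.atTop_mul_atTop₀ ?_
    exact Filter.tendsto_atTop_add_const_right _ _ (hn.const_mul_atTop (by norm_num))
  obtain ⟨w, hw⟩ := hcont.exists_forall_le hlim
  exact ⟨w, gradient_sub_inner (hd.differentiable w) hw⟩

lemma norm_sq_le_inner_gradient {p : ENNReal} {d : E n → ℝ} (hp : 1 ≤ p) (hp2 : p ≤ 2)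
    (hd : IsProxFunction p d) (x y : E n) :
    ‖x - y‖ ^ 2 ≤ inner ℝ (gradient d x - gradient d y) (x - y) := by
  have h1 := half_norm_sq_le_bregman hp hp2 hd x y
  have h2 := half_norm_sq_le_bregman hp hp2 hd y x
  have e : inner ℝ (gradient d x) (y - x) = -(inner ℝ (gradient d x) (x - y) : ℝ) := by
    rw [← inner_neg_right, neg_sub]
  rw [norm_sub_rev] at h1
  simp only [bregman] at h1 h2
  rw [inner_sub_left]
  linarith

/-- The inverse of the gradient of a prox-function. -/
def gradInv (d : E n → ℝ) (v : E n) : E n := Classical.epsilon fun w => gradient d w = v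

lemma gradient_gradInv {p : ENNReal} {d : E n → ℝ} (hp : 1 ≤ p) (hp2 : p ≤ 2)
    (hd : IsProxFunction p d) (v : E n) : gradient d (gradInv d v) = v :=
  Classical.epsilon_spec (exists_gradient_eq hp hp2 hd v)

/-- Since `‖·‖₂ ≤ ‖·‖_p` for `p ≤ 2`, the gradient of `d` is strongly monotone with constant 1 in
the Euclidean norm. Continuity of the inverse is what makes the mirror step measurable. -/
lemma lipschitzWith_gradInv {p : ENNReal} {d : E n → ℝ} (hp : 1 ≤ p) (hp2 : p ≤ 2)
    (hd : IsProxFunction p d) : LipschitzWith 1 (gradInv d) := by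
  refine LipschitzWith.of_dist_le_mul fun v w => ?_
  have h := norm_sq_le_inner_gradient hp hp2 hd (gradInv d v) (gradInv d w)
  rw [gradient_gradInv hp hp2 hd, gradient_gradInv hp hp2 hd] at h
  have h2 := real_inner_le_norm (v - w) (gradInv d v - gradInv d w)
  rw [dist_eq_norm, dist_eq_norm, NNReal.coe_one, one_mul]
  by_contra hlt
  push Not at hlt
  nlinarith [norm_nonneg (v - w)]

/-- Up to a constant, the function minimized in the step is the Bregman divergence from `w₀`. It is
therefore minimized at `w₀` only, and the choice made by `Classical.epsilon` is forced. -/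
lemma mirrorStep_eq_gradInv {p : ENNReal} {d : E n → ℝ} (hp : 1 ≤ p) (hp2 : p ≤ 2)
    (hd : IsProxFunction p d) (a : ℝ) (g z : E n) :
    mirrorStep d a g z = gradInv d (gradient d z - a • g) := by
  set w₀ := gradInv d (gradient d z - a • g) with hw₀
  have hg : gradient d w₀ = gradient d z - a • g := gradient_gradInv hp hp2 hd _
  have hdiff : ∀ u, a * inner ℝ g (u - z) + bregman d z u -
      (a * inner ℝ g (w₀ - z) + bregman d z w₀) = bregman d w₀ u := by
    intro u
    simp only [bregman, hg, inner_sub_left, inner_sub_right, real_inner_smul_left]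
    ring
  have hex : ∃ w : E n, IsMinOn (fun u : E n => a * inner ℝ g (u - z) + bregman d z u)
      Set.univ w := by
    refine ⟨w₀, fun u _ => ?_⟩
    have := bregman_nonneg hp hp2 hd w₀ u
    rw [← hdiff] at this
    simpa using this
  have hspec : IsMinOn (fun u : E n => a * inner ℝ g (u - z) + bregman d z u) Set.univ
      (mirrorStep d a g z) := Classical.epsilon_spec hex
  have h1 : a * inner ℝ g (mirrorStep d a g z - z) + bregman d z (mirrorStep d a g z) ≤
      a * inner ℝ g (w₀ - z) + bregman d z w₀ := hspec (Set.mem_univ w₀)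
  have h2 := hdiff (mirrorStep d a g z)
  have h3 := half_norm_sq_le_bregman hp hp2 hd w₀ (mirrorStep d a g z)
  have h4 : ‖mirrorStep d a g z - w₀‖ ^ 2 ≤ 0 := by linarith
  have h5 : ‖mirrorStep d a g z - w₀‖ = 0 := by
    nlinarith [norm_nonneg (mirrorStep d a g z - w₀)]
  exact sub_eq_zero.1 (norm_eq_zero.1 h5)

lemma gradient_mirrorStep {p : ENNReal} {d : E n → ℝ} (hp : 1 ≤ p) (hp2 : p ≤ 2)
    (hd : IsProxFunction p d) (a : ℝ) (g z : E n) :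
    gradient d (mirrorStep d a g z) = gradient d z - a • g := by
  rw [mirrorStep_eq_gradInv hp hp2 hd, gradient_gradInv hp hp2 hd]

lemma measurable_gradient (d : E n → ℝ) : Measurable (gradient d) := by
  have h : gradient d = fun x => (InnerProductSpace.toDual ℝ (E n)).symm (fderiv ℝ d x) := rfl
  rw [h]
  exact (InnerProductSpace.toDual ℝ (E n)).symm.continuous.measurable.comp (measurable_fderiv ℝ d)

lemma measurable_mirrorStep {p : ENNReal} {d : E n → ℝ} (hp : 1 ≤ p) (hp2 : p ≤ 2)
    (hd : IsProxFunction p d) (a : ℝ) {α : Type*} [MeasurableSpace α] {g z : α → E n}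
    (hg : Measurable g) (hz : Measurable z) :
    Measurable fun w => mirrorStep d a (g w) (z w) := by
  simp only [mirrorStep_eq_gradInv hp hp2 hd]
  exact (lipschitzWith_gradInv hp hp2 hd).continuous.measurable.comp
    (((measurable_gradient d).comp hz).sub (hg.const_smul a))

lemma measurable_bregman {p : ENNReal} {d : E n → ℝ} (hd : IsProxFunction p d) (u : E n) :
    Measurable fun z => bregman d z u := by
  have h1 : Measurable d := hd.differentiable.continuous.measurable
  have h2 := measurable_gradient d
  unfold bregman
  exact (measurable_const.sub h1).sub (h2.inner (measurable_const.sub measurable_id))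

/-- The basic inequality of mirror descent. -/
lemma mirrorStep_inequality {p q : ENNReal} {d : E n → ℝ} (hp : 1 ≤ p) (hp2 : p ≤ 2)
    (hpq : p⁻¹ + q⁻¹ = 1) (hd : IsProxFunction p d) (a : ℝ) (g z u : E n) :
    bregman d (mirrorStep d a g z) u ≤
      bregman d z u - a * inner ℝ g (z - u) + a ^ 2 / 2 * pNorm q g ^ 2 := by
  have hq := two_le_of_conj hp2 hpq
  have hq1 : 1 ≤ q := le_trans (by norm_num) hq
  set w := mirrorStep d a g z with hw
  have hg : gradient d w = gradient d z - a • g := gradient_mirrorStep hp hp2 hd a g z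
  -- Three-point identity of the Bregman divergence, with the optimality condition `hg` inserted.
  -- The last two terms are then bounded by strong convexity, Hölder and Young.
  have hid : bregman d w u = bregman d z u - a * inner ℝ g (z - u) - bregman d z w +
      inner ℝ (a • g) (z - w) := by
    simp only [bregman, hg, inner_sub_left, inner_sub_right, real_inner_smul_left]
    ring
  have h1 := half_pNorm_sq_le_bregman hd z w
  have h2 := inner_le_pNorm_mul_pNorm hp hq hpq (a • g) (z - w)
  have h3 : pNorm p (z - w) = pNorm p (w - z) := by
    rw [← neg_sub w z, ← neg_one_smul ℝ, pNorm_smul hp]; simp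
  rw [h3, pNorm_smul hq1] at h2
  have h4 : a ^ 2 * pNorm q g ^ 2 = (|a| * pNorm q g) ^ 2 := by rw [mul_pow, sq_abs]
  nlinarith [sq_nonneg (|a| * pNorm q g - pNorm p (w - z))]

end ARDFDS
end

noncomputable section

namespace ARDFDS

variable {n : ℕ}

/-! ### The uniform distribution on the sphere -/

lemma isProbabilityMeasure_sphereLaw (hn : 0 < n) : IsProbabilityMeasure (sphereLaw n) := by
  have : Nonempty (Fin n) := ⟨⟨0, hn⟩⟩
  have : Nontrivial (E n) := inferInstance
  constructor
  rw [sphereLaw, Measure.map_apply measurable_subtype_coe .univ, Set.preimage_univ,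
    Measure.smul_apply, smul_eq_mul]
  refine ENNReal.inv_mul_cancel ?_ (measure_ne_top _ _)
  rw [Ne, Measure.measure_univ_eq_zero]
  exact Measure.toSphere_ne_zero _

lemma ae_norm_eq_one (n : ℕ) : ∀ᵐ e ∂sphereLaw n, ‖e‖ = 1 := by
  rw [sphereLaw, ae_map_iff measurable_subtype_coe.aemeasurable
    (measurableSet_eq_fun measurable_norm measurable_const)]
  exact Filter.Eventually.of_forall fun x => by simp

open scoped Pointwise in
-- The surface measure of a set is a multiple of the volume of the cone over it, and a linear
-- isometry preserves volume and commutes with forming cones.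
lemma map_sphereLaw (U : E n ≃ₗᵢ[ℝ] E n) : (sphereLaw n).map U = sphereLaw n := by
  ext A hA
  have hU : Measurable U := U.continuous.measurable
  rw [Measure.map_apply hU hA, sphereLaw, Measure.map_apply measurable_subtype_coe (hU hA),
    Measure.map_apply measurable_subtype_coe hA, Measure.smul_apply, Measure.smul_apply,
    Measure.toSphere_apply' _ (measurable_subtype_coe (hU hA)),
    Measure.toSphere_apply' _ (measurable_subtype_coe hA)]
  congr 2
  have hset : (Set.Ioo (0 : ℝ) 1 • (Subtype.val '' ((Subtype.val : Metric.sphere (0 : E n) 1 → E n)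
        ⁻¹' (U ⁻¹' A))) : Set (E n)) =
      U ⁻¹' (Set.Ioo (0 : ℝ) 1 • (Subtype.val '' ((Subtype.val :
        Metric.sphere (0 : E n) 1 → E n) ⁻¹' A))) := by
    ext x
    simp only [Set.mem_smul, Set.mem_preimage, Subtype.image_preimage_coe, Set.mem_inter_iff,
      mem_sphere_iff_norm, sub_zero]
    constructor
    · rintro ⟨r, hr, y, ⟨h1, h2⟩, rfl⟩
      exact ⟨r, hr, U y, ⟨by simpa using h1, h2⟩, by simp⟩
    · rintro ⟨r, hr, y, ⟨h1, h2⟩, h3⟩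
      refine ⟨r, hr, U.symm y, ⟨by simpa using h1, by simpa using h2⟩, U.injective ?_⟩
      simpa using h3
  rw [hset]
  exact U.measurePreserving.measure_preimage_emb U.toHomeomorph.measurableEmbedding _

lemma integral_sphereLaw_comp (U : E n ≃ₗᵢ[ℝ] E n) (h : E n → ℝ) :
    ∫ e, h (U e) ∂sphereLaw n = ∫ e, h e ∂sphereLaw n := by
  conv_rhs => rw [← map_sphereLaw U]
  exact (U.toHomeomorph.measurableEmbedding.integral_map h).symm

lemma integrable_sphereLaw [IsProbabilityMeasure (sphereLaw n)] {h : E n → ℝ}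
    (hh : Continuous h) : Integrable h (sphereLaw n) := by
  obtain ⟨C, hC⟩ := (isCompact_sphere (0 : E n) 1).exists_bound_of_continuousOn hh.continuousOn
  refine Integrable.of_bound hh.aestronglyMeasurable C ?_
  filter_upwards [ae_norm_eq_one n] with e he
  exact hC e (by simpa using he)

/-- The isometry that changes the sign of the `i`-th coordinate. -/
def signFlip (i : Fin n) : E n ≃ₗᵢ[ℝ] E n :=
  LinearIsometryEquiv.piLpCongrRight 2
    (fun j => if j = i then LinearIsometryEquiv.neg ℝ else LinearIsometryEquiv.refl ℝ ℝ)

/-- The isometry that swaps two coordinates. -/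
def swapIso (i j : Fin n) : E n ≃ₗᵢ[ℝ] E n :=
  LinearIsometryEquiv.piLpCongrLeft 2 ℝ ℝ (Equiv.swap i j)

lemma signFlip_apply (i j : Fin n) (x : E n) : signFlip i x j = if j = i then -x j else x j := by
  simp only [signFlip, LinearIsometryEquiv.piLpCongrRight_apply]
  split_ifs <;> simp

lemma swapIso_apply (i j k : Fin n) (x : E n) : swapIso i j x k = x (Equiv.swap i j k) := by
  simp [swapIso, LinearIsometryEquiv.piLpCongrLeft_apply, Equiv.piCongrLeft'_apply]

lemma pNorm_signFlip {p : ENNReal} (hp : 1 ≤ p) (i : Fin n) (x : E n) :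
    pNorm p (signFlip i x) = pNorm p x := by
  have h : ∀ j, |signFlip i x j| = |x j| := by
    intro j
    rw [signFlip_apply]
    split_ifs <;> simp
  rcases eq_or_ne p ⊤ with rfl | hp'
  · simp only [pNorm, PiLp.norm_eq_ciSup, Real.norm_eq_abs, h]
  · have := one_le_toReal hp hp'
    simp only [pNorm_eq_sum (by linarith : 0 < p.toReal), h]

lemma pNorm_swapIso {p : ENNReal} (hp : 1 ≤ p) (i j : Fin n) (x : E n) :
    pNorm p (swapIso i j x) = pNorm p x := by
  rcases eq_or_ne p ⊤ with rfl | hp'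
  · simp only [pNorm, PiLp.norm_eq_ciSup, swapIso_apply]
    exact Equiv.iSup_comp (g := fun k => ‖x k‖) (Equiv.swap i j)
  · have := one_le_toReal hp hp'
    simp only [pNorm_eq_sum (by linarith : 0 < p.toReal), swapIso_apply]
    congr 1
    exact Equiv.sum_comp (Equiv.swap i j) (fun k => |x k| ^ p.toReal)

/-- Isotropy of the uniform distribution on the sphere, with a weight that is invariant under
signed permutations of the coordinates. -/
lemma integral_inner_mul_inner_mul (hn : 0 < n) {w : E n → ℝ} (hw : Continuous w)
    (hsign : ∀ i x, w (signFlip i x) = w x) (hswap : ∀ i j x, w (swapIso i j x) = w x)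
    (u v : E n) :
    ∫ e, inner ℝ u e * inner ℝ v e * w e ∂sphereLaw n =
      inner ℝ u v / n * ∫ e, w e ∂sphereLaw n := by
  have := isProbabilityMeasure_sphereLaw hn
  have hn' : (n : ℝ) ≠ 0 := by exact_mod_cast hn.ne'
  have hint : ∀ i j : Fin n, Integrable (fun e : E n => e i * e j * w e) (sphereLaw n) :=
    fun i j => integrable_sphereLaw (by fun_prop)
  -- A sign flip kills the off-diagonal moments and a swap equates the diagonal ones. The latter sum
  -- to `∫ w`, as `‖e‖ = 1` almost surely.
  have hoff : ∀ i j : Fin n, i ≠ j → ∫ e, e i * e j * w e ∂sphereLaw n = 0 := by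
    intro i j hij
    have h := integral_sphereLaw_comp (signFlip i) (fun e => e i * e j * w e)
    simp only [signFlip_apply, hsign, if_true, if_neg hij.symm] at h
    have e : ∀ e : E n, -e i * e j * w e = -(e i * e j * w e) := fun e => by ring
    simp only [e, integral_neg] at h
    linarith
  have hdiag : ∀ i j : Fin n,
      ∫ e, e i * e i * w e ∂sphereLaw n = ∫ e, e j * e j * w e ∂sphereLaw n := by
    intro i j
    have h := integral_sphereLaw_comp (swapIso i j) (fun e => e i * e i * w e)
    simpa only [swapIso_apply, hswap, Equiv.swap_apply_left] using h.symm
  have hsum : ∑ i, ∫ e, e i * e i * w e ∂sphereLaw n = ∫ e, w e ∂sphereLaw n := by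
    rw [← integral_finsetSum _ fun i _ => hint i i]
    refine integral_congr_ae ?_
    filter_upwards [ae_norm_eq_one n] with e he
    have h1 : ∑ i, e i * e i = 1 := by
      have := EuclideanSpace.real_norm_sq_eq e
      rw [he] at this
      simpa [sq] using this.symm
    rw [← Finset.sum_mul, h1, one_mul]
  have hdiag' : ∀ i : Fin n, ∫ e, e i * e i * w e ∂sphereLaw n = (∫ e, w e ∂sphereLaw n) / n := by
    intro i
    have h : ∑ j, ∫ e, e j * e j * w e ∂sphereLaw n = n * ∫ e, e i * e i * w e ∂sphereLaw n := by
      rw [Finset.sum_congr rfl fun j _ => hdiag j i]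
      simp
    rw [← hsum, h]
    field_simp
  have hin : ∀ u e : E n, (inner ℝ u e : ℝ) = ∑ i, u i * e i := by
    intro u e
    simp [PiLp.inner_apply, mul_comm]
  have hexp : ∀ e : E n, inner ℝ u e * inner ℝ v e * w e =
      ∑ i, ∑ j, u i * v j * (e i * e j * w e) := by
    intro e
    rw [hin, hin, Finset.sum_mul_sum, Finset.sum_mul]
    refine Finset.sum_congr rfl fun i _ => ?_
    rw [Finset.sum_mul]
    exact Finset.sum_congr rfl fun j _ => by ring
  simp only [hexp]
  rw [integral_finsetSum _ fun i _ => integrable_finsetSum _ fun j _ => (hint i j).const_mul _]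
  have hrow : ∀ i, ∫ e, ∑ j, u i * v j * (e i * e j * w e) ∂sphereLaw n =
      u i * v i * ((∫ e, w e ∂sphereLaw n) / n) := by
    intro i
    rw [integral_finsetSum _ fun j _ => (hint i j).const_mul _]
    simp only [integral_const_mul]
    rw [Finset.sum_eq_single i, hdiag' i]
    · intro j _ hj
      rw [hoff i j hj.symm, mul_zero]
    · simp
  rw [Finset.sum_congr rfl fun i _ => hrow i, ← Finset.sum_mul, hin]
  ring

lemma integral_inner_mul_inner (hn : 0 < n) (u v : E n) :
    ∫ e, inner ℝ u e * inner ℝ v e ∂sphereLaw n = inner ℝ u v / n := by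
  have := isProbabilityMeasure_sphereLaw hn
  simpa using integral_inner_mul_inner_mul hn (w := fun _ => 1) continuous_const
    (fun _ _ => rfl) (fun _ _ _ => rfl) u v

lemma integral_inner_sq (hn : 0 < n) (u : E n) :
    ∫ e, inner ℝ u e ^ 2 ∂sphereLaw n = ‖u‖ ^ 2 / n := by
  simp only [sq (inner ℝ u _)]
  rw [integral_inner_mul_inner hn, real_inner_self_eq_norm_sq]

lemma integral_inner_sq_mul_pNorm_sq (hn : 0 < n) {q : ENNReal} (hq : 1 ≤ q) (u : E n) :
    ∫ e, inner ℝ u e ^ 2 * pNorm q e ^ 2 ∂sphereLaw n =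
      ‖u‖ ^ 2 / n * ∫ e, pNorm q e ^ 2 ∂sphereLaw n := by
  simp only [sq (inner ℝ u _)]
  rw [integral_inner_mul_inner_mul hn (w := fun e => pNorm q e ^ 2) ((continuous_pNorm hq).pow 2)
    (fun i x => by rw [pNorm_signFlip hq]) (fun i j x => by rw [pNorm_swapIso hq]),
    real_inner_self_eq_norm_sq]

/-! ### Moments of the coordinates and of the dual norm. -/

/-- One-dimensional marginals of the uniform distribution coincide up to scaling. -/
lemma integral_inner_pow (u v : E n) (huv : ‖u‖ = ‖v‖) (k : ℕ) :
    ∫ e, inner ℝ u e ^ k ∂sphereLaw n = ∫ e, inner ℝ v e ^ k ∂sphereLaw n := by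
  let U : E n ≃ₗᵢ[ℝ] E n := (Submodule.span ℝ {u - v})ᗮ.reflection
  have hU : U u = v := Submodule.reflection_sub huv
  have h := integral_sphereLaw_comp U (fun e => inner ℝ v e ^ k)
  rw [← h]
  simp only [← hU, LinearIsometryEquiv.inner_map_map]

/-- The left side is the moment of the marginal along a vector of length `√(1 + s²)`, so rotation
invariance moves it to the `i`-th axis. -/
lemma integral_add_mul_pow {i j : Fin n} (hij : i ≠ j) (k : ℕ) (s : ℝ) :
    ∫ e, (e i + s * e j) ^ (2 * k) ∂sphereLaw n =
      (1 + s ^ 2) ^ k * ∫ e, e i ^ (2 * k) ∂sphereLaw n := by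
  set u : E n := EuclideanSpace.single i 1 + s • EuclideanSpace.single j 1 with hu
  set v : E n := √(1 + s ^ 2) • EuclideanSpace.single i 1 with hv
  have hu2 : ‖u‖ ^ 2 = 1 + s ^ 2 := by
    rw [hu, norm_add_sq_real, norm_smul, real_inner_smul_right, EuclideanSpace.inner_single_left]
    simp [hij]
  have hv2 : ‖v‖ ^ 2 = 1 + s ^ 2 := by
    rw [hv, norm_smul, mul_pow, Real.norm_eq_abs, sq_abs, Real.sq_sqrt (by positivity)]
    simp
  have huv : ‖u‖ = ‖v‖ := by
    rw [← sq_eq_sq₀ (norm_nonneg _) (norm_nonneg _), hu2, hv2]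
  have h := integral_inner_pow u v huv (2 * k)
  have e1 : ∀ e : E n, (inner ℝ u e : ℝ) = e i + s * e j := by
    intro e
    rw [hu, inner_add_left, real_inner_smul_left, EuclideanSpace.inner_single_left,
      EuclideanSpace.inner_single_left]
    simp
  have e2 : ∀ e : E n, (inner ℝ v e : ℝ) = √(1 + s ^ 2) * e i := by
    intro e
    rw [hv, real_inner_smul_left, EuclideanSpace.inner_single_left]
    simp
  simp only [e1, e2, mul_pow, integral_const_mul] at h
  rw [h, pow_mul, Real.sq_sqrt (by positivity)]

/-- Both sides of `integral_add_mul_pow` are polynomials in `s`. Equating their coefficients of `s²`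
gives `C(2k+2, 2) ∫ e_i^(2k) e_j² = (k + 1) ∫ e_i^(2k+2)`, and the binomial coefficient is `(k +
1)(2k + 1)`. -/
lemma integral_pow_eq_mul (hn : 0 < n) {i j : Fin n} (hij : i ≠ j) (k : ℕ) :
    ∫ e, e i ^ (2 * (k + 1)) ∂sphereLaw n =
      (2 * k + 1) * ∫ e, e i ^ (2 * k) * e j ^ 2 ∂sphereLaw n := by
  have := isProbabilityMeasure_sphereLaw hn
  set K := 2 * (k + 1) with hK
  let M : ℕ → ℝ := fun m => ∫ e, e j ^ m * e i ^ (K - m) ∂sphereLaw n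
  let P : Polynomial ℝ :=
    ∑ m ∈ Finset.range (K + 1), Polynomial.C (M m * (K.choose m : ℝ)) * Polynomial.X ^ m
  let Q : Polynomial ℝ := (Polynomial.expand ℝ 2 ((1 + Polynomial.X) ^ (k + 1))) *
    Polynomial.C (∫ e, e i ^ K ∂sphereLaw n)
  have hPQ : P = Q := by
    refine Polynomial.funext fun s => ?_
    have h1 : Q.eval s = (1 + s ^ 2) ^ (k + 1) * ∫ e, e i ^ K ∂sphereLaw n := by
      simp [Q]
    rw [h1, hK, ← integral_add_mul_pow hij, ← hK]
    have h2 : ∀ e : E n, (e i + s * e j) ^ K =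
        ∑ m ∈ Finset.range (K + 1), (s ^ m * (K.choose m : ℝ)) * (e j ^ m * e i ^ (K - m)) := by
      intro e
      rw [add_comm, add_pow]
      exact Finset.sum_congr rfl fun m _ => by rw [mul_pow]; ring
    simp only [h2]
    rw [integral_finsetSum _ fun m _ => (integrable_sphereLaw (by fun_prop)).const_mul _]
    simp only [P, Polynomial.eval_finsetSum, Polynomial.eval_mul, Polynomial.eval_C,
      Polynomial.eval_pow, Polynomial.eval_X, integral_const_mul]
    exact Finset.sum_congr rfl fun m _ => by simp only [M]; ring
  have hc := congrArg (fun R => Polynomial.coeff R 2) hPQ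
  have hP : P.coeff 2 = M 2 * (K.choose 2 : ℝ) := by
    simp only [P, Polynomial.finsetSum_coeff, Polynomial.coeff_C_mul, Polynomial.coeff_X_pow]
    rw [Finset.sum_eq_single 2]
    · simp
    · intro m _ hm
      rw [if_neg hm.symm, mul_zero]
    · intro h
      exact absurd (Finset.mem_range.2 (by omega)) h
  have hQ : Q.coeff 2 = (k + 1) * ∫ e, e i ^ K ∂sphereLaw n := by
    simp only [Q, Polynomial.coeff_mul_C, Polynomial.coeff_expand (by norm_num : 0 < 2)]
    simp [Polynomial.coeff_one_add_X_pow]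
  simp only [hP, hQ] at hc
  have hch : (K.choose 2 : ℝ) = (k + 1) * (2 * k + 1) := by
    rw [Nat.cast_choose_two, hK]; push_cast; ring
  have hM2 : M 2 = ∫ e, e i ^ (2 * k) * e j ^ 2 ∂sphereLaw n := by
    have : K - 2 = 2 * k := by omega
    simp only [M, this, mul_comm]
  rw [hch, hM2] at hc
  have hk : (k + 1 : ℝ) ≠ 0 := by positivity
  refine mul_left_cancel₀ hk ?_
  linarith

lemma integral_pow_nonneg (i : Fin n) (k : ℕ) : 0 ≤ ∫ e, e i ^ (2 * k) ∂sphereLaw n :=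
  integral_nonneg fun e => by
    simp only [Pi.zero_apply, pow_mul]
    positivity

/-- Sum the previous relation over `j` with `∑ e_j² = 1`. The term `j = i` only satisfies an
inequality, which suffices. -/
lemma mul_integral_pow_le (hn : 0 < n) (i : Fin n) (k : ℕ) :
    n * ∫ e, e i ^ (2 * (k + 1)) ∂sphereLaw n ≤ (2 * k + 1) * ∫ e, e i ^ (2 * k) ∂sphereLaw n := by
  have := isProbabilityMeasure_sphereLaw hn
  have hsum : ∑ j, ∫ e, e i ^ (2 * k) * e j ^ 2 ∂sphereLaw n = ∫ e, e i ^ (2 * k) ∂sphereLaw n := by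
    rw [← integral_finsetSum _ fun j _ => integrable_sphereLaw (by fun_prop)]
    refine integral_congr_ae ?_
    filter_upwards [ae_norm_eq_one n] with e he
    have h1 : ∑ i, e i ^ 2 = 1 := by
      have := EuclideanSpace.real_norm_sq_eq e
      rw [he] at this
      simpa using this.symm
    rw [← Finset.mul_sum, h1, mul_one]
  have hle : ∀ j, ∫ e, e i ^ (2 * (k + 1)) ∂sphereLaw n ≤
      (2 * k + 1) * ∫ e, e i ^ (2 * k) * e j ^ 2 ∂sphereLaw n := by
    intro j
    rcases eq_or_ne i j with rfl | hij
    · have e : ∀ e : E n, e i ^ (2 * k) * e i ^ 2 = e i ^ (2 * (k + 1)) := fun e => by ring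
      simp only [e]
      have := integral_pow_nonneg i (k + 1)
      nlinarith [(Nat.cast_nonneg k : (0 : ℝ) ≤ k)]
    · exact (integral_pow_eq_mul hn hij k).le
  rw [← hsum, Finset.mul_sum]
  have := Finset.sum_le_sum fun j (_ : j ∈ Finset.univ) => hle j
  simpa using this

/-- The recursion factors `2k + 1` are all bounded by the last one, `2K - 1`. -/
lemma integral_pow_le (hn : 0 < n) (i : Fin n) {k K : ℕ} (hk : k ≤ K) :
    ∫ e, e i ^ (2 * k) ∂sphereLaw n ≤ ((2 * K - 1) / n : ℝ) ^ k := by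
  have := isProbabilityMeasure_sphereLaw hn
  have hn' : (0 : ℝ) < n := by exact_mod_cast hn
  induction k with
  | zero => simp
  | succ k ih =>
    have h1 := mul_integral_pow_le hn i k
    have h2 := ih (by omega)
    have hK : (k : ℝ) + 1 ≤ K := by exact_mod_cast hk
    have hk0 : (0 : ℝ) ≤ k := Nat.cast_nonneg k
    have h3 := integral_pow_nonneg i k
    rw [pow_succ, ← mul_div_assoc, le_div_iff₀ hn', mul_comm _ (n : ℝ),
      mul_comm _ (2 * (K : ℝ) - 1)]
    refine h1.trans (mul_le_mul (by linarith) h2 h3 (by linarith))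

/-- Second moment of the `2k`-norm of a uniform direction. -/
lemma integral_pNorm_even_sq_le (hn : 0 < n) {k : ℕ} (hk : 0 < k) :
    ∫ e, pNorm ((2 * k : ℕ) : ENNReal) e ^ 2 ∂sphereLaw n ≤
      (n : ℝ) ^ (1 / (k : ℝ)) * ((2 * k - 1) / n) := by
  have := isProbabilityMeasure_sphereLaw hn
  have hn' : (0 : ℝ) < n := by exact_mod_cast hn
  have hk1 : (1 : ℝ) ≤ k := by exact_mod_cast hk
  have h1 : (1 : ENNReal) ≤ ((2 * k : ℕ) : ENNReal) := by exact_mod_cast (by omega : 1 ≤ 2 * k)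
  have hc := (continuous_pNorm (n := n) h1).pow 2
  have hpow : ∀ e : E n, (pNorm ((2 * k : ℕ) : ENNReal) e ^ 2) ^ k = ∑ i, e i ^ (2 * k) := by
    intro e
    have h := pNorm_rpow (p := ((2 * k : ℕ) : ENNReal)) (by simp; omega) e
    rw [ENNReal.toReal_natCast, Real.rpow_natCast] at h
    rw [← pow_mul, h]
    refine Finset.sum_congr rfl fun i _ => ?_
    rw [Real.rpow_natCast, pow_mul, sq_abs, ← pow_mul]
  -- Jensen for the `k`-th power, after which the `2k`-norm becomes a sum of coordinate moments.
  have hJ : (∫ e, pNorm ((2 * k : ℕ) : ENNReal) e ^ 2 ∂sphereLaw n) ^ k ≤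
      ∫ e, (pNorm ((2 * k : ℕ) : ENNReal) e ^ 2) ^ k ∂sphereLaw n :=
    (convexOn_pow k).map_integral_le (by fun_prop) isClosed_Ici
      (Filter.Eventually.of_forall fun e => by simp only [Set.mem_Ici]; positivity)
      (integrable_sphereLaw hc) (integrable_sphereLaw (hc.pow k))
  simp only [hpow] at hJ
  rw [integral_finsetSum _ fun i _ => integrable_sphereLaw (by fun_prop)] at hJ
  have hsum : ∑ i : Fin n, ∫ e, e i ^ (2 * k) ∂sphereLaw n ≤ n * ((2 * k - 1) / n : ℝ) ^ k := by
    have := Finset.sum_le_sum fun i (_ : i ∈ (Finset.univ : Finset (Fin n))) =>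
      integral_pow_le hn i (le_refl k)
    simpa using this
  have hb : 0 ≤ (2 * k - 1) / (n : ℝ) := div_nonneg (by linarith) hn'.le
  refine le_of_pow_le_pow_left₀ hk.ne' (by positivity) (hJ.trans (hsum.trans_eq ?_))
  rw [mul_pow, ← Real.rpow_natCast ((n : ℝ) ^ _), ← Real.rpow_mul hn'.le,
    one_div_mul_cancel (by positivity), Real.rpow_one]

/-- Round `q` up to the even integer `2k`. The factor `n^(2/q - 1/k)` lost in comparing norms
combines with the `n^(1/k)` of the even moment to leave exactly `n^(2/q)`. The constant 3 comes from
`2k - 1 ≤ q + 1 ≤ 3 (q - 1)`, valid for `q ≥ 2`. -/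
lemma integral_pNorm_sq_le_of_le_log (hn : 8 ≤ n) {q : ENNReal} (hq : 2 ≤ q) (hq' : q ≠ ⊤) :
    ∫ e, pNorm q e ^ 2 ∂sphereLaw n ≤
      3 * ((q.toReal - 1) * (n : ℝ) ^ (2 * (q⁻¹).toReal - 1)) := by
  have hn0 : 0 < n := by omega
  have := isProbabilityMeasure_sphereLaw hn0
  have hn' : (0 : ℝ) < n := by exact_mod_cast hn0
  have hq1 : 1 ≤ q := le_trans (by norm_num) hq
  have hr2 : 2 ≤ q.toReal := by
    simpa using (ENNReal.toReal_le_toReal (by norm_num) hq').2 hq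
  set r := q.toReal with hr
  set k := ⌈r / 2⌉₊ with hk
  have hk1 : r / 2 ≤ k := Nat.le_ceil _
  have hk2 : (k : ℝ) < r / 2 + 1 := Nat.ceil_lt_add_one (by linarith)
  have hk0 : 0 < k := Nat.ceil_pos.2 (by linarith)
  have hk0' : (0 : ℝ) < k := by exact_mod_cast hk0
  have hle : q ≤ ((2 * k : ℕ) : ENNReal) := by
    rw [← ENNReal.toReal_le_toReal hq' (ENNReal.natCast_ne_top _), ENNReal.toReal_natCast]
    push_cast
    linarith
  have h1k : 1 ≤ ((2 * k : ℕ) : ENNReal) := hq1.trans hle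
  have hpt : ∀ e : E n, pNorm q e ^ 2 ≤
      (n : ℝ) ^ (2 / r - 1 / k) * pNorm ((2 * k : ℕ) : ENNReal) e ^ 2 := by
    intro e
    have h := pow_le_pow_left₀ (pNorm_nonneg hq1 e)
      (pNorm_le_rpow_mul_pNorm hq1 hle (ENNReal.natCast_ne_top _) e) 2
    rw [mul_pow, ← Real.rpow_natCast ((n : ℝ) ^ _), ← Real.rpow_mul hn'.le,
      ENNReal.toReal_natCast] at h
    rw [show (1 / q.toReal - 1 / ((2 * k : ℕ) : ℝ)) * ((2 : ℕ) : ℝ) = 2 / r - 1 / k by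
      rw [← hr]; push_cast; field_simp] at h
    exact h
  have h1 : ∫ e, pNorm q e ^ 2 ∂sphereLaw n ≤ (n : ℝ) ^ (2 / r - 1 / k) *
      ∫ e, pNorm ((2 * k : ℕ) : ENNReal) e ^ 2 ∂sphereLaw n := by
    rw [← integral_const_mul]
    exact integral_mono (integrable_sphereLaw ((continuous_pNorm hq1).pow 2))
      ((integrable_sphereLaw ((continuous_pNorm h1k).pow 2)).const_mul _) hpt
  have h2 := integral_pNorm_even_sq_le hn0 hk0
  have h3 : (n : ℝ) ^ (2 / r - 1 / k) * ((n : ℝ) ^ (1 / (k : ℝ)) * ((2 * k - 1) / n)) =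
      (2 * k - 1) * (n : ℝ) ^ (2 * (q⁻¹).toReal - 1) := by
    rw [← mul_assoc, ← Real.rpow_add hn', sub_add_cancel, Real.rpow_sub hn', Real.rpow_one,
      ENNReal.toReal_inv, ← hr, div_eq_mul_inv 2 r]
    ring
  calc _ ≤ _ := h1
    _ ≤ _ := mul_le_mul_of_nonneg_left h2 (by positivity)
    _ = _ := h3
    _ ≤ (3 * (r - 1)) * (n : ℝ) ^ (2 * (q⁻¹).toReal - 1) := by
      gcongr
      linarith
    _ = _ := by ring

/-- For large `q` pass down to `2k` with `k = ⌈ln n⌉`: then `n^(1/k) ≤ e ≤ 3` and `2k - 1 ≤ 2 ln n +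
1 ≤ 16 ln n - 8`. -/
lemma integral_pNorm_sq_le_of_log_le (hn : 8 ≤ n) {q : ENNReal}
    (hq : ENNReal.ofReal (16 * Real.log n - 8) ≤ q - 1) :
    ∫ e, pNorm q e ^ 2 ∂sphereLaw n ≤
      3 * ((16 * Real.log n - 8) * (n : ℝ) ^ (2 * (q⁻¹).toReal - 1)) := by
  have hn0 : 0 < n := by omega
  have := isProbabilityMeasure_sphereLaw hn0
  have hn' : (0 : ℝ) < n := by exact_mod_cast hn0
  have hlog := two_lt_log hn
  set ℓ := Real.log n with hℓ
  set k := ⌈ℓ⌉₊ with hk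
  have hk1 : ℓ ≤ k := Nat.le_ceil _
  have hk2 : (k : ℝ) < ℓ + 1 := Nat.ceil_lt_add_one (by linarith)
  have hk0 : 0 < k := Nat.ceil_pos.2 (by linarith)
  have hk0' : (0 : ℝ) < k := by exact_mod_cast hk0
  have hle : ((2 * k : ℕ) : ENNReal) ≤ q := by
    refine le_trans ?_ (hq.trans tsub_le_self)
    rw [← ENNReal.ofReal_natCast]
    apply ENNReal.ofReal_le_ofReal
    push_cast
    linarith
  have h1k : (1 : ENNReal) ≤ ((2 * k : ℕ) : ENNReal) := by exact_mod_cast (by omega : 1 ≤ 2 * k)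
  have hq1 : 1 ≤ q := h1k.trans hle
  have h1 : ∫ e, pNorm q e ^ 2 ∂sphereLaw n ≤
      ∫ e, pNorm ((2 * k : ℕ) : ENNReal) e ^ 2 ∂sphereLaw n :=
    integral_mono (integrable_sphereLaw ((continuous_pNorm hq1).pow 2))
      (integrable_sphereLaw ((continuous_pNorm h1k).pow 2))
      fun e => pow_le_pow_left₀ (pNorm_nonneg hq1 e) (pNorm_anti h1k hle e) 2
  have h2 := integral_pNorm_even_sq_le hn0 hk0
  have h3 : (n : ℝ) ^ (1 / (k : ℝ)) ≤ 3 := by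
    rw [Real.rpow_def_of_pos hn', ← hℓ]
    have : ℓ * (1 / k) ≤ 1 := by
      rw [mul_one_div, div_le_one hk0']
      exact hk1
    exact (Real.exp_le_exp.2 this).trans (by linarith [Real.exp_one_lt_d9])
  have h4 : (1 : ℝ) / n ≤ (n : ℝ) ^ (2 * (q⁻¹).toReal - 1) := by
    rw [one_div, ← Real.rpow_neg_one]
    refine Real.rpow_le_rpow_of_exponent_le (by exact_mod_cast hn0) ?_
    have : 0 ≤ (q⁻¹).toReal := ENNReal.toReal_nonneg
    linarith
  calc _ ≤ _ := h1
    _ ≤ _ := h2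
    _ ≤ 3 * ((2 * k - 1) / n) := by
      gcongr
      exact div_nonneg (by linarith) hn'.le
    _ = 3 * ((2 * k - 1) * (1 / n)) := by ring
    _ ≤ _ := by
      refine mul_le_mul_of_nonneg_left (mul_le_mul ?_ h4 (by positivity) ?_) (by norm_num) <;>
        linarith

lemma rho_pos (hn : 8 ≤ n) {q : ENNReal} (hq : 2 ≤ q) : 0 < rho n q := by
  have hlog := two_lt_log hn
  have hn' : (0 : ℝ) < n := by exact_mod_cast (by omega : 0 < n)
  refine mul_pos (ENNReal.toReal_pos ?_ ?_) (Real.rpow_pos_of_pos hn' _)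
  · refine (lt_min ?_ ?_).ne'
    · exact tsub_pos_of_lt (lt_of_lt_of_le (by norm_num) hq)
    · exact ENNReal.ofReal_pos.2 (by linarith)
  · exact ne_top_of_le_ne_top ENNReal.ofReal_ne_top (min_le_right _ _)

/-- The second moment of the dual norm of a uniform direction is at most `3 ρ_n`. -/
lemma integral_pNorm_sq_le (hn : 8 ≤ n) {q : ENNReal} (hq : 2 ≤ q) :
    ∫ e, pNorm q e ^ 2 ∂sphereLaw n ≤ 3 * rho n q := by
  have hlog := two_lt_log hn
  rw [rho]
  rcases le_total (q - 1) (ENNReal.ofReal (16 * Real.log n - 8)) with h | h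
  · have hq' : q ≠ ⊤ := by
      rintro rfl
      simp at h
    have hq1 : 1 ≤ q := le_trans (by norm_num) hq
    rw [min_eq_left h, ENNReal.toReal_sub_of_le hq1 hq', ENNReal.toReal_one]
    exact integral_pNorm_sq_le_of_le_log hn hq hq'
  · rw [min_eq_right h, ENNReal.toReal_ofReal (by linarith)]
    exact integral_pNorm_sq_le_of_log_le hn h

/-- Needed when `N = 0`, where `n² ρ_n L₂ Θ ≤ ε` must imply `L₂ Θ ≤ ε`. -/
lemma one_le_mul_rho (hn : 8 ≤ n) {q : ENNReal} (hq : 2 ≤ q) : 1 ≤ (n : ℝ) * rho n q := by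
  have hlog := two_lt_log hn
  have hn' : (0 : ℝ) < n := by exact_mod_cast (by omega : 0 < n)
  have h1 : 1 ≤ (min (q - 1) (ENNReal.ofReal (16 * Real.log n - 8))).toReal := by
    rw [← ENNReal.toReal_one]
    refine (ENNReal.toReal_le_toReal ENNReal.one_ne_top
      (ne_top_of_le_ne_top ENNReal.ofReal_ne_top (min_le_right _ _))).2 (le_min ?_ ?_)
    · exact ENNReal.le_sub_of_add_le_left (by norm_num) (by norm_num; exact hq)
    · rw [← ENNReal.ofReal_one]
      exact ENNReal.ofReal_le_ofReal (by linarith)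
  have h4 : (1 : ℝ) / n ≤ (n : ℝ) ^ (2 * (q⁻¹).toReal - 1) := by
    rw [one_div, ← Real.rpow_neg_one]
    refine Real.rpow_le_rpow_of_exponent_le (by exact_mod_cast (by omega : 1 ≤ n)) ?_
    have : 0 ≤ (q⁻¹).toReal := ENNReal.toReal_nonneg
    linarith
  have h5 : 1 * (1 / (n : ℝ)) ≤ rho n q := mul_le_mul h1 h4 (by positivity) (by linarith)
  calc (1 : ℝ) = n * (1 * (1 / n)) := by field_simp
    _ ≤ _ := by gcongr

end ARDFDS
end

noncomputable section

namespace ARDFDS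

variable {n : ℕ}

/-! ### Smoothness -/

lemma le_of_lipschitz_gradient {f : E n → ℝ} {K : ℝ} (hf : Differentiable ℝ f)
    (hL : ∀ x y, ‖gradient f x - gradient f y‖ ≤ K * ‖x - y‖) (x y : E n) :
    f y - f x - inner ℝ (gradient f x) (y - x) ≤ K / 2 * ‖y - x‖ ^ 2 := by
  set h := y - x with hh
  let φ : ℝ → ℝ := fun s => f (x + s • h) - s * inner ℝ (gradient f x) h - K / 2 * ‖h‖ ^ 2 * s ^ 2
  have hd : ∀ s, HasDerivAt φ (inner ℝ (gradient f (x + s • h)) h - inner ℝ (gradient f x) h -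
      K / 2 * ‖h‖ ^ 2 * (((2 : ℕ) : ℝ) * s ^ (2 - 1))) s := by
    intro s
    have h1 : HasDerivAt (fun s : ℝ => f (x + s • h)) (inner ℝ (gradient f (x + s • h)) h) s := by
      have hl : HasDerivAt (fun s : ℝ => x + s • h) h s := by
        simpa using ((hasDerivAt_id s).smul_const h).const_add x
      rw [inner_gradient_left]
      exact (hf (x + s • h)).hasFDerivAt.comp_hasDerivAt s hl
    have h2 : HasDerivAt (fun s : ℝ => s * inner ℝ (gradient f x) h)
        (inner ℝ (gradient f x) h) s := by
      simpa using (hasDerivAt_id s).mul_const (inner ℝ (gradient f x) h)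
    exact (h1.sub h2).sub ((hasDerivAt_pow 2 s).const_mul _)
  have hanti : AntitoneOn φ (Set.Icc 0 1) := by
    apply antitoneOn_of_deriv_nonpos (convex_Icc _ _)
    · exact fun s _ => (hd s).continuousAt.continuousWithinAt
    · exact fun s _ => (hd s).differentiableAt.differentiableWithinAt
    · intro s hs
      rw [interior_Icc] at hs
      rw [(hd s).deriv, ← inner_sub_left]
      have h1 := real_inner_le_norm (gradient f (x + s • h) - gradient f x) h
      have h2 := hL (x + s • h) x
      rw [add_sub_cancel_left, norm_smul, Real.norm_eq_abs, abs_of_pos hs.1] at h2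
      have h3 := mul_le_mul_of_nonneg_right h2 (norm_nonneg h)
      norm_num
      nlinarith
  have h01 := hanti (Set.left_mem_Icc.2 zero_le_one) (Set.right_mem_Icc.2 zero_le_one) zero_le_one
  simp only [φ, zero_smul, add_zero, one_smul, hh, add_sub_cancel] at h01
  rw [hh]
  linarith

lemma abs_taylor_le {f : E n → ℝ} {K : ℝ} (hf : Differentiable ℝ f)
    (hL : ∀ x y, ‖gradient f x - gradient f y‖ ≤ K * ‖x - y‖) (x y : E n) :
    |f y - f x - inner ℝ (gradient f x) (y - x)| ≤ K / 2 * ‖y - x‖ ^ 2 := by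
  have hneg : ∀ x, gradient (fun u => -f u) x = -gradient f x := by
    intro x
    refine ext_inner_right ℝ fun u => ?_
    rw [inner_neg_left, inner_gradient_left, inner_gradient_left, fderiv_fun_neg]
    rfl
  have h1 := le_of_lipschitz_gradient hf hL x y
  have h2 := le_of_lipschitz_gradient (f := fun u => -f u) (K := K) hf.neg
    (fun x y => by
      rw [hneg, hneg, ← neg_sub', norm_neg]
      exact hL x y) x y
  rw [hneg, inner_neg_left] at h2
  rw [abs_le]
  constructor <;> linarith

/-! ### The expected objective: its gradient, smoothness and convexity, and the gradient noise. -/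

section Problem

variable {Ξ : Type*} [MeasurableSpace Ξ] {P : Measure Ξ}
  {F : E n → Ξ → ℝ} {L : Ξ → ℝ} {σ : ℝ}

lemma IsProblem.taylor (hP : IsProblem F P L σ) : ∀ᵐ ξ ∂P, ∀ x y : E n,
    |F y ξ - F x ξ - inner ℝ (gradient (fun u => F u ξ) x) (y - x)| ≤ L ξ / 2 * ‖y - x‖ ^ 2 := by
  filter_upwards [hP.lipschitz, hP.differentiable] with ξ h1 h2 x y
  exact abs_taylor_le h2 h1 x y

/-- Measurability of the gradient in `ξ` is not assumed; it is inherited from difference quotients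
of `F` along `1 / (k + 1)`. -/
lemma IsProblem.aestronglyMeasurable_inner (hP : IsProblem F P L σ) (x v : E n) :
    AEStronglyMeasurable (fun ξ => inner ℝ (gradient (fun u => F u ξ) x) v) P := by
  have hu : Filter.Tendsto (fun k : ℕ => (1 : ℝ) / (k + 1)) Filter.atTop (nhdsWithin 0 {0}ᶜ) := by
    rw [tendsto_nhdsWithin_iff]
    exact ⟨tendsto_one_div_add_atTop_nhds_zero_nat,
      Filter.Eventually.of_forall fun k => (by positivity : (1 : ℝ) / (k + 1) ≠ 0)⟩
  refine aestronglyMeasurable_of_tendsto_ae Filter.atTop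
    (f := fun (k : ℕ) ξ => ((1 : ℝ) / (k + 1))⁻¹ * (F (x + ((1 : ℝ) / (k + 1)) • v) ξ - F x ξ))
    (fun k => ?_) ?_
  · exact (((hP.integrable _).sub (hP.integrable _)).const_mul _).aestronglyMeasurable
  · filter_upwards [hP.differentiable] with ξ hξ
    have h1 : HasDerivAt (fun s : ℝ => F (x + s • v) ξ)
        (inner ℝ (gradient (fun u => F u ξ) x) v) 0 := by
      have hl : HasDerivAt (fun s : ℝ => x + s • v) v 0 := by
        simpa using ((hasDerivAt_id (0 : ℝ)).smul_const v).const_add x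
      rw [inner_gradient_left]
      have h2 := (hξ (x + (0 : ℝ) • v)).hasFDerivAt.comp_hasDerivAt 0 hl
      rw [zero_smul, add_zero] at h2
      exact h2
    rw [hasDerivAt_iff_tendsto_slope] at h1
    refine (h1.comp hu).congr fun k => ?_
    simp [slope_def_field]
    field_simp

variable [IsProbabilityMeasure P]

lemma IsProblem.integrable_lipschitz (hP : IsProblem F P L σ) : Integrable L P :=
  hP.memLp.integrable (by norm_num)

/-- The Taylor bound dominates the directional derivative by a difference of two integrable values
of `F` plus a multiple of `L`. -/
lemma IsProblem.integrable_inner (hP : IsProblem F P L σ) (x v : E n) :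
    Integrable (fun ξ => inner ℝ (gradient (fun u => F u ξ) x) v) P := by
  have hb : Integrable (fun ξ => |F (x + v) ξ - F x ξ| + L ξ / 2 * ‖v‖ ^ 2) P :=
    ((hP.integrable _).sub (hP.integrable _)).abs.add
      ((hP.integrable_lipschitz.div_const 2).mul_const _)
  refine hb.mono' (hP.aestronglyMeasurable_inner x v) ?_
  filter_upwards [hP.taylor] with ξ hξ
  have h := hξ x (x + v)
  rw [add_sub_cancel_left] at h
  rw [Real.norm_eq_abs]
  have h2 := abs_sub_abs_le_abs_sub (inner ℝ (gradient (fun u => F u ξ) x) v) (F (x + v) ξ - F x ξ)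
  rw [abs_sub_comm (inner ℝ (gradient (fun u => F u ξ) x) v)] at h2
  linarith

lemma sum_inner_single_smul (g : E n) :
    ∑ i, (inner ℝ g (EuclideanSpace.single i (1 : ℝ)) : ℝ) • EuclideanSpace.single i (1 : ℝ) = g := by
  ext j
  simp [EuclideanSpace.inner_single_right, Pi.single_apply]

lemma IsProblem.integrable_gradient (hP : IsProblem F P L σ) (x : E n) :
    Integrable (fun ξ => gradient (fun u => F u ξ) x) P := by
  have h : Integrable (fun ξ => ∑ i, (inner ℝ (gradient (fun u => F u ξ) x)
      (EuclideanSpace.single i (1 : ℝ)) : ℝ) • (EuclideanSpace.single i (1 : ℝ) : E n)) P :=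
    integrable_finsetSum _ fun i _ => (hP.integrable_inner x _).smul_const _
  simpa only [sum_inner_single_smul] using h

lemma IsProblem.integral_inner_gradient (hP : IsProblem F P L σ) (x v : E n) :
    ∫ ξ, inner ℝ (gradient (fun u => F u ξ) x) v ∂P =
      inner ℝ (∫ ξ, gradient (fun u => F u ξ) x ∂P) v := by
  have h := integral_inner (𝕜 := ℝ) (hP.integrable_gradient x) v
  simp only [real_inner_comm] at h ⊢
  exact h

lemma IsProblem.abs_taylor_objective_le (hP : IsProblem F P L σ) (x y : E n) :
    |objective F P y - objective F P x -
      inner ℝ (∫ ξ, gradient (fun u => F u ξ) x ∂P) (y - x)| ≤ (∫ ξ, L ξ ∂P) / 2 * ‖y - x‖ ^ 2 := by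
  rw [objective, objective, ← hP.integral_inner_gradient x (y - x),
    ← integral_sub (hP.integrable _) (hP.integrable _),
    ← integral_sub (f := fun ξ => F y ξ - F x ξ) ((hP.integrable y).sub (hP.integrable x))
      (hP.integrable_inner _ _), ← integral_div, ← integral_mul_const]
  refine (abs_integral_le_integral_abs).trans ?_
  refine integral_mono_ae ?_ ((hP.integrable_lipschitz.div_const 2).mul_const _) ?_
  · exact (((hP.integrable _).sub (hP.integrable _)).sub (hP.integrable_inner _ _)).abs
  · filter_upwards [hP.taylor] with ξ hξ
    exact hξ x y

/-- The Taylor remainder integrates to at most `E L / 2 · ‖y - x‖²`, so differentiation under the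
expectation comes directly from the definition of the gradient. -/
lemma IsProblem.hasGradientAt (hP : IsProblem F P L σ) (x : E n) :
    HasGradientAt (objective F P) (∫ ξ, gradient (fun u => F u ξ) x ∂P) x := by
  rw [hasGradientAt_iff_isLittleO]
  have h1 : (fun y => objective F P y - objective F P x -
      inner ℝ (∫ ξ, gradient (fun u => F u ξ) x ∂P) (y - x)) =O[nhds x]
      fun y => ‖y - x‖ ^ 2 := by
    refine Asymptotics.IsBigO.of_bound ((∫ ξ, L ξ ∂P) / 2) (Filter.Eventually.of_forall fun y => ?_)
    rw [Real.norm_eq_abs, Real.norm_eq_abs, abs_of_nonneg (by positivity : (0 : ℝ) ≤ ‖y - x‖ ^ 2)]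
    exact hP.abs_taylor_objective_le x y
  refine h1.trans_isLittleO ?_
  have h2 : Filter.Tendsto (fun y : E n => y - x) (nhds x) (nhds 0) := by
    have : Continuous fun y : E n => y - x := by fun_prop
    simpa using this.tendsto x
  have h3 := (Asymptotics.isLittleO_norm_pow_id (E' := E n) (n := 2) (by norm_num)).comp_tendsto h2
  exact h3

lemma IsProblem.gradient_objective (hP : IsProblem F P L σ) (x : E n) :
    gradient (objective F P) x = ∫ ξ, gradient (fun u => F u ξ) x ∂P :=
  (hP.hasGradientAt x).gradient

lemma IsProblem.differentiable_objective (hP : IsProblem F P L σ) :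
    Differentiable ℝ (objective F P) := fun x => (hP.hasGradientAt x).differentiableAt

lemma L2_sq (L : Ξ → ℝ) (P : Measure Ξ) : L2 L P ^ 2 = ∫ ξ, L ξ ^ 2 ∂P :=
  Real.sq_sqrt (integral_nonneg fun _ => sq_nonneg _)

lemma IsProblem.integral_lipschitz_le (hP : IsProblem F P L σ) (hL : 0 < L2 L P) :
    ∫ ξ, L ξ ∂P ≤ L2 L P := by
  have hi := hP.memLp.integrable_sq
  have h : ∫ ξ, 2 * L2 L P * L ξ ∂P ≤ ∫ ξ, (L ξ ^ 2 + L2 L P ^ 2) ∂P :=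
    integral_mono (hP.integrable_lipschitz.const_mul _) (hi.add (integrable_const _))
      fun ξ => by simp only; nlinarith [sq_nonneg (L ξ - L2 L P)]
  rw [integral_const_mul, integral_add hi (integrable_const _), ← L2_sq] at h
  simp only [integral_const, probReal_univ, one_smul] at h
  nlinarith

lemma IsProblem.objective_le (hP : IsProblem F P L σ) (hL : 0 < L2 L P) (x y : E n) :
    objective F P y ≤ objective F P x + inner ℝ (gradient (objective F P) x) (y - x) +
      L2 L P / 2 * ‖y - x‖ ^ 2 := by
  have h1 := (abs_le.1 (hP.abs_taylor_objective_le x y)).2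
  have h2 := hP.integral_lipschitz_le hL
  rw [hP.gradient_objective]
  nlinarith [sq_nonneg ‖y - x‖]

lemma IsProblem.le_objective (hP : IsProblem F P L σ) (x y : E n) :
    objective F P x + inner ℝ (gradient (objective F P) x) (y - x) ≤ objective F P y := by
  have h := gradient_inequality_of_midpoint hP.differentiable_objective (x := x) (h := y - x)
    (M := 0) fun s => by
      have hc := hP.convex.2 (Set.mem_univ (x + s • (y - x))) (Set.mem_univ x)
        (by norm_num : (0 : ℝ) ≤ 1 / 2) (by norm_num : (0 : ℝ) ≤ 1 / 2) (by norm_num)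
      rw [show (1 / 2 : ℝ) • (x + s • (y - x)) + (1 / 2 : ℝ) • x = x + (s / 2) • (y - x) by
        module] at hc
      simp only [smul_eq_mul] at hc
      linarith
  rw [add_sub_cancel] at h
  linarith

/-- Deviation of the stochastic gradient from its mean. -/
def gradNoise (F : E n → Ξ → ℝ) (P : Measure Ξ) (x : E n) (ξ : Ξ) : E n :=
  gradient (fun u => F u ξ) x - gradient (objective F P) x

lemma IsProblem.integrable_gradNoise (hP : IsProblem F P L σ) (x : E n) :
    Integrable (gradNoise F P x) P :=
  (hP.integrable_gradient x).sub (integrable_const _)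

lemma IsProblem.integral_gradNoise (hP : IsProblem F P L σ) (x : E n) :
    ∫ ξ, gradNoise F P x ξ ∂P = 0 := by
  simp only [gradNoise]
  rw [integral_sub (hP.integrable_gradient x) (integrable_const _), hP.gradient_objective]
  simp

lemma IsProblem.memLp_gradNoise (hP : IsProblem F P L σ) (x : E n) :
    MemLp (gradNoise F P x) 2 P := by
  refine ⟨(hP.integrable_gradNoise x).aestronglyMeasurable, ?_⟩
  rw [eLpNorm_lt_top_iff_lintegral_rpow_enorm_lt_top (by norm_num) (by norm_num)]
  have h := hP.variance x
  refine lt_of_le_of_lt ?_ (ENNReal.ofReal_lt_top (r := σ ^ 2))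
  simpa [gradNoise] using h

lemma IsProblem.integral_norm_gradNoise_sq_le (hP : IsProblem F P L σ) (x : E n) :
    ∫ ξ, ‖gradNoise F P x ξ‖ ^ 2 ∂P ≤ σ ^ 2 := by
  have hi := (hP.memLp_gradNoise x).integrable_norm_pow (p := 2) (by norm_num)
  rw [← ENNReal.ofReal_le_ofReal_iff (by positivity),
    ofReal_integral_eq_lintegral_ofReal hi (Filter.Eventually.of_forall fun ξ => by positivity)]
  refine le_trans (le_of_eq ?_) (hP.variance x)
  refine lintegral_congr fun ξ => ?_
  rw [ENNReal.ofReal_pow (norm_nonneg _), ofReal_norm]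
  rfl

end Problem

/-! ### Averages over a batch -/

section Batch

variable {Ξ : Type*} [MeasurableSpace Ξ] {P : Measure Ξ} [IsProbabilityMeasure P] {m : ℕ}

/-- The average of `X` over a batch. -/
def batchMean {V : Type*} [AddCommGroup V] [Module ℝ V] (X : Ξ → V) (ξ : Fin m → Ξ) : V :=
  (1 / (m : ℝ)) • ∑ i, X (ξ i)

lemma integrable_batchMean {V : Type*} [NormedAddCommGroup V] [NormedSpace ℝ V] {X : Ξ → V}
    (hX : Integrable X P) :
    Integrable (batchMean X : (Fin m → Ξ) → V) (Measure.pi fun _ => P) :=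
  (integrable_finsetSum _ fun i _ =>
    (measurePreserving_eval (fun _ : Fin m => P) i).integrable_comp_of_integrable hX).smul _

lemma integral_batchMean {V : Type*} [NormedAddCommGroup V] [NormedSpace ℝ V] [CompleteSpace V]
    {X : Ξ → V} (hX : Integrable X P) (hm : 0 < m) :
    ∫ ξ : Fin m → Ξ, batchMean X ξ ∂(Measure.pi fun _ => P) = ∫ ξ, X ξ ∂P := by
  have hm' : (m : ℝ) ≠ 0 := by exact_mod_cast hm.ne'
  have h1 : ∀ i : Fin m, ∫ ξ : Fin m → Ξ, X (ξ i) ∂(Measure.pi fun _ => P) = ∫ ξ, X ξ ∂P := by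
    intro i
    have hmp := measurePreserving_eval (fun _ : Fin m => P) i
    conv_rhs => rw [← hmp.map_eq]
    rw [integral_map hmp.measurable.aemeasurable (by
      rw [hmp.map_eq]; exact hX.aestronglyMeasurable)]
  have h2 : ∀ i : Fin m, Integrable (fun ξ : Fin m → Ξ => X (ξ i)) (Measure.pi fun _ => P) :=
    fun i => (measurePreserving_eval (fun _ : Fin m => P) i).integrable_comp_of_integrable hX
  simp only [batchMean]
  rw [integral_smul, integral_finsetSum _ fun i _ => h2 i]
  rw [Finset.sum_congr rfl fun i _ => h1 i]
  simp [← Nat.cast_smul_eq_nsmul ℝ, smul_smul, hm']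

/-- The variances of independent centred variables add up, and the factor `1 / m²` leaves `1 / m`.
The vector version follows by summing over coordinates. -/
lemma integral_batchMean_sq {Y : Ξ → ℝ} (hY : MemLp Y 2 P) (h0 : ∫ ξ, Y ξ ∂P = 0) (hm : 0 < m) :
    Integrable (fun ξ : Fin m → Ξ => batchMean Y ξ ^ 2) (Measure.pi fun _ => P) ∧
    ∫ ξ : Fin m → Ξ, batchMean Y ξ ^ 2 ∂(Measure.pi fun _ => P) = 1 / m * ∫ ξ, Y ξ ^ 2 ∂P := by
  have hm' : (m : ℝ) ≠ 0 := by exact_mod_cast hm.ne'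
  set μ : Measure (Fin m → Ξ) := Measure.pi fun _ => P with hμ
  have hmp : ∀ i, MeasurePreserving (fun ξ : Fin m → Ξ => ξ i) μ P :=
    measurePreserving_eval (fun _ : Fin m => P)
  have hZ : ∀ i, MemLp (fun ξ : Fin m → Ξ => Y (ξ i)) 2 μ := fun i => hY.comp_measurePreserving (hmp i)
  have hind : iIndepFun (fun (i : Fin m) (ξ : Fin m → Ξ) => Y (ξ i)) μ :=
    iIndepFun_pi fun _ => hY.aestronglyMeasurable.aemeasurable
  have hvar := IndepFun.variance_sum (s := Finset.univ)
    (X := fun (i : Fin m) (ξ : Fin m → Ξ) => Y (ξ i)) (fun i _ => hZ i)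
    (fun i _ j _ hij => hind.indepFun hij)
  have hsum : MemLp (∑ i, fun ξ : Fin m → Ξ => Y (ξ i)) 2 μ := memLp_finsetSum' _ fun i _ => hZ i
  have hYi : Integrable Y P := hY.integrable (by norm_num)
  have hzero : ∀ i, ∫ ξ : Fin m → Ξ, Y (ξ i) ∂μ = 0 := by
    intro i
    rw [← h0]
    conv_rhs => rw [← (hmp i).map_eq]
    rw [integral_map (hmp i).measurable.aemeasurable (by
      rw [(hmp i).map_eq]; exact hYi.aestronglyMeasurable)]
  have hsq : ∀ i, ∫ ξ : Fin m → Ξ, Y (ξ i) ^ 2 ∂μ = ∫ ξ, Y ξ ^ 2 ∂P := by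
    intro i
    conv_rhs => rw [← (hmp i).map_eq]
    rw [integral_map (hmp i).measurable.aemeasurable (by
      rw [(hmp i).map_eq]; exact hY.integrable_sq.aestronglyMeasurable)]
  have hmean : ∫ ξ, (∑ i, fun ξ : Fin m → Ξ => Y (ξ i)) ξ ∂μ = 0 := by
    simp only [Finset.sum_apply]
    rw [integral_finsetSum _ fun i _ => (hZ i).integrable (by norm_num)]
    simp [hzero]
  rw [variance_of_integral_eq_zero hsum.aestronglyMeasurable.aemeasurable hmean] at hvar
  have hv : ∀ i, variance (fun ξ : Fin m → Ξ => Y (ξ i)) μ = ∫ ξ, Y ξ ^ 2 ∂P := by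
    intro i
    rw [variance_of_integral_eq_zero (hZ i).aestronglyMeasurable.aemeasurable (hzero i)]
    exact hsq i
  simp only [hv, Finset.sum_const, Finset.card_univ, Fintype.card_fin, nsmul_eq_mul,
    Finset.sum_apply] at hvar
  have e : ∀ ξ : Fin m → Ξ, batchMean Y ξ ^ 2 = (1 / (m : ℝ)) ^ 2 * (∑ i, Y (ξ i)) ^ 2 := by
    intro ξ
    rw [batchMean, smul_eq_mul, mul_pow]
  simp only [e]
  refine ⟨?_, ?_⟩
  · have := hsum.integrable_sq.const_mul ((1 / (m : ℝ)) ^ 2)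
    simpa using this
  · rw [integral_const_mul, hvar]
    field_simp

/-- The variance of the average of a batch of independent vectors. -/
lemma integral_norm_batchMean_sq {X : Ξ → E n} (hX : MemLp X 2 P) (h0 : ∫ ξ, X ξ ∂P = 0)
    (hm : 0 < m) :
    Integrable (fun ξ : Fin m → Ξ => ‖batchMean X ξ‖ ^ 2) (Measure.pi fun _ => P) ∧
    ∫ ξ : Fin m → Ξ, ‖batchMean X ξ‖ ^ 2 ∂(Measure.pi fun _ => P) =
      1 / m * ∫ ξ, ‖X ξ‖ ^ 2 ∂P := by
  have hXi : Integrable X P := hX.integrable (by norm_num)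
  have hc : ∀ c, MemLp (fun ξ => X ξ c) 2 P := fun c =>
    (hX.continuousLinearMap_comp (EuclideanSpace.proj c : E n →L[ℝ] ℝ))
  have hc0 : ∀ c, ∫ ξ, X ξ c ∂P = 0 := by
    intro c
    have := (EuclideanSpace.proj c : E n →L[ℝ] ℝ).integral_comp_comm hXi
    rw [h0] at this
    simpa using this
  have hbc : ∀ (ξ : Fin m → Ξ) c, (batchMean X ξ) c = batchMean (fun ξ => X ξ c) ξ := by
    intro ξ c
    simp [batchMean]
  have hk := fun c => integral_batchMean_sq (m := m) (hc c) (hc0 c) hm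
  simp only [EuclideanSpace.real_norm_sq_eq, hbc]
  refine ⟨integrable_finsetSum _ fun c _ => (hk c).1, ?_⟩
  rw [integral_finsetSum _ fun c _ => (hk c).1, integral_finsetSum _ fun c _ => (hc c).integrable_sq,
    Finset.mul_sum]
  exact Finset.sum_congr rfl fun c _ => (hk c).2

end Batch

end ARDFDS
end

noncomputable section

namespace ARDFDS

variable {n : ℕ}

/-! ### One iteration -/

/-- Integration over the two factors of a product of an upper bound for a nonnegative function. -/
lemma lintegral_prod_ofReal_le {α β : Type*} [MeasurableSpace α] [MeasurableSpace β]
    {μ : Measure α} {ν : Measure β} [SFinite μ] [SFinite ν] {φ : α × β → ℝ} (hφ : Measurable φ)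
    (h0 : ∀ w, 0 ≤ φ w) {T : α → β → ℝ} (hT : ∀ᵐ w ∂μ.prod ν, φ w ≤ T w.1 w.2)
    (hT1 : ∀ b, Integrable (fun a => T a b) μ) (hT2 : Integrable (fun b => ∫ a, T a b ∂μ) ν) :
    ∫⁻ w, ENNReal.ofReal (φ w) ∂μ.prod ν ≤ ENNReal.ofReal (∫ b, ∫ a, T a b ∂μ ∂ν) := by
  have hae : ∀ᵐ b ∂ν, ∀ᵐ a ∂μ, φ (a, b) ≤ T a b := by
    have h1 : ∀ᵐ w ∂ν.prod μ, φ w.swap ≤ T w.swap.1 w.swap.2 :=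
      (Measure.measurePreserving_swap (μ := ν) (ν := μ)).quasiMeasurePreserving.ae hT
    exact Measure.ae_ae_of_ae_prod h1
  rw [lintegral_prod_symm _ hφ.ennreal_ofReal.aemeasurable]
  have hnn : ∀ᵐ b ∂ν, 0 ≤ ∫ a, T a b ∂μ := by
    filter_upwards [hae] with b hb
    refine integral_nonneg_of_ae ?_
    filter_upwards [hb] with a ha
    exact (h0 _).trans ha
  rw [ofReal_integral_eq_lintegral_ofReal hT2 hnn]
  refine lintegral_mono_ae ?_
  filter_upwards [hae] with b hb
  rw [ofReal_integral_eq_lintegral_ofReal (hT1 b) (by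
    filter_upwards [hb] with a ha
    exact (h0 _).trans ha)]
  refine lintegral_mono_ae ?_
  filter_upwards [hb] with a ha
  exact ENNReal.ofReal_le_ofReal ha

/-- The upper bound for the potential after one iteration, in terms of the direction `e`; `g` is
the gradient, `h` its stochastic error, `v` the distance of the mirror point from the minimizer,
`w` the squared dual norm and `R` the squared error of finite differences. -/
def stepBound (C c₁ c₂ c₃ c₄ c₅ c₆ c₇ : ℝ) (w : E n → ℝ) (g h v e : E n) : ℝ :=
  C + c₁ * inner ℝ g e ^ 2 + c₂ * inner ℝ h e ^ 2 - c₃ * (inner ℝ (g + h) e * inner ℝ v e) +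
    c₄ * inner ℝ v e ^ 2 + c₅ * (inner ℝ g e ^ 2 * w e) + c₆ * (inner ℝ h e ^ 2 * w e) + c₇ * w e

lemma integral_stepBound (hn : 0 < n) (C c₁ c₂ c₃ c₄ c₅ c₆ c₇ : ℝ) {w : E n → ℝ}
    (hw : Continuous w) {ρ : ℝ} (hw1 : ∫ e, w e ∂sphereLaw n = ρ)
    (hw2 : ∀ u : E n, ∫ e, inner ℝ u e ^ 2 * w e ∂sphereLaw n = ‖u‖ ^ 2 / n * ρ) (g h v : E n) :
    Integrable (stepBound C c₁ c₂ c₃ c₄ c₅ c₆ c₇ w g h v) (sphereLaw n) ∧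
    ∫ e, stepBound C c₁ c₂ c₃ c₄ c₅ c₆ c₇ w g h v e ∂sphereLaw n =
      C + c₁ * (‖g‖ ^ 2 / n) + c₂ * (‖h‖ ^ 2 / n) - c₃ * (inner ℝ (g + h) v / n) +
        c₄ * (‖v‖ ^ 2 / n) + c₅ * (‖g‖ ^ 2 / n * ρ) + c₆ * (‖h‖ ^ 2 / n * ρ) + c₇ * ρ := by
  have := isProbabilityMeasure_sphereLaw hn
  have i0 : Integrable (fun _ : E n => C) (sphereLaw n) := integrable_const _
  have i1 : ∀ (c : ℝ) (u : E n), Integrable (fun e : E n => c * inner ℝ u e ^ 2) (sphereLaw n) :=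
    fun c u => integrable_sphereLaw (by fun_prop)
  have i2 : Integrable (fun e : E n => c₃ * (inner ℝ (g + h) e * inner ℝ v e)) (sphereLaw n) :=
    integrable_sphereLaw (by fun_prop)
  have i3 : ∀ (c : ℝ) (u : E n), Integrable (fun e : E n => c * (inner ℝ u e ^ 2 * w e))
      (sphereLaw n) := fun c u => integrable_sphereLaw (by fun_prop)
  have i4 : Integrable (fun e : E n => c₇ * w e) (sphereLaw n) := integrable_sphereLaw (by fun_prop)
  have j1 := i0.add (i1 c₁ g)
  have j2 := j1.add (i1 c₂ h)
  have j3 := j2.sub i2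
  have j4 := j3.add (i1 c₄ v)
  have j5 := j4.add (i3 c₅ g)
  have j6 := j5.add (i3 c₆ h)
  have j7 := j6.add i4
  refine ⟨j7, ?_⟩
  have e7 := integral_add j6 i4
  have e6 := integral_add j5 (i3 c₆ h)
  have e5 := integral_add j4 (i3 c₅ g)
  have e4 := integral_add j3 (i1 c₄ v)
  have e3 := integral_sub j2 i2
  have e2 := integral_add j1 (i1 c₂ h)
  have e1 := integral_add i0 (i1 c₁ g)
  simp only [Pi.add_apply, Pi.sub_apply] at e1 e2 e3 e4 e5 e6 e7
  simp only [stepBound]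
  rw [e7, e6, e5, e4, e3, e2, e1]
  simp only [integral_const_mul, integral_inner_sq hn, integral_inner_mul_inner hn, hw1, hw2]
  simp

/-! ### Finite-difference error over a batch, and measurability of one step. -/

section Step

variable {Ξ : Type*} {m : ℕ}

/-- The average of the difference quotients over a batch. -/
def batchSlope (ft : E n → Ξ → ℝ) (t : ℝ) (x e : E n) (ξ : Fin m → Ξ) : ℝ :=
  batchMean (fun ζ => (ft (x + t • e) ζ - ft x ζ) / t) ξ

lemma gradEst_fst (ft : E n → Ξ → ℝ) (t : ℝ) (x e : E n) (ξ : Fin m → Ξ) :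
    (gradEst ft t x e ξ).1 = batchSlope ft t x e ξ • e := by
  simp only [gradEst, oracleCall, batchSlope, batchMean]
  rw [← Finset.sum_smul, smul_smul, smul_eq_mul]

/-- One iteration of the method, without the counter of the oracle calls. -/
def step (ft : E n → Ξ → ℝ) (d : E n → ℝ) (ℓ : ℝ) (α : ℕ → ℝ) (t : ℝ) (k : ℕ) (s : E n × E n)
    (w : E n × (Fin m → Ξ)) : E n × E n :=
  let τ : ℝ := 2 / ((k : ℝ) + 2)
  let x : E n := τ • s.2 + (1 - τ) • s.1
  (x - (1 / (2 * ℓ)) • (gradEst ft t x w.1 w.2).1,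
    mirrorStep d (α (k + 1) * n) (gradEst ft t x w.1 w.2).1 s.2)

lemma sq_batchMean_le {Y Z : Ξ → ℝ} (ξ : Fin m → Ξ) (h : ∀ i, Y (ξ i) ^ 2 ≤ Z (ξ i)) :
    batchMean Y ξ ^ 2 ≤ batchMean Z ξ := by
  rcases Nat.eq_zero_or_pos m with rfl | hm
  · simp [batchMean]
  have hm' : (0 : ℝ) < m := by exact_mod_cast hm
  simp only [batchMean, smul_eq_mul]
  have h1 := sq_sum_le_card_mul_sum_sq (s := Finset.univ) (f := fun i => Y (ξ i))
  rw [Finset.card_univ, Fintype.card_fin] at h1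
  have h2 := Finset.sum_le_sum fun i (_ : i ∈ Finset.univ) => h i
  have h3 : (∑ i, Y (ξ i)) ^ 2 ≤ m * ∑ i, Z (ξ i) := h1.trans (by gcongr)
  rw [mul_pow]
  calc (1 / (m : ℝ)) ^ 2 * (∑ i, Y (ξ i)) ^ 2 ≤ (1 / (m : ℝ)) ^ 2 * (m * ∑ i, Z (ξ i)) := by
        gcongr
    _ = _ := by field_simp

variable [MeasurableSpace Ξ]

/-- Upper bound for the squared error of the difference quotients over a batch. -/
def batchError (L : Ξ → ℝ) (t Δ : ℝ) (ξ : Fin m → Ξ) : ℝ :=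
  batchMean (fun ζ => t ^ 2 / 2 * L ζ ^ 2 + 8 * Δ ^ 2 / t ^ 2) ξ

/-- For each sample the error is `(A + B) / t`, with Taylor remainder `|A| ≤ L t² / 2` and noise
`|B| ≤ 2Δ`. Apply `(A + B)² ≤ 2A² + 2B²`, then convexity of the square over the batch. -/
lemma batchSlope_error_sq_le {P : Measure Ξ} {F η : E n → Ξ → ℝ} {L : Ξ → ℝ} {t Δ : ℝ}
    (ht : 0 < t) (hm : 0 < m) {x e : E n} (he : ‖e‖ = 1) {ξ : Fin m → Ξ}
    (hT : ∀ i, |F (x + t • e) (ξ i) - F x (ξ i) -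
      inner ℝ (gradient (fun u => F u (ξ i)) x) (t • e)| ≤ L (ξ i) / 2 * ‖t • e‖ ^ 2)
    (h1 : ∀ i, |η (x + t • e) (ξ i)| ≤ Δ) (h2 : ∀ i, |η x (ξ i)| ≤ Δ) :
    (batchSlope (fun x w => F x w + η x w) t x e ξ - inner ℝ (gradient (objective F P) x) e -
      inner ℝ (batchMean (gradNoise F P x) ξ) e) ^ 2 ≤ batchError L t Δ ξ := by
  have hm' : (m : ℝ) ≠ 0 := by exact_mod_cast hm.ne'
  have e1 : batchSlope (fun x w => F x w + η x w) t x e ξ -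
      inner ℝ (gradient (objective F P) x) e - inner ℝ (batchMean (gradNoise F P x) ξ) e =
      batchMean (fun ζ => (F (x + t • e) ζ + η (x + t • e) ζ - (F x ζ + η x ζ)) / t -
        inner ℝ (gradient (fun u => F u ζ) x) e) ξ := by
    simp only [batchSlope, batchMean, gradNoise, smul_eq_mul, Finset.sum_sub_distrib,
      real_inner_smul_left, inner_sub_left, sum_inner, Finset.sum_const, Finset.card_univ,
      Fintype.card_fin, ← Nat.cast_smul_eq_nsmul ℝ]
    field_simp
    ring
  rw [e1]
  refine sq_batchMean_le ξ fun i => ?_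
  have hTi := hT i
  rw [norm_smul, he, mul_one, Real.norm_eq_abs, sq_abs, real_inner_smul_right] at hTi
  set A := F (x + t • e) (ξ i) - F x (ξ i) - t * inner ℝ (gradient (fun u => F u (ξ i)) x) e with hA
  set B := η (x + t • e) (ξ i) - η x (ξ i) with hB
  have hB2 : |B| ≤ 2 * Δ := by
    have := abs_sub (η (x + t • e) (ξ i)) (η x (ξ i))
    have := h1 i
    have := h2 i
    linarith
  have e2 : (F (x + t • e) (ξ i) + η (x + t • e) (ξ i) - (F x (ξ i) + η x (ξ i))) / t -
      inner ℝ (gradient (fun u => F u (ξ i)) x) e = (A + B) / t := by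
    rw [hA, hB]
    field_simp
    ring
  rw [e2, div_pow, div_le_iff₀ (by positivity)]
  have hA2 : A ^ 2 ≤ (L (ξ i) / 2 * t ^ 2) ^ 2 := sq_le_sq' (abs_le.1 hTi).1 (abs_le.1 hTi).2
  have hB3 : B ^ 2 ≤ (2 * Δ) ^ 2 := sq_le_sq' (abs_le.1 hB2).1 (abs_le.1 hB2).2
  have e3 : (t ^ 2 / 2 * L (ξ i) ^ 2 + 8 * Δ ^ 2 / t ^ 2) * t ^ 2 =
      2 * (L (ξ i) / 2 * t ^ 2) ^ 2 + 2 * (2 * Δ) ^ 2 := by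
    field_simp
    ring
  rw [e3]
  nlinarith [sq_nonneg (A - B)]

lemma ae_batchSlope_error {P : Measure Ξ} [IsProbabilityMeasure P] {F η : E n → Ξ → ℝ} {L : Ξ → ℝ}
    {σ t Δ : ℝ} (hn : 0 < n) (hP : IsProblem F P L σ) (hη : Measurable (Function.uncurry η))
    (hΔ : ∀ x, ∀ᵐ ξ ∂P, |η x ξ| ≤ Δ) (ht : 0 < t) (hm : 0 < m) (x : E n) :
    ∀ᵐ w ∂(sphereLaw n).prod (Measure.pi fun _ : Fin m => P), ‖w.1‖ = 1 ∧
      (batchSlope (fun x w => F x w + η x w) t x w.1 w.2 -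
        inner ℝ (gradient (objective F P) x) w.1 -
        inner ℝ (batchMean (gradNoise F P x) w.2) w.1) ^ 2 ≤ batchError L t Δ w.2 := by
  have := isProbabilityMeasure_sphereLaw hn
  have hev : ∀ (i : Fin m) {p : Ξ → Prop}, (∀ᵐ ξ ∂P, p ξ) →
      ∀ᵐ ξ ∂(Measure.pi fun _ : Fin m => P), p (ξ i) := fun i p hp =>
    (measurePreserving_eval (fun _ : Fin m => P) i).quasiMeasurePreserving.ae hp
  have a1 : ∀ᵐ w ∂(sphereLaw n).prod (Measure.pi fun _ : Fin m => P), ‖w.1‖ = 1 :=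
    Measure.quasiMeasurePreserving_fst.ae (ae_norm_eq_one n)
  have a2 : ∀ᵐ w ∂(sphereLaw n).prod (Measure.pi fun _ : Fin m => P), ∀ i, |η x (w.2 i)| ≤ Δ :=
    Measure.quasiMeasurePreserving_snd.ae (ae_all_iff.2 fun i => hev i (hΔ x))
  have a3 : ∀ᵐ w ∂(sphereLaw n).prod (Measure.pi fun _ : Fin m => P), ∀ i, ∀ x y : E n,
      |F y (w.2 i) - F x (w.2 i) - inner ℝ (gradient (fun u => F u (w.2 i)) x) (y - x)| ≤
        L (w.2 i) / 2 * ‖y - x‖ ^ 2 :=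
    Measure.quasiMeasurePreserving_snd.ae (ae_all_iff.2 fun i => hev i hP.taylor)
  -- The exceptional null set in `hΔ` depends on the point, and `x + t e` is random. Fubini settles
  -- this because the direction is independent of the batch.
  have a4 : ∀ᵐ w ∂(sphereLaw n).prod (Measure.pi fun _ : Fin m => P), ∀ i,
      |η (x + t • w.1) (w.2 i)| ≤ Δ := by
    rw [ae_all_iff]
    intro i
    have hmeas : Measurable fun w : E n × (Fin m → Ξ) => η (x + t • w.1) (w.2 i) :=
      hη.comp ((measurable_const.add (measurable_fst.const_smul t)).prodMk
        ((measurable_pi_apply i).comp measurable_snd))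
    have hset : MeasurableSet {w : E n × (Fin m → Ξ) | |η (x + t • w.1) (w.2 i)| ≤ Δ} :=
      measurableSet_le (by fun_prop) measurable_const
    rw [Measure.ae_prod_iff_ae_ae hset]
    exact Filter.Eventually.of_forall fun e => hev i (hΔ (x + t • e))
  filter_upwards [a1, a2, a3, a4] with w h1 h2 h3 h4
  refine ⟨h1, batchSlope_error_sq_le ht hm h1 (fun i => ?_) h4 h2⟩
  simpa using h3 i x (x + t • w.1)

lemma measurable_batchSlope {ft : E n → Ξ → ℝ} (hft : Measurable (Function.uncurry ft)) (t : ℝ)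
    {β : Type*} [MeasurableSpace β] {x e : β → E n} {ξ : β → Fin m → Ξ} (hx : Measurable x)
    (he : Measurable e) (hξ : Measurable ξ) :
    Measurable fun b => batchSlope ft t (x b) (e b) (ξ b) := by
  simp only [batchSlope, batchMean, smul_eq_mul]
  refine (Finset.measurable_sum _ fun i _ => ?_).const_mul _
  have hi : Measurable fun b => ξ b i := (measurable_pi_apply i).comp hξ
  have h1 : Measurable fun b => ft (x b + t • e b) (ξ b i) :=
    hft.comp ((hx.add (he.const_smul t)).prodMk hi)
  have h2 : Measurable fun b => ft (x b) (ξ b i) := hft.comp (hx.prodMk hi)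
  exact (h1.sub h2).div_const t

lemma measurable_step {p : ENNReal} {ft : E n → Ξ → ℝ} (hft : Measurable (Function.uncurry ft))
    {d : E n → ℝ} (hp : 1 ≤ p) (hp2 : p ≤ 2) (hd : IsProxFunction p d) (ℓ : ℝ) (α : ℕ → ℝ) (t : ℝ)
    (k : ℕ) : Measurable fun a : (E n × E n) × (E n × (Fin m → Ξ)) =>
      step ft d ℓ α t k a.1 a.2 := by
  simp only [step, gradEst_fst]
  have hx : Measurable fun a : (E n × E n) × (E n × (Fin m → Ξ)) =>
      (2 / ((k : ℝ) + 2)) • a.1.2 + (1 - 2 / ((k : ℝ) + 2)) • a.1.1 := by fun_prop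
  have hG := (measurable_batchSlope hft t hx (measurable_fst.comp measurable_snd)
    (measurable_snd.comp measurable_snd)).smul
      ((measurable_fst.comp measurable_snd : Measurable
        fun a : (E n × E n) × (E n × (Fin m → Ξ)) => a.2.1))
  exact (hx.sub (hG.const_smul (1 / (2 * ℓ)))).prodMk
    (measurable_mirrorStep hp hp2 hd _ hG (measurable_snd.comp measurable_fst))

end Step

end ARDFDS
end

noncomputable section

namespace ARDFDS

/-! ### Expected change of the potential in one iteration. -/

variable {n m : ℕ} {Ξ : Type*} [MeasurableSpace Ξ] {P : Measure Ξ} [IsProbabilityMeasure P]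
  {F : E n → Ξ → ℝ} {L : Ξ → ℝ} {σ : ℝ}

/-- The given `t` satisfies `t² = 4Δ / L₂`, which minimizes the expected bound: smoothing error and
noise contribute `2 Δ L₂` each. -/
lemma integral_batchError (hP : IsProblem F P L σ) (hL : 0 < L2 L P) (hm : 0 < m) {t Δ : ℝ}
    (hΔ : 0 < Δ) (ht : t = 2 * √(Δ / L2 L P)) :
    Integrable (batchError L t Δ : (Fin m → Ξ) → ℝ) (Measure.pi fun _ => P) ∧
    ∫ ξ : Fin m → Ξ, batchError L t Δ ξ ∂(Measure.pi fun _ => P) = 4 * Δ * L2 L P := by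
  have hi : Integrable (fun ζ => t ^ 2 / 2 * L ζ ^ 2 + 8 * Δ ^ 2 / t ^ 2) P :=
    (hP.memLp.integrable_sq.const_mul _).add (integrable_const _)
  refine ⟨integrable_batchMean hi, ?_⟩
  have ht2 : t ^ 2 = 4 * Δ / L2 L P := by
    rw [ht, mul_pow, Real.sq_sqrt (by positivity)]
    ring
  simp only [batchError]
  rw [integral_batchMean hi hm, integral_add (hP.memLp.integrable_sq.const_mul _)
    (integrable_const _), integral_const_mul, ← L2_sq, ht2]
  simp only [integral_const, probReal_univ, one_smul]
  field_simp
  ring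

/-- Gradient step along a random direction, with errors `b` and `r`. -/
lemma IsProblem.objective_gradient_step_le (hP : IsProblem F P L σ) (hL : 0 < L2 L P) {x e : E n}
    (he : ‖e‖ = 1) {b r R : ℝ} (hr : r ^ 2 ≤ R) :
    objective F P (x - (1 / (2 * L2 L P)) •
        ((inner ℝ (gradient (objective F P) x) e + b + r) • e)) ≤
      objective F P x - inner ℝ (gradient (objective F P) x) e ^ 2 / (4 * L2 L P) +
        (b ^ 2 + R) / (2 * L2 L P) := by
  set ℓ := L2 L P with hℓ
  set a : ℝ := inner ℝ (gradient (objective F P) x) e with ha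
  have h := hP.objective_le hL x (x - (1 / (2 * ℓ)) • ((a + b + r) • e))
  rw [show x - (1 / (2 * ℓ)) • ((a + b + r) • e) - x = (-(1 / (2 * ℓ) * (a + b + r))) • e by
    module, real_inner_smul_right, norm_smul, he, mul_one, Real.norm_eq_abs, sq_abs, ← ha,
    ← hℓ] at h
  refine h.trans ?_
  have e1 : objective F P x + -(1 / (2 * ℓ) * (a + b + r)) * a +
      ℓ / 2 * (-(1 / (2 * ℓ) * (a + b + r))) ^ 2 =
      objective F P x + ((a + b + r) ^ 2 - 4 * (a + b + r) * a) / (8 * ℓ) := by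
    field_simp
    ring
  have e2 : objective F P x - a ^ 2 / (4 * ℓ) + (b ^ 2 + R) / (2 * ℓ) =
      objective F P x + (4 * (b ^ 2 + R) - 2 * a ^ 2) / (8 * ℓ) := by
    field_simp
    ring
  rw [e1, e2]
  refine add_le_add_right (div_le_div_of_nonneg_right ?_ (by positivity)) _
  -- With `s = a + b + r`, one has `s² - 4sa = (b + r - a)² - 4a²`, and `(b + r - a)² ≤ 4b² + 4r² +
  -- 2a²`.
  nlinarith [sq_nonneg (a + b + r), sq_nonneg (b - r)]

/-- The error `r` depends on `e` in an uncontrolled way, so it is eliminated in favour of `R`. What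
remains is quadratic in `e` up to the weight `‖e‖_q²`, and its mean over the sphere is explicit. -/
lemma potential_step_le_stepBound {p q : ENNReal} {d : E n → ℝ} (hp : 1 ≤ p) (hp2 : p ≤ 2)
    (hpq : p⁻¹ + q⁻¹ = 1) (hd : IsProxFunction p d) (hP : IsProblem F P L σ) (hL : 0 < L2 L P)
    {x z u e h : E n} (he : ‖e‖ = 1) {γ R A α N fs : ℝ} (hA : 0 ≤ A) (hN : 0 < N)
    (hr : (γ - inner ℝ (gradient (objective F P) x) e - inner ℝ h e) ^ 2 ≤ R) :
    A * (objective F P (x - (1 / (2 * L2 L P)) • (γ • e)) - fs) +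
        bregman d (mirrorStep d (α * n) (γ • e) z) u ≤
      stepBound (A * (objective F P x - fs) + bregman d z u + A * R / (2 * L2 L P) +
          α ^ 2 * n * N * R / 2) (-A / (4 * L2 L P)) (A / (2 * L2 L P)) (α * n) (n / (2 * N))
        (α ^ 2 * n ^ 2) (2 * α ^ 2 * n ^ 2) (2 * α ^ 2 * n ^ 2 * R) (fun e => pNorm q e ^ 2)
        (gradient (objective F P) x) h (z - u) e := by
  set ℓ := L2 L P with hℓ
  set a : ℝ := inner ℝ (gradient (objective F P) x) e with ha
  set b : ℝ := inner ℝ h e with hb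
  set r : ℝ := γ - a - b with hrdef
  set c : ℝ := inner ℝ (z - u) e with hc
  have hγ : γ = a + b + r := by rw [hrdef]; ring
  have hn0 : (0 : ℝ) ≤ n := Nat.cast_nonneg n
  have hq1 : 1 ≤ q := le_trans (by norm_num) (two_le_of_conj hp2 hpq)
  have h1 := hP.objective_gradient_step_le hL (x := x) he (b := b) hr
  rw [← ha, ← hγ, ← hℓ] at h1
  have h2 := mirrorStep_inequality hp hp2 hpq hd (α * n) (γ • e) z u
  rw [real_inner_smul_left, pNorm_smul hq1, real_inner_comm, ← hc, mul_pow |γ|, sq_abs] at h2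
  have h3 : (α * n) ^ 2 / 2 * (γ ^ 2 * pNorm q e ^ 2) ≤
      α ^ 2 * n ^ 2 * (a ^ 2 + 2 * b ^ 2 + 2 * R) * pNorm q e ^ 2 := by
    have h4 : γ ^ 2 ≤ 2 * (a ^ 2 + 2 * b ^ 2 + 2 * R) := by
      rw [hγ]
      nlinarith [sq_nonneg (a - (b + r)), sq_nonneg (b - r)]
    calc (α * n) ^ 2 / 2 * (γ ^ 2 * pNorm q e ^ 2)
        ≤ (α * n) ^ 2 / 2 * (2 * (a ^ 2 + 2 * b ^ 2 + 2 * R) * pNorm q e ^ 2) := by gcongr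
      _ = _ := by ring
  -- Young with weight `N`: the part in `c²` averages to `‖z - u‖² / (2N)`, small enough to be
  -- compounded over `N` steps.
  have h5 : -(α * n * (r * c)) ≤ n / (2 * N) * c ^ 2 + α ^ 2 * n * N * R / 2 := by
    have h6 : -(α * (r * c)) ≤ 1 / (2 * N) * c ^ 2 + α ^ 2 * N * R / 2 := by
      have h7 : 1 / (2 * N) * c ^ 2 + α ^ 2 * N * R / 2 =
          (c ^ 2 + α ^ 2 * N ^ 2 * R) / (2 * N) := by field_simp
      rw [h7, le_div_iff₀ (by positivity)]
      have h8 : α ^ 2 * N ^ 2 * r ^ 2 ≤ α ^ 2 * N ^ 2 * R := by gcongr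
      nlinarith [sq_nonneg (c + α * N * r)]
    calc -(α * n * (r * c)) = n * -(α * (r * c)) := by ring
      _ ≤ n * (1 / (2 * N) * c ^ 2 + α ^ 2 * N * R / 2) := by gcongr
      _ = _ := by ring
  have h9 : A * (objective F P (x - (1 / (2 * ℓ)) • (γ • e)) - fs) ≤
      A * (objective F P x - a ^ 2 / (4 * ℓ) + (b ^ 2 + R) / (2 * ℓ) - fs) := by gcongr
  simp only [stepBound, inner_add_left]
  rw [← ha, ← hb, ← hc]
  have e1 : α * n * (γ * c) = α * n * ((a + b) * c) + α * n * (r * c) := by rw [hγ]; ring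
  have e2 : A * (objective F P x - a ^ 2 / (4 * ℓ) + (b ^ 2 + R) / (2 * ℓ) - fs) =
      A * (objective F P x - fs) + A * R / (2 * ℓ) + -A / (4 * ℓ) * a ^ 2 +
        A / (2 * ℓ) * b ^ 2 := by ring
  nlinarith

/-- The recursive inequality of the method for the conditional expectation, before the choice of
the stepsizes. -/
lemma lintegral_potential_step_le {p q : ENNReal} {d : E n → ℝ} (hn : 8 ≤ n) (hp : 1 ≤ p)
    (hp2 : p ≤ 2) (hpq : p⁻¹ + q⁻¹ = 1) (hd : IsProxFunction p d) (hP : IsProblem F P L σ)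
    (hL : 0 < L2 L P) {η : E n → Ξ → ℝ} (hη : Measurable (Function.uncurry η)) {Δ t : ℝ}
    (hΔ : 0 < Δ) (hηΔ : ∀ x, ∀ᵐ ξ ∂P, |η x ξ| ≤ Δ) (ht : t = 2 * √(Δ / L2 L P)) (hm : 0 < m)
    {fs : ℝ} (hfs : ∀ x, fs ≤ objective F P x) {A α N : ℝ} (hA : 0 ≤ A) (hN : 0 < N)
    (x z u : E n) :
    ∫⁻ w, ENNReal.ofReal (A * (objective F P (x - (1 / (2 * L2 L P)) •
        (batchSlope (fun x w => F x w + η x w) t x w.1 w.2 • w.1)) - fs) +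
        bregman d (mirrorStep d (α * n) (batchSlope (fun x w => F x w + η x w) t x w.1 w.2 • w.1) z)
          u) ∂(sphereLaw n).prod (Measure.pi fun _ : Fin m => P) ≤
      ENNReal.ofReal (A * (objective F P x - fs) + bregman d z u
        - A / (4 * L2 L P) * (‖gradient (objective F P) x‖ ^ 2 / n)
        - α * inner ℝ (gradient (objective F P) x) (z - u) + ‖z - u‖ ^ 2 / (2 * N)
        + α ^ 2 * n * ‖gradient (objective F P) x‖ ^ 2 * (3 * rho n q)
        + (A / (2 * L2 L P) / n + 2 * α ^ 2 * n * (3 * rho n q)) * (σ ^ 2 / m)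
        + (A / (2 * L2 L P) + α ^ 2 * n * N / 2 + 2 * α ^ 2 * n ^ 2 * (3 * rho n q)) *
          (4 * Δ * L2 L P)) := by
  have hn0 : 0 < n := by omega
  have hn' : (0 : ℝ) < n := by exact_mod_cast hn0
  have hm' : (0 : ℝ) < m := by exact_mod_cast hm
  have := isProbabilityMeasure_sphereLaw hn0
  have hq := two_le_of_conj hp2 hpq
  have hq1 : 1 ≤ q := le_trans (by norm_num) hq
  have ht0 : 0 < t := by rw [ht]; positivity
  set ℓ := L2 L P with hℓ
  set g := gradient (objective F P) x with hg
  set ft : E n → Ξ → ℝ := fun x w => F x w + η x w with hft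
  have hftm : Measurable (Function.uncurry ft) := hP.measurable.add hη
  have hfm : Measurable (objective F P) := hP.differentiable_objective.continuous.measurable
  set μ := sphereLaw n with hμ
  set π : Measure (Fin m → Ξ) := Measure.pi fun _ : Fin m => P with hπ
  have hGm : Measurable fun w : E n × (Fin m → Ξ) => batchSlope ft t x w.1 w.2 • w.1 :=
    (measurable_batchSlope hftm t measurable_const measurable_fst measurable_snd).smul
      measurable_fst
  have hφm : Measurable fun w : E n × (Fin m → Ξ) =>
      A * (objective F P (x - (1 / (2 * ℓ)) • (batchSlope ft t x w.1 w.2 • w.1)) - fs) +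
        bregman d (mirrorStep d (α * n) (batchSlope ft t x w.1 w.2 • w.1) z) u := by
    refine Measurable.add ?_ ?_
    · exact ((hfm.comp (measurable_const.sub (hGm.const_smul (1 / (2 * ℓ))))).sub_const fs).const_mul
        A
    · exact (measurable_bregman hd u).comp (measurable_mirrorStep hp hp2 hd _ hGm measurable_const)
  let H : (Fin m → Ξ) → E n := batchMean (gradNoise F P x)
  let R : (Fin m → Ξ) → ℝ := batchError L t Δ
  set ρ' : ℝ := ∫ e, pNorm q e ^ 2 ∂μ with hρ'
  have hρ0 : 0 ≤ ρ' := integral_nonneg fun e => by positivity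
  have hρ3 : ρ' ≤ 3 * rho n q := integral_pNorm_sq_le hn hq
  let T : E n → (Fin m → Ξ) → ℝ := fun e ξ =>
    stepBound (A * (objective F P x - fs) + bregman d z u + A * R ξ / (2 * ℓ) +
        α ^ 2 * n * N * R ξ / 2) (-A / (4 * ℓ)) (A / (2 * ℓ)) (α * n) (n / (2 * N))
        (α ^ 2 * n ^ 2) (2 * α ^ 2 * n ^ 2) (2 * α ^ 2 * n ^ 2 * R ξ) (fun e => pNorm q e ^ 2)
        g (H ξ) (z - u) e
  have hT := fun ξ => integral_stepBound hn0 (w := fun e => pNorm q e ^ 2)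
    (A * (objective F P x - fs) + bregman d z u +
    A * R ξ / (2 * ℓ) + α ^ 2 * n * N * R ξ / 2) (-A / (4 * ℓ)) (A / (2 * ℓ)) (α * n) (n / (2 * N))
    (α ^ 2 * n ^ 2) (2 * α ^ 2 * n ^ 2) (2 * α ^ 2 * n ^ 2 * R ξ)
    ((continuous_pNorm hq1).pow 2) hρ'.symm (fun v => integral_inner_sq_mul_pNorm_sq hn0 hq1 v)
    g (H ξ) (z - u)
  have hle : ∀ᵐ w ∂μ.prod π,
      A * (objective F P (x - (1 / (2 * ℓ)) • (batchSlope ft t x w.1 w.2 • w.1)) - fs) +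
        bregman d (mirrorStep d (α * n) (batchSlope ft t x w.1 w.2 • w.1) z) u ≤ T w.1 w.2 := by
    filter_upwards [ae_batchSlope_error hn0 hP hη hηΔ ht0 hm x] with w hw
    exact potential_step_le_stepBound hp hp2 hpq hd hP hL hw.1 hA hN hw.2
  obtain ⟨hR1, hR2⟩ := integral_batchError hP hL hm hΔ ht
  obtain ⟨hH1, hH2⟩ := integral_norm_batchMean_sq (m := m) (hP.memLp_gradNoise x)
    (hP.integral_gradNoise x) hm
  have hHi : Integrable H π := integrable_batchMean (hP.integrable_gradNoise x)
  -- The batch noise is centred, so the only term linear in it disappears; just its variance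
  -- remains.
  have hHv : ∫ ξ, inner ℝ (z - u) (H ξ) ∂π = 0 := by
    rw [integral_inner (𝕜 := ℝ) hHi, integral_batchMean (hP.integrable_gradNoise x) hm,
      hP.integral_gradNoise, inner_zero_right]
  have hHvi : Integrable (fun ξ => inner ℝ (z - u) (H ξ)) π := hHi.const_inner _
  let K₀ : ℝ := A * (objective F P x - fs) + bregman d z u - A / (4 * ℓ) * (‖g‖ ^ 2 / n) -
    α * inner ℝ g (z - u) + ‖z - u‖ ^ 2 / (2 * N) + α ^ 2 * n * ‖g‖ ^ 2 * ρ'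
  let K₁ : ℝ := A / (2 * ℓ) / n + 2 * α ^ 2 * n * ρ'
  let K₂ : ℝ := A / (2 * ℓ) + α ^ 2 * n * N / 2 + 2 * α ^ 2 * n ^ 2 * ρ'
  have hTbar : ∀ ξ, ∫ e, T e ξ ∂μ = K₀ + K₁ * ‖H ξ‖ ^ 2 + K₂ * R ξ - α * inner ℝ (z - u) (H ξ) := by
    intro ξ
    simp only [T]
    rw [(hT ξ).2, inner_add_left, real_inner_comm (H ξ)]
    simp only [K₀, K₁, K₂]
    field_simp
    ring
  have i1 : Integrable (fun ξ => K₀ + K₁ * ‖H ξ‖ ^ 2) π := (integrable_const _).add (hH1.const_mul _)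
  have i2 : Integrable (fun ξ => K₀ + K₁ * ‖H ξ‖ ^ 2 + K₂ * R ξ) π := i1.add (hR1.const_mul _)
  have i3 : Integrable (fun ξ => K₀ + K₁ * ‖H ξ‖ ^ 2 + K₂ * R ξ - α * inner ℝ (z - u) (H ξ)) π :=
    i2.sub (hHvi.const_mul _)
  have hmain := lintegral_prod_ofReal_le (μ := μ) (ν := π) hφm
    (fun w => add_nonneg (mul_nonneg hA (sub_nonneg.2 (hfs _))) (bregman_nonneg hp hp2 hd _ _))
    hle (fun ξ => (hT ξ).1) (by simp only [hTbar]; exact i3)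
  refine hmain.trans (ENNReal.ofReal_le_ofReal ?_)
  simp only [hTbar]
  rw [integral_sub i2 (hHvi.const_mul _), integral_add i1 (hR1.const_mul _),
    integral_add (integrable_const _) (hH1.const_mul _), integral_const_mul, integral_const_mul,
    integral_const_mul, hHv, hR2, hH2]
  simp only [integral_const, probReal_univ, one_smul, mul_zero, sub_zero]
  have hS := hP.integral_norm_gradNoise_sq_le x
  have hS' : 1 / (m : ℝ) * ∫ ξ, ‖gradNoise F P x ξ‖ ^ 2 ∂P ≤ σ ^ 2 / m := by
    rw [one_div, inv_mul_eq_div]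
    gcongr
  have hK₀ : K₀ ≤ A * (objective F P x - fs) + bregman d z u - A / (4 * ℓ) * (‖g‖ ^ 2 / n) -
      α * inner ℝ g (z - u) + ‖z - u‖ ^ 2 / (2 * N) + α ^ 2 * n * ‖g‖ ^ 2 * (3 * rho n q) := by
    simp only [K₀]
    gcongr
  have hK₁ : K₁ ≤ A / (2 * ℓ) / n + 2 * α ^ 2 * n * (3 * rho n q) := by
    simp only [K₁]
    gcongr
  have hK₂ : K₂ ≤ A / (2 * ℓ) + α ^ 2 * n * N / 2 + 2 * α ^ 2 * n ^ 2 * (3 * rho n q) := by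
    simp only [K₂]
    gcongr
  have hK₁0 : 0 ≤ K₁ := by positivity
  refine add_le_add (add_le_add hK₀ ?_) ?_
  · calc K₁ * (1 / (m : ℝ) * ∫ ξ, ‖gradNoise F P x ξ‖ ^ 2 ∂P) ≤ K₁ * (σ ^ 2 / m) := by gcongr
      _ ≤ _ := by gcongr
  · gcongr

end ARDFDS
end

noncomputable section

namespace ARDFDS

/-! ### Iterating a random map -/

section Iterate

variable {S W : Type*}

/-- The state after `k` steps of the recursion `s ↦ f j s w` driven by `w : Fin k → W`. -/
def iter (f : ℕ → S → W → S) (s₀ : S) : (k : ℕ) → (Fin k → W) → S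
  | 0, _ => s₀
  | k + 1, w => f k (iter f s₀ k fun i => w i.castSucc) (w (Fin.last k))

variable [MeasurableSpace S] [MeasurableSpace W]

lemma measurable_iter {f : ℕ → S → W → S} (hf : ∀ k, Measurable fun a : S × W => f k a.1 a.2)
    (s₀ : S) (k : ℕ) : Measurable (iter f s₀ k) := by
  induction k with
  | zero => exact measurable_const
  | succ k ih =>
    exact (hf k).comp ((ih.comp (measurable_pi_lambda _ fun i => measurable_pi_apply _)).prodMk
      (measurable_pi_apply _))

/-- The last draw is independent of the state reached before it, so Fubini separates the last
coordinate of the product. -/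
lemma lintegral_iter_succ {ν : Measure W} [IsProbabilityMeasure ν] {f : ℕ → S → W → S}
    (hf : ∀ k, Measurable fun a : S × W => f k a.1 a.2) (s₀ : S) (k : ℕ) {Φ : S → ENNReal}
    (hΦ : Measurable Φ) :
    ∫⁻ w, Φ (iter f s₀ (k + 1) w) ∂(Measure.pi fun _ : Fin (k + 1) => ν) =
      ∫⁻ w, ∫⁻ v, Φ (f k (iter f s₀ k w) v) ∂ν ∂(Measure.pi fun _ : Fin k => ν) := by
  have hmp := measurePreserving_piFinSuccAbove (fun _ : Fin (k + 1) => ν) (Fin.last k)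
  let Ψ : W × (Fin k → W) → ENNReal := fun a => Φ (f k (iter f s₀ k a.2) a.1)
  have hΨ : Measurable Ψ :=
    hΦ.comp ((hf k).comp (((measurable_iter hf s₀ k).comp measurable_snd).prodMk measurable_fst))
  have h1 : ∀ w : Fin (k + 1) → W, Φ (iter f s₀ (k + 1) w) =
      Ψ (MeasurableEquiv.piFinSuccAbove (fun _ => W) (Fin.last k) w) := by
    intro w
    simp only [Ψ, iter]
    congr 3
    funext i
    simp only [MeasurableEquiv.piFinSuccAbove]
    simp
    rfl
  simp only [h1]
  rw [hmp.lintegral_comp hΨ, lintegral_prod_symm _ hΨ.aemeasurable]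

/-- Expected value of a potential that grows in a controlled way. -/
lemma lintegral_iter_le {ν : Measure W} [IsProbabilityMeasure ν] {f : ℕ → S → W → S}
    (hf : ∀ k, Measurable fun a : S × W => f k a.1 a.2) (s₀ : S) {Φ : ℕ → S → ENNReal}
    (hΦ : ∀ k, Measurable (Φ k)) {r b : ENNReal} (hr : 1 ≤ r) {N : ℕ}
    (hstep : ∀ k < N, ∀ s, ∫⁻ v, Φ (k + 1) (f k s v) ∂ν ≤ r * Φ k s + b) :
    ∀ k ≤ N, ∫⁻ w, Φ k (iter f s₀ k w) ∂(Measure.pi fun _ : Fin k => ν) ≤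
      r ^ k * (Φ 0 s₀ + k * b) := by
  intro k
  induction k with
  | zero => intro _; simp [iter]
  | succ k ih =>
    intro hk
    rw [lintegral_iter_succ hf s₀ k (hΦ (k + 1))]
    calc ∫⁻ w, ∫⁻ v, Φ (k + 1) (f k (iter f s₀ k w) v) ∂ν ∂(Measure.pi fun _ : Fin k => ν)
        ≤ ∫⁻ w, (r * Φ k (iter f s₀ k w) + b) ∂(Measure.pi fun _ : Fin k => ν) :=
          lintegral_mono fun w => hstep k (by omega) _
      _ = r * ∫⁻ w, Φ k (iter f s₀ k w) ∂(Measure.pi fun _ : Fin k => ν) + b := by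
          rw [lintegral_add_right _ measurable_const,
            lintegral_const_mul r (f := fun w => Φ k (iter f s₀ k w))
              ((hΦ k).comp (measurable_iter hf s₀ k))]
          simp
      _ ≤ r * (r ^ k * (Φ 0 s₀ + k * b)) + r ^ (k + 1) * b := by
          gcongr
          · exact ih (by omega)
          · exact le_mul_of_one_le_left zero_le (one_le_pow₀ hr)
      _ = r ^ (k + 1) * (Φ 0 s₀ + ((k + 1 : ℕ) : ENNReal) * b) := by
          push_cast
          ring

end Iterate

/-! ### ARDFDS as an iterated random map, and the recursion for its potential. -/

variable {n m : ℕ} {Ξ : Type*}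

lemma run_eq_iter (ft : E n → Ξ → ℝ) (d : E n → ℝ) (ℓ : ℝ) (α : ℕ → ℝ) (t : ℝ) (x₀ : E n)
    (e : ℕ → E n) (ξ : ℕ → Fin m → Ξ) (k : ℕ) :
    ((run ft d ℓ α t x₀ e ξ k).y, (run ft d ℓ α t x₀ e ξ k).z) =
      iter (step ft d ℓ α t) (x₀, x₀) k fun i : Fin k => (e i, ξ i) := by
  induction k with
  | zero => rfl
  | succ k ih =>
    simp only [iter, Fin.val_castSucc, Fin.val_last, ← ih]
    rfl

lemma run_calls (ft : E n → Ξ → ℝ) (d : E n → ℝ) (ℓ : ℝ) (α : ℕ → ℝ) (t : ℝ) (x₀ : E n)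
    (e : ℕ → E n) (ξ : ℕ → Fin m → Ξ) (k : ℕ) : (run ft d ℓ α t x₀ e ξ k).calls = k * m := by
  induction k with
  | zero => simp [run]
  | succ k ih =>
    simp only [run, gradEst, oracleCall, ih]
    simp
    ring

variable [MeasurableSpace Ξ] {P : Measure Ξ} [IsProbabilityMeasure P]
  {F : E n → Ξ → ℝ} {L : Ξ → ℝ} {σ : ℝ}

/-- The potential of the method after `k` iterations. -/
def potential (f : E n → ℝ) (d : E n → ℝ) (c fs : ℝ) (u : E n) (k : ℕ) (s : E n × E n) : ℝ :=
  (k : ℝ) * (k + 2) / (2 * c) * (f s.1 - fs) + bregman d s.2 u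

/-- The coupling weight gives `z - u = (x - u) - (k/2) (y - x)`. Pairing with the gradient and using
convexity at `x` towards `u` and towards `y` produces the weights `1` and `k / 2`, whose sum is `(k
+ 2) / 2`. -/
lemma coupling_inequality (hP : IsProblem F P L σ) {k : ℕ} {x y z u : E n} {α : ℝ} (hα : 0 ≤ α)
    (hx : x = (2 / ((k : ℝ) + 2)) • z + (1 - 2 / ((k : ℝ) + 2)) • y) :
    α * (k + 2) / 2 * (objective F P x - objective F P u) -
        α * inner ℝ (gradient (objective F P) x) (z - u) ≤
      α * k / 2 * (objective F P y - objective F P u) := by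
  have h1 := hP.le_objective x u
  have h2 := hP.le_objective x y
  set g := gradient (objective F P) x with hg
  have hk : (0 : ℝ) < k + 2 := by positivity
  have hz : z - u = (x - u) - ((k : ℝ) / 2) • (y - x) := by
    have : z = ((k + 2 : ℝ) / 2) • x - ((k : ℝ) / 2) • y := by
      rw [hx, smul_add, smul_smul, smul_smul]
      rw [show ((k : ℝ) + 2) / 2 * (2 / (k + 2)) = 1 by field_simp,
        show ((k : ℝ) + 2) / 2 * (1 - 2 / (k + 2)) = k / 2 by field_simp; ring, one_smul,
        add_sub_cancel_right]
    rw [this]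
    module
  have e1 : inner ℝ g (x - u) = -(inner ℝ g (u - x) : ℝ) := by rw [← inner_neg_right, neg_sub]
  rw [hz, inner_sub_right, real_inner_smul_right, e1]
  have h3 : 0 ≤ α * (objective F P u - objective F P x - inner ℝ g (u - x)) :=
    mul_nonneg hα (by linarith)
  have h4 : 0 ≤ α * (k / 2) * (objective F P y - objective F P x - inner ℝ g (y - x)) :=
    mul_nonneg (by positivity) (by linarith)
  nlinarith

/-- The recursive inequality for the potential. -/
lemma lintegral_potential_le {p q : ENNReal} {d : E n → ℝ} (hn : 8 ≤ n) (hp : 1 ≤ p)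
    (hp2 : p ≤ 2) (hpq : p⁻¹ + q⁻¹ = 1) (hd : IsProxFunction p d) (hP : IsProblem F P L σ)
    (hL : 0 < L2 L P) {η : E n → Ξ → ℝ} (hη : Measurable (Function.uncurry η)) {Δ t : ℝ}
    (hΔ : 0 < Δ) (hηΔ : ∀ x, ∀ᵐ ξ ∂P, |η x ξ| ≤ Δ) (ht : t = 2 * √(Δ / L2 L P)) (hm : 0 < m)
    {u : E n} (hu : ∀ x, objective F P u ≤ objective F P x) {N k : ℕ} (hN : 0 < N) {c : ℝ}
    (hc : c = 96 * (n : ℝ) ^ 2 * rho n q * L2 L P) (s : E n × E n) :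
    ∫⁻ w, ENNReal.ofReal (potential (objective F P) d c (objective F P u) u (k + 1)
        (step (fun x w => F x w + η x w) d (L2 L P) (stepSize n (rho n q) (L2 L P)) t k s w))
        ∂(sphereLaw n).prod (Measure.pi fun _ : Fin m => P) ≤
      ENNReal.ofReal ((1 + 1 / (N : ℝ)) * potential (objective F P) d c (objective F P u) u k s +
        ((k : ℝ) + 2) ^ 2 / (2 * c) * (σ ^ 2 / (m * n * L2 L P) + 3 * Δ +
          4 * N * n * Δ * L2 L P / c)) := by
  have hn' : (0 : ℝ) < n := by exact_mod_cast (by omega : 0 < n)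
  have hN' : (0 : ℝ) < N := by exact_mod_cast hN
  have hm' : (0 : ℝ) < m := by exact_mod_cast hm
  have hq := two_le_of_conj hp2 hpq
  have hρ := rho_pos hn hq
  have hc0 : 0 < c := by rw [hc]; positivity
  set ℓ := L2 L P with hℓ
  set ρ := rho n q with hρdef
  set f := objective F P with hf
  obtain ⟨y, z⟩ := s
  set x : E n := (2 / ((k : ℝ) + 2)) • z + (1 - 2 / ((k : ℝ) + 2)) • y with hx
  set α : ℝ := ((k : ℝ) + 2) / c with hα
  have hαpos : 0 < α := by positivity
  have hstep : stepSize n ρ ℓ (k + 1) = α := by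
    rw [stepSize, hα, hc]
    push_cast
    ring
  set A : ℝ := ((k : ℝ) + 2) ^ 2 / (2 * c) with hA
  have hA0 : 0 ≤ A := by positivity
  have hAα : A = α * (k + 2) / 2 := by rw [hA, hα]; field_simp
  have h1 := lintegral_potential_step_le hn hp hp2 hpq hd hP hL hη hΔ hηΔ ht hm hu (α := α) hA0 hN'
    x z u
  refine (lintegral_mono fun w => ENNReal.ofReal_le_ofReal ?_).trans
    (h1.trans (ENNReal.ofReal_le_ofReal ?_))
  · simp only [potential, step, gradEst_fst, hstep]
    -- The potential at `k + 1` carries the weight `(k + 1)(k + 3)`, which is below the `(k + 2)²`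
    -- of `A`.
    refine add_le_add_left (mul_le_mul_of_nonneg_right ?_ (sub_nonneg.2 (hu _))) _
    rw [hA]
    gcongr
    push_cast
    nlinarith
  · have h2 := coupling_inequality hP (u := u) hαpos.le hx
    rw [← hf, ← hAα] at h2
    have h3 : ‖z - u‖ ^ 2 / (2 * N) ≤ 1 / N * bregman d z u := by
      have := half_norm_sq_le_bregman hp hp2 hd z u
      rw [norm_sub_rev] at this
      calc ‖z - u‖ ^ 2 / (2 * N) = 1 / N * (1 / 2 * ‖z - u‖ ^ 2) := by field_simp
        _ ≤ _ := by gcongr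
    -- Here the 96 in the stepsize acts: `α² = 2A / c` turns the mirror cost into `A / (16 n ℓ)`, a
    -- quarter of the descent coefficient `A / (4 n ℓ)`. The slack also keeps the noise terms in
    -- `h8` and `h9` small.
    have h4 : α ^ 2 * n * (3 * ρ) = A / (16 * n * ℓ) := by
      rw [hα, hA, hc]
      field_simp
      ring
    have h5 : 0 ≤ (k : ℝ) * (k + 2) / (2 * c) * (f y - f u) :=
      mul_nonneg (by positivity) (sub_nonneg.2 (hu _))
    have h6 : α * k / 2 = (k : ℝ) * (k + 2) / (2 * c) := by rw [hα]; field_simp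
    rw [h6] at h2
    have h7 : α ^ 2 * n * ‖gradient f x‖ ^ 2 * (3 * ρ) ≤ A / (4 * ℓ) * (‖gradient f x‖ ^ 2 / n) := by
      rw [show α ^ 2 * n * ‖gradient f x‖ ^ 2 * (3 * ρ) =
        α ^ 2 * n * (3 * ρ) * ‖gradient f x‖ ^ 2 by ring, h4,
        show A / (4 * ℓ) * (‖gradient f x‖ ^ 2 / n) = A / (4 * n * ℓ) * ‖gradient f x‖ ^ 2 by
          field_simp]
      gcongr
      norm_num
    have h8 : (A / (2 * ℓ) / n + 2 * α ^ 2 * n * (3 * ρ)) * (σ ^ 2 / m) ≤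
        A * (σ ^ 2 / (m * n * ℓ)) := by
      rw [show 2 * α ^ 2 * n * (3 * ρ) = 2 * (α ^ 2 * n * (3 * ρ)) by ring, h4,
        show (A / (2 * ℓ) / n + 2 * (A / (16 * n * ℓ))) * (σ ^ 2 / m) =
          5 / 8 * (A * (σ ^ 2 / (m * n * ℓ))) by field_simp; ring]
      have : 0 ≤ A * (σ ^ 2 / (m * n * ℓ)) := by positivity
      linarith
    have h9 : (A / (2 * ℓ) + α ^ 2 * n * N / 2 + 2 * α ^ 2 * n ^ 2 * (3 * ρ)) * (4 * Δ * ℓ) ≤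
        A * (3 * Δ + 4 * N * n * Δ * ℓ / c) := by
      rw [show 2 * α ^ 2 * n ^ 2 * (3 * ρ) = 2 * n * (α ^ 2 * n * (3 * ρ)) by ring, h4,
        show α ^ 2 = 2 * A / c by rw [hα, hA]; field_simp,
        show (A / (2 * ℓ) + 2 * A / c * n * N / 2 + 2 * n * (A / (16 * n * ℓ))) * (4 * Δ * ℓ) =
          A * (5 / 2 * Δ + 4 * N * n * Δ * ℓ / c) by field_simp; ring]
      gcongr
      norm_num
    have h10 : 0 ≤ 1 / (N : ℝ) * ((k : ℝ) * (k + 2) / (2 * c) * (f y - f u)) := by positivity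
    simp only [potential]
    nlinarith

end ARDFDS
end

noncomputable section

namespace ARDFDS

/-! ### Convergence -/

variable {n m : ℕ} {Ξ : Type*} [MeasurableSpace Ξ] {P : Measure Ξ} [IsProbabilityMeasure P]
  {F : E n → Ξ → ℝ} {L : Ξ → ℝ} {σ : ℝ}

lemma one_add_one_div_pow_le {N : ℕ} (hN : 0 < N) : (1 + 1 / (N : ℝ)) ^ N ≤ 3 := by
  have hN' : (0 : ℝ) < N := by exact_mod_cast hN
  have h1 : 1 + 1 / (N : ℝ) ≤ Real.exp (1 / N) := by
    rw [add_comm]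
    exact Real.add_one_le_exp _
  calc (1 + 1 / (N : ℝ)) ^ N ≤ Real.exp (1 / N) ^ N := by gcongr
    _ = Real.exp 1 := by rw [← Real.exp_nat_mul]; congr 1; field_simp
    _ ≤ 3 := by linarith [Real.exp_one_lt_d9]

lemma measurable_potential {p : ENNReal} {d : E n → ℝ} (hd : IsProxFunction p d) {f : E n → ℝ}
    (hf : Measurable f) (c fs : ℝ) (u : E n) (k : ℕ) : Measurable (potential f d c fs u k) := by
  unfold potential
  exact (((hf.comp measurable_fst).sub_const fs).const_mul _).add
    ((measurable_bregman hd u).comp measurable_snd)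

/-- Convergence of the method after `N` iterations, for arbitrary parameters. -/
lemma lintegral_objective_iter_le {p q : ENNReal} {d : E n → ℝ} (hn : 8 ≤ n) (hp : 1 ≤ p)
    (hp2 : p ≤ 2) (hpq : p⁻¹ + q⁻¹ = 1) (hd : IsProxFunction p d) (hP : IsProblem F P L σ)
    (hL : 0 < L2 L P) {η : E n → Ξ → ℝ} (hη : Measurable (Function.uncurry η)) {Δ t : ℝ}
    (hΔ : 0 < Δ) (hηΔ : ∀ x, ∀ᵐ ξ ∂P, |η x ξ| ≤ Δ) (ht : t = 2 * √(Δ / L2 L P)) (hm : 0 < m)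
    {u : E n} (hu : ∀ x, objective F P u ≤ objective F P x) {N : ℕ} (hN : 0 < N) {c : ℝ}
    (hc : c = 96 * (n : ℝ) ^ 2 * rho n q * L2 L P) (x₀ : E n) :
    ∫⁻ w, ENNReal.ofReal (objective F P (iter (step (fun x w => F x w + η x w) d (L2 L P)
        (stepSize n (rho n q) (L2 L P)) t) (x₀, x₀) N w).1 - objective F P u)
        ∂(sampleLaw n N m P) ≤
      ENNReal.ofReal (8 * c * bregman d x₀ u / ((N : ℝ) + 1) ^ 2 +
        4 * N * (σ ^ 2 / (m * n * L2 L P) + 3 * Δ + 4 * N * n * Δ * L2 L P / c)) := by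
  have hn' : (0 : ℝ) < n := by exact_mod_cast (by omega : 0 < n)
  have hN' : (0 : ℝ) < N := by exact_mod_cast hN
  have hm' : (0 : ℝ) < m := by exact_mod_cast hm
  have hρ := rho_pos hn (two_le_of_conj hp2 hpq)
  have hc0 : 0 < c := by rw [hc]; positivity
  have := isProbabilityMeasure_sphereLaw (by omega : 0 < n)
  set ft : E n → Ξ → ℝ := fun x w => F x w + η x w with hft
  have hftm : Measurable (Function.uncurry ft) := hP.measurable.add hη
  have hfm : Measurable (objective F P) := hP.differentiable_objective.continuous.measurable
  set ℓ := L2 L P with hℓ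
  set f := objective F P with hf
  set D : ℝ := σ ^ 2 / (m * n * ℓ) + 3 * Δ + 4 * N * n * Δ * ℓ / c with hD
  have hD0 : 0 ≤ D := by positivity
  set Θ := bregman d x₀ u with hΘ
  have hΘ0 : 0 ≤ Θ := bregman_nonneg hp hp2 hd _ _
  set b : ℝ := ((N : ℝ) + 1) ^ 2 / (2 * c) * D with hb
  have hpot0 : ∀ k s, 0 ≤ potential f d c (f u) u k s := fun k s =>
    add_nonneg (mul_nonneg (by positivity) (sub_nonneg.2 (hu _))) (bregman_nonneg hp hp2 hd _ _)
  have hiter := lintegral_iter_le (ν := (sphereLaw n).prod (Measure.pi fun _ : Fin m => P))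
    (f := step ft d ℓ (stepSize n (rho n q) ℓ) t)
    (fun k => measurable_step hftm hp hp2 hd ℓ (stepSize n (rho n q) ℓ) t k) (x₀, x₀)
    (Φ := fun k s => ENNReal.ofReal (potential f d c (f u) u k s))
    (fun k => (measurable_potential hd hfm c (f u) u k).ennreal_ofReal)
    (r := ENNReal.ofReal (1 + 1 / N)) (b := ENNReal.ofReal b)
    (by
      rw [← ENNReal.ofReal_one]
      exact ENNReal.ofReal_le_ofReal (by linarith [(by positivity : 0 < 1 / (N : ℝ))]))
    (N := N) (fun k hk s => by
      refine (lintegral_potential_le hn hp hp2 hpq hd hP hL hη hΔ hηΔ ht hm hu hN hc s).trans ?_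
      rw [← ENNReal.ofReal_mul (by positivity), ← ENNReal.ofReal_add
        (mul_nonneg (by positivity) (hpot0 k s)) (by positivity)]
      refine ENNReal.ofReal_le_ofReal (add_le_add_right ?_ _)
      rw [hb]
      have hk' : (k : ℝ) + 1 ≤ N := by exact_mod_cast hk
      gcongr ?_ ^ 2 / _ * _
      linarith) N le_rfl
  have hpot_zero : potential f d c (f u) u 0 (x₀, x₀) = Θ := by simp [potential, hΘ]
  have hb0 : 0 ≤ b := by positivity
  have hbound : ENNReal.ofReal (1 + 1 / N) ^ N *
      (ENNReal.ofReal (potential f d c (f u) u 0 (x₀, x₀)) + N * ENNReal.ofReal b) ≤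
      ENNReal.ofReal (3 * (Θ + N * b)) := by
    rw [hpot_zero, ← ENNReal.ofReal_natCast, ← ENNReal.ofReal_mul hN'.le,
      ← ENNReal.ofReal_add hΘ0 (by positivity), ← ENNReal.ofReal_pow (by positivity),
      ← ENNReal.ofReal_mul (by positivity)]
    refine ENNReal.ofReal_le_ofReal ?_
    gcongr
    exact one_add_one_div_pow_le hN
  have hfin := hiter.trans hbound
  set a : ℝ := (N : ℝ) * (N + 2) / (2 * c) with ha
  have ha0 : 0 < a := by positivity
  have hlow : ENNReal.ofReal a * ∫⁻ w, ENNReal.ofReal (f (iter (step ft d ℓ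
      (stepSize n (rho n q) ℓ) t) (x₀, x₀) N w).1 - f u) ∂(sampleLaw n N m P) ≤
      ENNReal.ofReal (3 * (Θ + N * b)) := by
    rw [← lintegral_const_mul' _ _ ENNReal.ofReal_ne_top]
    refine le_trans (lintegral_mono fun w => ?_) hfin
    rw [← ENNReal.ofReal_mul ha0.le]
    refine ENNReal.ofReal_le_ofReal ?_
    simp only [potential, ← ha]
    linarith [bregman_nonneg hp hp2 hd (iter (step ft d ℓ (stepSize n (rho n q) ℓ) t)
      (x₀, x₀) N w).2 u]
  have hdiv : ∫⁻ w, ENNReal.ofReal (f (iter (step ft d ℓ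
      (stepSize n (rho n q) ℓ) t) (x₀, x₀) N w).1 - f u) ∂(sampleLaw n N m P) ≤
      ENNReal.ofReal (3 * (Θ + N * b)) / ENNReal.ofReal a := by
    rw [ENNReal.le_div_iff_mul_le (Or.inl (by simpa using ha0)) (Or.inl ENNReal.ofReal_ne_top),
      mul_comm]
    exact hlow
  refine hdiv.trans ?_
  rw [← ENNReal.ofReal_div_of_pos ha0]
  refine ENNReal.ofReal_le_ofReal ?_
  have hN1 : (1 : ℝ) ≤ N := by exact_mod_cast hN
  -- Equivalent to `(N + 1)² ≥ 4`, so `N ≥ 1` is needed. The 3/4 against the growth factor 3 and the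
  -- `2c` of the potential gives the 8.
  have ha2 : 3 / 4 * ((N : ℝ) + 1) ^ 2 / (2 * c) ≤ a := by
    rw [ha]
    exact div_le_div_of_nonneg_right (by nlinarith) (by positivity)
  calc 3 * (Θ + N * b) / a ≤ 3 * (Θ + N * b) / (3 / 4 * ((N : ℝ) + 1) ^ 2 / (2 * c)) := by gcongr
    _ = 8 * c * Θ / ((N : ℝ) + 1) ^ 2 + 4 * N * D := by
      rw [hb]
      field_simp
      ring

lemma rpow_three_halves {ε : ℝ} (hε : 0 < ε) : ε ^ (3 / 2 : ℝ) = ε * √ε := by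
  rw [show (3 / 2 : ℝ) = 1 + 1 / 2 by norm_num, Real.rpow_add hε, Real.rpow_one,
    ← Real.sqrt_eq_rpow]

/-- The choice of the parameters makes the convergence bound at most `ε`. -/
lemma convergence_bound_le {ν ρ ℓ Θ ε σ Δ : ℝ} (hν : 0 < ν) (hρ : 0 < ρ) (hℓ : 0 < ℓ) (hΘ : 0 ≤ Θ)
    (hε : 0 < ε) (hΔ : 0 < Δ) {N m : ℕ} (hm : 0 < m)
    (hN : N = ⌊40 * √(ν ^ 2 * ρ * ℓ * Θ / ε)⌋₊)
    (hmB : 1000 * (σ ^ 2 / ε ^ (3 / 2 : ℝ) * √(ρ * Θ / ℓ)) ≤ m)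
    (hΔ1 : Δ * (ν * ℓ * Θ) ≤ 1 / 5000 * ε ^ 2)
    (hΔ2 : Δ * √(ν ^ 2 * ρ * ℓ * Θ) ≤ 1 / 5000 * ε ^ (3 / 2 : ℝ)) {c : ℝ}
    (hc : c = 96 * ν ^ 2 * ρ * ℓ) :
    8 * c * Θ / ((N : ℝ) + 1) ^ 2 +
        4 * N * (σ ^ 2 / (m * ν * ℓ) + 3 * Δ + 4 * N * ν * Δ * ℓ / c) ≤ ε := by
  have hm' : (0 : ℝ) < m := by exact_mod_cast hm
  set M : ℝ := ν ^ 2 * ρ * ℓ * Θ with hM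
  have hM0 : 0 ≤ M := by positivity
  have hs : 0 < √ε := Real.sqrt_pos.2 hε
  have hss : √ε * √ε = ε := Real.mul_self_sqrt hε.le
  have hN1 : (N : ℝ) ≤ 40 * (√M / √ε) := by
    rw [hN, ← Real.sqrt_div hM0]
    exact Nat.floor_le (by positivity)
  have hN2 : 40 * (√M / √ε) < (N : ℝ) + 1 := by
    rw [hN, ← Real.sqrt_div hM0]
    exact Nat.lt_floor_add_one _
  rw [rpow_three_halves hε] at hmB hΔ2
  have hMM : √M * √M = M := Real.mul_self_sqrt hM0
  have hq0 : 0 ≤ √M / √ε := by positivity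
  have hqq : (√M / √ε) * (√M / √ε) * ε = M := by
    rw [div_mul_div_comm, hMM, hss]
    field_simp
  -- After the outer factor 4, the contributions are at most `0.48 ε` for the initial distance,
  -- `0.096 ε` and about `0.054 ε` for the oracle noise, and `0.16 ε` for the variance; their sum is
  -- below `ε`.
  have t1 : 8 * c * Θ / ((N : ℝ) + 1) ^ 2 ≤ 48 / 100 * ε := by
    rw [div_le_iff₀ (by positivity)]
    have h1 : (40 * (√M / √ε)) ^ 2 ≤ ((N : ℝ) + 1) ^ 2 := by gcongr
    have h2 : 8 * c * Θ = 768 * M := by rw [hc, hM]; ring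
    rw [h2]
    have h3 : ε * (40 * (√M / √ε)) ^ 2 = 1600 * M := by linear_combination 1600 * hqq
    nlinarith [mul_le_mul_of_nonneg_left h1 hε.le]
  have t2 : N * Δ ≤ 40 / 5000 * ε := by
    calc N * Δ ≤ 40 * (√M / √ε) * Δ := by gcongr
      _ = 40 * (Δ * √M) / √ε := by ring
      _ ≤ 40 * (1 / 5000 * (ε * √ε)) / √ε := by gcongr
      _ = 40 / 5000 * ε := by field_simp
  have t3 : N * (σ ^ 2 / (m * ν * ℓ)) ≤ 40 / 1000 * ε := by
    have h1 : √M = ν * ℓ * √(ρ * Θ / ℓ) := by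
      rw [hM, show ν ^ 2 * ρ * ℓ * Θ = (ν * ℓ) ^ 2 * (ρ * Θ / ℓ) by field_simp,
        Real.sqrt_mul (by positivity), Real.sqrt_sq (by positivity)]
    rw [mul_div_assoc', div_le_iff₀ (by positivity)]
    calc N * σ ^ 2 ≤ 40 * (√M / √ε) * σ ^ 2 := by gcongr
      _ = 40 / 1000 * ε * (1000 * (σ ^ 2 / (ε * √ε) * √(ρ * Θ / ℓ))) * (ν * ℓ) := by
          rw [h1]; field_simp
      _ ≤ 40 / 1000 * ε * m * (ν * ℓ) := by gcongr
      _ = _ := by ring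
  have t4 : N * (4 * N * ν * Δ * ℓ / c) ≤ 4 * 1600 / 96 / 5000 * ε := by
    have h1 : (N : ℝ) ^ 2 ≤ (40 * (√M / √ε)) ^ 2 := by gcongr
    have h3 : ε * (40 * (√M / √ε)) ^ 2 = 1600 * M := by linear_combination 1600 * hqq
    rw [mul_div_assoc', div_le_iff₀ (by rw [hc]; positivity)]
    have h4 : (N : ℝ) ^ 2 * ε ≤ 1600 * M := by nlinarith
    refine le_of_mul_le_mul_right ?_ hε
    calc N * (4 * N * ν * Δ * ℓ) * ε = 4 * ν * Δ * ℓ * (N ^ 2 * ε) := by ring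
      _ ≤ 4 * ν * Δ * ℓ * (1600 * M) := by gcongr
      _ = 4 * 1600 / 96 * (Δ * (ν * ℓ * Θ)) * c := by rw [hM, hc]; ring
      _ ≤ 4 * 1600 / 96 * (1 / 5000 * ε ^ 2) * c := by
          have : 0 ≤ c := by rw [hc]; positivity
          gcongr
      _ = _ := by ring
  nlinarith

lemma IsProblem.objective_sub_le (hP : IsProblem F P L σ) (hL : 0 < L2 L P) {u : E n}
    (hu : ∀ x, objective F P u ≤ objective F P x) (x : E n) :
    objective F P x - objective F P u ≤ L2 L P / 2 * ‖x - u‖ ^ 2 := by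
  have h := hP.objective_le hL u x
  have hg : gradient (objective F P) u = 0 :=
    gradient_sub_inner (hP.differentiable_objective u) fun v => by simpa using hu v
  rw [hg, inner_zero_left] at h
  linarith

end ARDFDS
end

noncomputable section

namespace ARDFDS

/-! ### Convergence for the random variables of the method. -/

variable {n m : ℕ} {Ξ : Type*} [MeasurableSpace Ξ] {P : Measure Ξ} [IsProbabilityMeasure P]
  {F : E n → Ξ → ℝ} {L : Ξ → ℝ} {σ : ℝ}

/-- Since `f(y_N) - f*` is nonnegative, the bound on its `lintegral` under the sample law yields
both integrability and the estimate of the expectation. -/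
lemma convergence_of_pos {p q : ENNReal} {d : E n → ℝ} (hn : 8 ≤ n) (hp : 1 ≤ p)
    (hp2 : p ≤ 2) (hpq : p⁻¹ + q⁻¹ = 1) (hd : IsProxFunction p d) (hP : IsProblem F P L σ)
    (hL : 0 < L2 L P) {η : E n → Ξ → ℝ} (hη : Measurable (Function.uncurry η)) {Δ t : ℝ}
    (hΔ : 0 < Δ) (hηΔ : ∀ x, ∀ᵐ ξ ∂P, |η x ξ| ≤ Δ) (ht : t = 2 * √(Δ / L2 L P)) (hm : 0 < m)
    {u : E n} (hu : ∀ x, objective F P u ≤ objective F P x) {N : ℕ} (hN : 0 < N) {c ε : ℝ}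
    (hc : c = 96 * (n : ℝ) ^ 2 * rho n q * L2 L P) (x₀ : E n) (hε : 0 < ε)
    (hbound : 8 * c * bregman d x₀ u / ((N : ℝ) + 1) ^ 2 +
        4 * N * (σ ^ 2 / (m * n * L2 L P) + 3 * Δ + 4 * N * n * Δ * L2 L P / c) ≤ ε)
    {Ω : Type*} [MeasurableSpace Ω] {Pr : Measure Ω} [IsProbabilityMeasure Pr]
    {e : ℕ → Ω → E n} {ξ : ℕ → Fin m → Ω → Ξ}
    (hlaw : HasLaw (fun ω (k : Fin N) => (e k ω, fun i => ξ k i ω)) (sampleLaw n N m P) Pr) :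
    Integrable (fun ω => objective F P (run (fun x w => F x w + η x w) d (L2 L P)
        (stepSize n (rho n q) (L2 L P)) t x₀ (fun k => e k ω) (fun k i => ξ k i ω) N).y) Pr ∧
      (∫ ω, objective F P (run (fun x w => F x w + η x w) d (L2 L P)
        (stepSize n (rho n q) (L2 L P)) t x₀ (fun k => e k ω) (fun k i => ξ k i ω) N).y ∂Pr) -
          objective F P u ≤ ε := by
  have hftm : Measurable (Function.uncurry fun x w => F x w + η x w) := hP.measurable.add hη
  have hfm : Measurable (objective F P) := hP.differentiable_objective.continuous.measurable
  set f := objective F P with hf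
  set stp := step (m := m) (fun x w => F x w + η x w) d (L2 L P) (stepSize n (rho n q) (L2 L P)) t
    with hstp
  have hy : ∀ ω, (run (fun x w => F x w + η x w) d (L2 L P)
      (stepSize n (rho n q) (L2 L P)) t x₀ (fun k => e k ω) (fun k i => ξ k i ω) N).y =
      (iter stp (x₀, x₀) N fun k : Fin N => (e k ω, fun i => ξ k i ω)).1 := by
    intro ω
    rw [hstp, ← run_eq_iter _ d _ _ t x₀ (fun k => e k ω) (fun k i => ξ k i ω) N]
  simp only [hy]
  have hgm : Measurable fun w : Fin N → E n × (Fin m → Ξ) => f (iter stp (x₀, x₀) N w).1 - f u :=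
    (hfm.comp (measurable_fst.comp (measurable_iter
      (fun k => measurable_step hftm hp hp2 hd _ _ t k) _ N))).sub_const _
  have hle := lintegral_objective_iter_le hn hp hp2 hpq hd hP hL hη hΔ hηΔ ht hm hu hN hc x₀
  rw [← hlaw.lintegral_comp hgm.ennreal_ofReal.aemeasurable] at hle
  have hle2 := hle.trans (ENNReal.ofReal_le_ofReal hbound)
  set Z : Ω → ℝ := fun ω => f (iter stp (x₀, x₀) N fun k : Fin N => (e k ω, fun i => ξ k i ω)).1 -
    f u with hZ
  have hZm : AEStronglyMeasurable Z Pr := (hgm.comp_aemeasurable hlaw.aemeasurable).aestronglyMeasurable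
  have hZ0 : ∀ ω, 0 ≤ Z ω := fun ω => sub_nonneg.2 (hu _)
  have hZi : Integrable Z Pr := by
    refine ⟨hZm, ?_⟩
    rw [hasFiniteIntegral_iff_ofReal (Filter.Eventually.of_forall hZ0)]
    exact hle2.trans_lt ENNReal.ofReal_lt_top
  have hZe : ∫ ω, Z ω ∂Pr ≤ ε := by
    rw [← ENNReal.ofReal_le_ofReal_iff hε.le,
      ofReal_integral_eq_lintegral_ofReal hZi (Filter.Eventually.of_forall hZ0)]
    exact hle2
  have hfi : Integrable (fun ω => f (iter stp (x₀, x₀) N fun k : Fin N =>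
      (e k ω, fun i => ξ k i ω)).1) Pr := by
    have := hZi.add (integrable_const (f u))
    refine this.congr (Filter.Eventually.of_forall fun ω => ?_)
    simp [hZ]
  refine ⟨hfi, ?_⟩
  have h1 : ∫ ω, Z ω ∂Pr = (∫ ω, f (iter stp (x₀, x₀) N fun k : Fin N =>
      (e k ω, fun i => ξ k i ω)).1 ∂Pr) - f u := by
    rw [hZ, integral_sub hfi (integrable_const _)]
    simp
  linarith

/-! ### Size of the parameters -/

lemma natFloor_mul_natCeil_le {X Y : ℝ} (hX : 0 ≤ X) {N m : ℕ}
    (hN : N = ⌊40 * X⌋₊) (hm : m = ⌈1000 * max 1 Y⌉₊) :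
    (N : ℝ) ≤ 40 * X ∧ 1 ≤ m ∧ (m : ℝ) ≤ 1001 * max 1 Y ∧
      ((N * m : ℕ) : ℝ) ≤ 40040 * max X (X * Y) := by
  have h1 : (N : ℝ) ≤ 40 * X := by
    rw [hN]; exact Nat.floor_le (by positivity)
  have hmax : 1 ≤ max 1 Y := le_max_left _ _
  have h2 : (m : ℝ) ≤ 1001 * max 1 Y := by
    have := Nat.ceil_lt_add_one (by positivity : 0 ≤ 1000 * max 1 Y)
    rw [← hm] at this
    linarith
  refine ⟨h1, ?_, h2, ?_⟩
  · rw [hm]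
    exact Nat.ceil_pos.2 (by positivity)
  · push_cast
    calc (N : ℝ) * m ≤ 40 * X * (1001 * max 1 Y) := by gcongr
      _ = 40040 * (X * max 1 Y) := by ring
      _ = 40040 * max X (X * Y) := by rw [mul_max_of_nonneg _ _ hX, mul_one]

/-- The first root equals `ν ℓ √(ρ Θ / ℓ) / √ε`, so the two roots multiply to a rational expression:
the variance term of the oracle complexity. -/
lemma sqrt_mul_batch_eq {ν ρ ℓ Θ ε σ : ℝ} (hν : 0 < ν) (hρ : 0 < ρ) (hℓ : 0 < ℓ) (hΘ : 0 ≤ Θ)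
    (hε : 0 < ε) :
    √(ν ^ 2 * ρ * ℓ * Θ / ε) * (σ ^ 2 / ε ^ (3 / 2 : ℝ) * √(ρ * Θ / ℓ)) =
      ν * ρ * σ ^ 2 * Θ / ε ^ 2 := by
  have hs : 0 < √ε := Real.sqrt_pos.2 hε
  have hss : √ε * √ε = ε := Real.mul_self_sqrt hε.le
  have h1 : √(ν ^ 2 * ρ * ℓ * Θ / ε) = ν * ℓ * √(ρ * Θ / ℓ) / √ε := by
    rw [Real.sqrt_div (by positivity), show ν ^ 2 * ρ * ℓ * Θ = (ν * ℓ) ^ 2 * (ρ * Θ / ℓ) by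
      field_simp, Real.sqrt_mul (by positivity), Real.sqrt_sq (by positivity)]
  have h2 : √(ρ * Θ / ℓ) * √(ρ * Θ / ℓ) = ρ * Θ / ℓ := Real.mul_self_sqrt (by positivity)
  rw [h1, rpow_three_halves hε]
  calc ν * ℓ * √(ρ * Θ / ℓ) / √ε * (σ ^ 2 / (ε * √ε) * √(ρ * Θ / ℓ))
      = ν * ℓ * (√(ρ * Θ / ℓ) * √(ρ * Θ / ℓ)) * σ ^ 2 / (ε * (√ε * √ε)) := by field_simp
    _ = _ := by rw [h2, hss]; field_simp

lemma smoothing_le {ν ρ ℓ Θ ε Δ t : ℝ} (hν : 0 < ν) (hρ : 0 < ρ) (hℓ : 0 < ℓ) (hΘ : 0 ≤ Θ)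
    (hε : 0 < ε) (hΔ : 0 < Δ) (hΔ1 : Δ * (ν * ℓ * Θ) ≤ 1 / 5000 * ε ^ 2)
    (hΔ2 : Δ * √(ν ^ 2 * ρ * ℓ * Θ) ≤ 1 / 5000 * ε ^ (3 / 2 : ℝ)) (ht : t = 2 * √(Δ / ℓ)) :
    t * (ℓ * √(ν * Θ)) ≤ 2 * ε ∧
      t * (ν ^ 2 * ρ * ℓ ^ 3 * Θ) ^ (1 / 4 : ℝ) ≤ 2 * ε ^ (3 / 4 : ℝ) := by
  have ht0 : 0 < t := by rw [ht]; positivity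
  have ht2 : t ^ 2 = 4 * Δ / ℓ := by
    rw [ht, mul_pow, Real.sq_sqrt (by positivity)]
    ring
  constructor
  · refine le_of_sq_le_sq ?_ (by positivity)
    rw [mul_pow, mul_pow, ht2, Real.sq_sqrt (by positivity)]
    calc 4 * Δ / ℓ * (ℓ ^ 2 * (ν * Θ)) = 4 * (Δ * (ν * ℓ * Θ)) := by field_simp
      _ ≤ 4 * (1 / 5000 * ε ^ 2) := by gcongr
      _ ≤ (2 * ε) ^ 2 := by nlinarith [sq_nonneg ε]
  · refine le_of_pow_le_pow_left₀ (n := 4) (by norm_num) (by positivity) ?_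
    have h4 : ∀ s : ℝ, 0 ≤ s → (s ^ (1 / 4 : ℝ)) ^ 4 = s := by
      intro s hs
      rw [← Real.rpow_natCast, ← Real.rpow_mul hs]
      norm_num
    have h5 : (ε ^ (3 / 4 : ℝ)) ^ 4 = ε ^ 3 := by
      rw [← Real.rpow_natCast, ← Real.rpow_mul hε.le, ← Real.rpow_natCast]
      norm_num
    have h6 : (ε ^ (3 / 2 : ℝ)) ^ 2 = ε ^ 3 := by
      rw [← Real.rpow_natCast, ← Real.rpow_mul hε.le, ← Real.rpow_natCast]
      norm_num
    rw [mul_pow, mul_pow, h4 _ (by positivity), h5]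
    have h7 : (Δ * √(ν ^ 2 * ρ * ℓ * Θ)) ^ 2 ≤ (1 / 5000 * ε ^ (3 / 2 : ℝ)) ^ 2 := by gcongr
    rw [mul_pow, mul_pow, h6, Real.sq_sqrt (by positivity)] at h7
    have h8 : t ^ 4 * (ν ^ 2 * ρ * ℓ ^ 3 * Θ) = 16 * (Δ ^ 2 * (ν ^ 2 * ρ * ℓ * Θ)) := by
      rw [show t ^ 4 = (t ^ 2) ^ 2 by ring, ht2]
      field_simp
      ring
    rw [h8]
    have : 0 < ε ^ 3 := by positivity
    nlinarith

/-! ### The two standard proximal setups -/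

lemma bregman_proxTwo (x z : E n) : bregman (proxTwo n) z x = 1 / 2 * ‖x - z‖ ^ 2 := by
  rw [bregman, (hasGradientAt_proxTwo z).gradient, proxTwo, proxTwo, norm_sub_sq_real, inner_sub_right,
    real_inner_self_eq_norm_sq, real_inner_comm]
  ring

/-- The prox-function is centred at its minimizer `x₀`, so the divergence from `x₀` is its value.
The exponent of `n` is at most `κ - 1`, so that power is at most `e`, and `e² ≤ 8`. -/
lemma bregman_proxOne_le (hn : 8 ≤ n) (x₀ x : E n) :
    bregman (proxOne n x₀) x₀ x ≤ 4 * Real.log n * pNorm 1 (x₀ - x) ^ 2 := by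
  obtain ⟨hk1, hk2⟩ := kappa_bounds hn
  have hlog := two_lt_log hn
  have hn1 : (1 : ℝ) ≤ n := by exact_mod_cast (by omega : 1 ≤ n)
  have hE1 : 1 ≤ ENNReal.ofReal (kappa n) := by simpa using ENNReal.ofReal_le_ofReal hk1.le
  have hd := isProxFunction_proxOne hn x₀
  have hzero : proxOne n x₀ x₀ = 0 := by
    rw [proxOne, sub_self, show (0 : E n) = (0 : ℝ) • (0 : E n) by simp, pNorm_smul hE1]
    simp
  have hnn : ∀ y, 0 ≤ proxOne n x₀ y := fun y => by
    rw [proxOne]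
    positivity
  have hg : gradient (proxOne n x₀) x₀ = 0 :=
    gradient_sub_inner (hd.differentiable x₀) fun y => by simpa [hzero] using hnn y
  have hrev : pNorm 1 (x₀ - x) = pNorm 1 (x - x₀) := by
    rw [← neg_sub x x₀, ← neg_one_smul ℝ, pNorm_smul le_rfl]; simp
  rw [bregman, hg, inner_zero_left, hzero, sub_zero, sub_zero, hrev, proxOne]
  have h1 : (n : ℝ) ^ ((kappa n - 1) * (2 - kappa n) / kappa n) ≤ Real.exp 1 := by
    rw [← rpow_kappa_sub_one hn]
    refine Real.rpow_le_rpow_of_exponent_le hn1 ?_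
    rw [div_le_iff₀ (by linarith)]
    gcongr
    linarith
  have h2 := pNorm_anti le_rfl hE1 (x - x₀)
  have h3 := pNorm_nonneg hE1 (x - x₀)
  have he := Real.exp_one_lt_d9
  have h4 : Real.exp 1 * (n : ℝ) ^ ((kappa n - 1) * (2 - kappa n) / kappa n) ≤ 8 := by
    calc _ ≤ Real.exp 1 * Real.exp 1 := by gcongr
      _ ≤ 8 := by nlinarith [Real.exp_pos 1]
  calc Real.exp 1 * (n : ℝ) ^ ((kappa n - 1) * (2 - kappa n) / kappa n) * Real.log n / 2 *
        pNorm (ENNReal.ofReal (kappa n)) (x - x₀) ^ 2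
      ≤ 8 * Real.log n / 2 * pNorm 1 (x - x₀) ^ 2 := by gcongr
    _ = _ := by ring

/-- For `p = 1` one logarithm comes from `ρ_n` and one from the prox-function, with `16 · 4 = 64`.
For `p = 2` there is none, and `ln n ≥ 1` covers it. -/
lemma mul_rho_mul_bregman_le (hn : 8 ≤ n) {p q : ENNReal} (hpq : p⁻¹ + q⁻¹ = 1) {d : E n → ℝ}
    {x₀ xs : E n} (h : (p = 1 ∧ d = proxOne n x₀) ∨ (p = 2 ∧ d = proxTwo n)) :
    n * rho n q * bregman d x₀ xs ≤
      64 * Real.log n ^ 2 * ((n : ℝ) ^ (2 * (q⁻¹).toReal) * pNorm p (x₀ - xs) ^ 2) := by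
  have hlog := two_lt_log hn
  have hn' : (0 : ℝ) < n := by exact_mod_cast (by omega : 0 < n)
  rcases h with ⟨rfl, rfl⟩ | ⟨rfl, rfl⟩
  · have hq : q = ⊤ := by
      have h0 : q⁻¹ = 0 := by
        have h1 : (1 : ENNReal) + q⁻¹ = 1 + 0 := by simpa using hpq
        exact (ENNReal.add_right_inj ENNReal.one_ne_top).1 h1
      exact ENNReal.inv_eq_zero.1 h0
    subst hq
    have hρ : n * rho n ⊤ = 16 * Real.log n - 8 := by
      rw [rho, ENNReal.top_sub ENNReal.one_ne_top, min_eq_right le_top, ENNReal.toReal_ofReal (by linarith)]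
      simp only [ENNReal.inv_top, ENNReal.toReal_zero, mul_zero, zero_sub, Real.rpow_neg_one]
      field_simp
    have hb := bregman_proxOne_le hn x₀ xs
    rw [hρ]
    simp only [ENNReal.inv_top, ENNReal.toReal_zero, mul_zero, Real.rpow_zero, one_mul]
    calc (16 * Real.log n - 8) * bregman (proxOne n x₀) x₀ xs
        ≤ (16 * Real.log n) * (4 * Real.log n * pNorm 1 (x₀ - xs) ^ 2) := by
          refine mul_le_mul (by linarith) hb
            (bregman_nonneg le_rfl (by norm_num) (isProxFunction_proxOne hn x₀) _ _) (by linarith)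
      _ = _ := by ring
  · have hqi : q⁻¹ = 2⁻¹ := by
      rw [← ENNReal.inv_two_add_inv_two] at hpq
      exact (ENNReal.add_right_inj (by simp)).1 hpq
    have hq : q = 2 := inv_injective hqi
    subst hq
    have hρ : rho n 2 = 1 := by
      have h21 : (2 : ENNReal) - 1 = 1 := by
        rw [show (2 : ENNReal) = 1 + 1 by norm_num]
        exact ENNReal.add_sub_cancel_right ENNReal.one_ne_top
      rw [rho, h21, min_eq_left]
      · simp
      · rw [← ENNReal.ofReal_one]
        exact ENNReal.ofReal_le_ofReal (by linarith)
    have he : (n : ℝ) ^ (2 * ((2 : ENNReal)⁻¹).toReal) = n := by simp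
    rw [hρ, bregman_proxTwo, he, pNorm_two, norm_sub_rev]
    have h1 : 1 ≤ Real.log n ^ 2 := by nlinarith
    have h2 : 0 ≤ (n : ℝ) * ‖x₀ - xs‖ ^ 2 := by positivity
    nlinarith

lemma max_le_log_mul_max {ν ρ ℓ Θ ε σ R θ lg : ℝ} (hν : 0 < ν) (hℓ : 0 < ℓ)
    (hε : 0 < ε) (hlg : 1 ≤ lg)
    (h : ν * ρ * Θ ≤ 64 * lg ^ 2 * (ν ^ (2 * θ) * R ^ 2)) :
    max √(ν ^ 2 * ρ * ℓ * Θ / ε) (ν * ρ * σ ^ 2 * Θ / ε ^ 2) ≤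
      64 * lg ^ 2 * max (ν ^ (1 / 2 + θ) * √(ℓ * R ^ 2 / ε)) (ν ^ (2 * θ) * σ ^ 2 * R ^ 2 / ε ^ 2) := by
  have hνθ : 0 < ν ^ (2 * θ) := Real.rpow_pos_of_pos hν _
  rw [mul_max_of_nonneg _ _ (by positivity)]
  refine max_le_max ?_ ?_
  · refine Real.sqrt_le_iff.2 ⟨by positivity, ?_⟩
    have h1 : (ν ^ (1 / 2 + θ)) ^ 2 = ν * ν ^ (2 * θ) := by
      rw [← Real.rpow_natCast, ← Real.rpow_mul hν.le]
      conv_rhs => rw [← Real.rpow_one ν, ← Real.rpow_mul hν.le, ← Real.rpow_add hν]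
      congr 1
      push_cast
      ring
    rw [mul_pow, mul_pow _ √_, h1, Real.sq_sqrt (by positivity)]
    calc ν ^ 2 * ρ * ℓ * Θ / ε = ν * ℓ / ε * (ν * ρ * Θ) := by ring
      _ ≤ ν * ℓ / ε * (64 * lg ^ 2 * (ν ^ (2 * θ) * R ^ 2)) := by gcongr
      _ = 64 * lg ^ 2 * (ν * ν ^ (2 * θ) * (ℓ * R ^ 2 / ε)) := by ring
      -- Under the square root only `√(64 lg²)` is needed; this cruder bound gives both entries of
      -- the maximum the same factor.
      _ ≤ (64 * lg ^ 2) ^ 2 * (ν * ν ^ (2 * θ) * (ℓ * R ^ 2 / ε)) := by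
          gcongr
          nlinarith [one_le_pow₀ hlg (n := 2)]
  · calc ν * ρ * σ ^ 2 * Θ / ε ^ 2 = σ ^ 2 / ε ^ 2 * (ν * ρ * Θ) := by ring
      _ ≤ σ ^ 2 / ε ^ 2 * (64 * lg ^ 2 * (ν ^ (2 * θ) * R ^ 2)) := by gcongr
      _ = _ := by ring

end ARDFDS
end

theorem corollary1 :
    (∃ A B c K : ℝ, 0 < A ∧ 0 < B ∧ 0 < c ∧ 0 < K ∧
      ∀ (n : ℕ) (_ : 8 ≤ n)
        -- proximal setup
        (p q : ENNReal) (_ : 1 ≤ p) (_ : p ≤ 2) (_ : p⁻¹ + q⁻¹ = 1)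
        (d : E n → ℝ) (_ : IsProxFunction p d)
        -- problem
        (Ξ : Type*) [MeasurableSpace Ξ] (P : Measure Ξ) [IsProbabilityMeasure P]
        (F : E n → Ξ → ℝ) (L : Ξ → ℝ) (σ : ℝ) (_ : IsProblem F P L σ) (_ : 0 < L2 L P)
        (xs : E n) (_ : ∀ x, objective F P xs ≤ objective F P x)
        -- target accuracy, starting point
        (ε : ℝ) (_ : 0 < ε) (x₀ : E n)
        (ρ ℓ Θ : ℝ) (_ : ρ = rho n q) (_ : ℓ = L2 L P) (_ : Θ = bregman d x₀ xs)
        -- number of iterations and batch size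
        (N m : ℕ) (_ : N = ⌊A * √((n : ℝ) ^ 2 * ρ * ℓ * Θ / ε)⌋₊)
        (_ : m = ⌈B * max 1 (σ ^ 2 / ε ^ (3 / 2 : ℝ) * √(ρ * Θ / ℓ))⌉₊)
        -- noise level `Δ ≤ c * min {ε² / (n L₂ Θ), ε^(3/2) / √(n² ρ L₂ Θ)}`, with the
        -- denominators cleared so that the case `Θ = 0` is covered, and smoothing parameter
        (Δ t : ℝ) (_ : 0 < Δ) (_ : Δ * (n * ℓ * Θ) ≤ c * ε ^ 2)
        (_ : Δ * √((n : ℝ) ^ 2 * ρ * ℓ * Θ) ≤ c * ε ^ (3 / 2 : ℝ))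
        (_ : t = 2 * √(Δ / ℓ))
        -- noise
        (η : E n → Ξ → ℝ) (_ : Measurable (Function.uncurry η))
        (_ : ∀ x, ∀ᵐ ξ ∂P, |η x ξ| ≤ Δ)
        -- random directions and batches
        (Ω : Type*) [MeasurableSpace Ω] (Pr : Measure Ω) [IsProbabilityMeasure Pr]
        (e : ℕ → Ω → E n) (ξ : ℕ → Fin m → Ω → Ξ)
        (_ : HasLaw (fun ω (k : Fin N) => (e k ω, fun i => ξ k i ω)) (sampleLaw n N m P) Pr)
        (S : Ω → State n)
        (_ : ∀ ω, S ω = run (fun x w => F x w + η x w) d ℓ (stepSize n ρ ℓ) t x₀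
          (fun k => e k ω) (fun k i => ξ k i ω) N),
        -- convergence
        (Integrable (fun ω => objective F P (S ω).y) Pr ∧
          (∫ ω, objective F P (S ω).y ∂Pr) - objective F P xs ≤ ε) ∧
        -- orders of the parameters
        (N : ℝ) ≤ K * √((n : ℝ) ^ 2 * ρ * ℓ * Θ / ε) ∧
        1 ≤ m ∧ (m : ℝ) ≤ K * max 1 (σ ^ 2 / ε ^ (3 / 2 : ℝ) * √(ρ * Θ / ℓ)) ∧
        t * (ℓ * √(n * Θ)) ≤ K * ε ∧
        t * ((n : ℝ) ^ 2 * ρ * ℓ ^ 3 * Θ) ^ (1 / 4 : ℝ) ≤ K * ε ^ (3 / 4 : ℝ) ∧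
        -- number of oracle calls
        (∀ ω, (S ω).calls = N * m ∧
          ((S ω).calls : ℝ) ≤
            K * max √((n : ℝ) ^ 2 * ρ * ℓ * Θ / ε) (n * ρ * σ ^ 2 * Θ / ε ^ 2)) ∧
        -- the same in terms of the distance `R_p = ‖x₀ - x*‖_p`, up to powers of `ln n`
        ((p = 1 ∧ d = proxOne n x₀) ∨ (p = 2 ∧ d = proxTwo n) →
          ∀ ω, ((S ω).calls : ℝ) ≤ K * Real.log n ^ 2 *
            max ((n : ℝ) ^ (1 / 2 + (q⁻¹).toReal) * √(ℓ * pNorm p (x₀ - xs) ^ 2 / ε))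
              ((n : ℝ) ^ (2 * (q⁻¹).toReal) * σ ^ 2 * pNorm p (x₀ - xs) ^ 2 / ε ^ 2))) ∧
    -- the two standard choices are prox-functions
    (∀ (n : ℕ), 8 ≤ n →
      (∀ c : E n, IsProxFunction 1 (proxOne n c)) ∧ IsProxFunction 2 (proxTwo n)) := by
  -- The first three constants are those of `convergence_bound_le`; the last exceeds `40040 · 64`,
  -- the product of the constants of `natFloor_mul_natCeil_le` and `max_le_log_mul_max`.
  refine ⟨⟨40, 1000, 1 / 5000, 3000000, by norm_num, by norm_num, by norm_num, by norm_num, ?_⟩,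
    fun n hn => ⟨isProxFunction_proxOne hn, isProxFunction_proxTwo n⟩⟩
  intro n hn p q hp hp2 hpq d hd Ξ _ P _ F L σ hP hL xs hxs ε hε x₀ ρ ℓ Θ hρ hℓ hΘ N m hN hm Δ t hΔ
    hΔ1 hΔ2 ht η hη hηΔ Ω _ Pr _ e ξ hlaw S hS
  have hq := two_le_of_conj hp2 hpq
  have hn' : (0 : ℝ) < n := by exact_mod_cast (by omega : 0 < n)
  have hρ0 : 0 < ρ := hρ ▸ rho_pos hn hq
  have hℓ0 : 0 < ℓ := hℓ ▸ hL
  have hΘ0 : 0 ≤ Θ := hΘ ▸ bregman_nonneg hp hp2 hd _ _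
  obtain ⟨hN1, hm1, hm2, hNm⟩ := natFloor_mul_natCeil_le (Real.sqrt_nonneg _) hN hm
  obtain ⟨ht1, ht2⟩ := smoothing_le hn' hρ0 hℓ0 hΘ0 hε hΔ hΔ1 hΔ2 ht
  rw [sqrt_mul_batch_eq hn' hρ0 hℓ0 hΘ0 hε] at hNm
  have hcalls : ∀ ω, (S ω).calls = N * m := fun ω => by rw [hS ω, run_calls]
  have hmax0 : 0 ≤ max √((n : ℝ) ^ 2 * ρ * ℓ * Θ / ε) (n * ρ * σ ^ 2 * Θ / ε ^ 2) :=
    le_max_of_le_left (Real.sqrt_nonneg _)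
  have hY0 : 1 ≤ max 1 (σ ^ 2 / ε ^ (3 / 2 : ℝ) * √(ρ * Θ / ℓ)) := le_max_left _ _
  have hε34 : 0 < ε ^ (3 / 4 : ℝ) := Real.rpow_pos_of_pos hε _
  refine ⟨?_, hN1.trans (by gcongr; norm_num), hm1, hm2.trans (by gcongr; norm_num),
    by linarith, by linarith, fun ω => ⟨hcalls ω, ?_⟩, fun h ω => ?_⟩
  · simp only [hS]
    rcases Nat.eq_zero_or_pos N with h0 | hNpos
    -- No iteration is made, as happens for `Θ = 0`. A vanishing floor forces `n² ρ ℓ Θ ≤ ε`, hence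
    -- `ℓ Θ ≤ ε`, and smoothness at the minimizer gives `f(x₀) - f* ≤ ℓ / 2 · ‖x₀ - x*‖² ≤ ℓ Θ`.
    · subst h0
      simp only [run, integral_const, probReal_univ, one_smul]
      refine ⟨integrable_const _, ?_⟩
      have h1 := hP.objective_sub_le hL hxs x₀
      have h2 := half_norm_sq_le_bregman hp hp2 hd x₀ xs
      rw [norm_sub_rev, ← hΘ] at h2
      have h3 := Nat.floor_eq_zero.1 hN.symm
      have h4 : √((n : ℝ) ^ 2 * ρ * ℓ * Θ / ε) ≤ 1 := by
        have h0 := Real.sqrt_nonneg ((n : ℝ) ^ 2 * ρ * ℓ * Θ / ε)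
        linarith
      have h5 : (n : ℝ) ^ 2 * ρ * ℓ * Θ ≤ ε := by
        simpa [div_le_one hε] using (Real.sqrt_le_iff.1 h4).2
      have h6 : 1 ≤ (n : ℝ) ^ 2 * ρ := by
        have h7 := one_le_mul_rho hn hq
        have h8 : (1 : ℝ) ≤ n := by exact_mod_cast (by omega : 1 ≤ n)
        rw [← hρ] at h7
        nlinarith
      have h9 : ℓ * Θ ≤ (n : ℝ) ^ 2 * ρ * (ℓ * Θ) := le_mul_of_one_le_left (by positivity) h6
      rw [← hℓ] at h1
      nlinarith
    · subst hρ hℓ hΘ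
      refine convergence_of_pos hn hp hp2 hpq hd hP hL hη hΔ hηΔ ht hm1 hxs hNpos rfl x₀ hε ?_ hlaw
      refine convergence_bound_le hn' hρ0 hℓ0 hΘ0 hε hΔ hm1 hN ?_ hΔ1 hΔ2 rfl
      refine le_trans ?_ ((Nat.le_ceil _).trans_eq (congrArg Nat.cast hm.symm))
      gcongr
      exact le_max_right _ _
  · rw [hcalls]
    exact hNm.trans (by gcongr; norm_num)
  · rw [hcalls]
    have h1 : n * ρ * Θ ≤ 64 * Real.log n ^ 2 *
        ((n : ℝ) ^ (2 * (q⁻¹).toReal) * pNorm p (x₀ - xs) ^ 2) := by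
      rw [hρ, hΘ]
      exact mul_rho_mul_bregman_le hn hpq h
    have h2 := max_le_log_mul_max (σ := σ) hn' hℓ0 hε (by linarith [two_lt_log hn]) h1
    refine hNm.trans ((mul_le_mul_of_nonneg_left h2 (by norm_num)).trans ?_)
    have h3 : 0 ≤ max ((n : ℝ) ^ (1 / 2 + (q⁻¹).toReal) * √(ℓ * pNorm p (x₀ - xs) ^ 2 / ε))
        ((n : ℝ) ^ (2 * (q⁻¹).toReal) * σ ^ 2 * pNorm p (x₀ - xs) ^ 2 / ε ^ 2) :=
      le_max_of_le_left (by positivity)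
    have h4 := mul_nonneg (sq_nonneg (Real.log n)) h3
    nlinarith
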